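/- Let $n\ge 1$, let $\mathbb F_n$ be the free group on $a_1,\dots,a_n$, and let $G$ be its Cayley graph with respect to $a_1,\dots,a_n$ (a tree with edges $\{x,xa_j\}$), regarded as a one-dimensional simplicial complex on which $\mathbb F_n$ acts by left translation. For a locally finite simplicial complex let $l^p(\Delta_m)$ be the space of complex functions $f(v_0,\dots,v_m)$ on the tuples that span an $m$-simplex which are antisymmetric in $v_0,\dots,v_m$ and have finite norm $\|f\|_p=\big(\sum |f(v_0,\dots,v_m)|^p\big)^{1/p}$, with one summand for each $m$-simplex. Put $(\delta f)(v_0,\dots,v_{m+1})=\sum_j(-1)^jf(v_0,\dots,\widehat{v_j},\dots,v_{m+1})$ and $(\partial f)(v_0,\dots,v_m)=\sum_x f(v_0,\dots,v_m,x)$, where $x$ ranges over the vertices for which $v_0,\dots,v_m,x$ span a simplex. For $m\geq 1$ and $1\le p<\infty$ the spaces $$H^m_{l^p}(\mathbb F_n)=\frac{\ker\delta\cap l^p(\Delta_m)}{\overline{\delta(l^p(\Delta_{m-1}))}},\qquad H_m^{l^p}(\mathbb F_n)=\frac{\ker\partial\cap l^p(\Delta_m)}{\overline{\partial(l^p(\Delta_{m+1}))}}$$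 are formed on $G$ and carry the quotient norms and the actions induced by left translation. Let $\Sigma=(\sigma_i\colon\Gamma\to S_{d_i})_{i\in\mathbb N}$ be a sofic approximation of a group $\Gamma$: $\sigma_i(e)=1$, $d_{\rm Hamm}(\sigma_i(gh),\sigma_i(g)\sigma_i(h))\to0$ for all $g,h$, and $d_{\rm Hamm}(\sigma_i(g),\sigma_i(h))\to1$ for $g\neq h$, where $d_{\rm Hamm}(\sigma,\tau)=\frac1d|\{j:\sigma(j)\ne\tau(j)\}|$ on $S_d$. Let $\Gamma$ act on a Banach space $X$ by uniformly bounded linear maps. Let $S=(x_j)_{j\ge1}$ be a bounded sequence in $X$ that is dynamically generating, i.e. the vectors $gx_j$ span a dense subspace, and let $\rho$ be a product norm, i.e. a norm on $l^\infty(\mathbb N)$ with $\rho(f)\le\rho(g)$ whenever $|f|\le|g|$, which induces the topology of pointwise convergence on the unit ball. For $F\subseteq\Gamma$ finite with $e\in F$, $m\in\mathbb N$ and $\eta>0$ let $X_{F,m}=\mathrm{span}\{g_1\cdots g_kx_j: g_1,\dots,g_k\in F,\ 1\le j,k\le m\}$, and let $\mathrm{Hom}_{\Gamma,p}(S,F,m,\eta,\sigma_i)$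 be the set of linear maps $T\colon X_{F,m}\to l^p(d_i)$ with $\|T\|\le1$ and $\|T(g_1\cdots g_kx_j)-\sigma_i(g_1)\cdots\sigma_i(g_k)T(x_j)\|<\eta$ for all $g_1,\dots,g_k\in F$, $1\le j,k\le m$, where $S_{d_i}$ acts on $l^p(d_i)$ by permutations. Let $\alpha_S(T)=(T(x_1),\dots,T(x_m),0,0,\dots)\in l^\infty(\mathbb N,l^p(d_i))$, and let $d_\varepsilon(A)$ be the smallest dimension of a linear subspace $W$ of $l^\infty(\mathbb N,l^p(d_i))$ such that each $x\in A$ admits a $w\in W$ with $\rho\big((\|x(k)-w(k)\|)_k\big)<\varepsilon$. Set $$\dim_{\Sigma,l^p}(S,\rho)=\sup_{\varepsilon>0}\ \limsup_{(F,m,\eta)}\ \limsup_{i\to\infty}\ \frac1{d_i}\,d_\varepsilon\big(\alpha_S(\mathrm{Hom}_{\Gamma,p}(S,F,m,\eta,\sigma_i))\big)\in[0,\infty],$$ where $F$ and $m$ increase and $\eta$ decreases to $0$, and let $\underline{\dim}_{\Sigma,l^p}(S,\rho)$ be defined in the same way with $\liminf_{i\to\infty}$ in place of $\limsup_{i\to\infty}$.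 We write $\dim_{\Sigma,l^p}(X,\Gamma)=r$ if bounded dynamically generating sequences and product norms exist and $\dim_{\Sigma,l^p}(S,\rho)=r$ for all of them; similarly for $\underline{\dim}_{\Sigma,l^p}(X,\Gamma)$. **Theorem.** Let $n\ge1$ and let $\Sigma$ be any sofic approximation of $\mathbb F_n$. (a) For $1\le p\le2$, $$\dim_{\Sigma,l^p}(H^1_{l^p}(\mathbb F_n),\mathbb F_n)=\underline{\dim}_{\Sigma,l^p}(H^1_{l^p}(\mathbb F_n),\mathbb F_n)=n-1.$$ (b) For $1<p<2$, $$\dim_{\Sigma,l^p}(H_1^{l^p}(\mathbb F_n),\mathbb F_n)=\underline{\dim}_{\Sigma,l^p}(H_1^{l^p}(\mathbb F_n),\mathbb F_n)=n-1.$$ (c) $\ker(\partial)\cap l^1(\Delta_1)=\{0\}$, and hence $H_1^{l^1}(\mathbb F_n)=\{0\}$. (d) For $1\le p<\infty$ and $m\ge2$, $H^m_{l^p}(\mathbb F_n)=\{0\}$ and $H_m^{l^p}(\mathbb F_n)=\{0\}$. -/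

import Mathlib

open Filter Topology
open scoped ENNReal

noncomputable section

namespace LpBetti

/-! ## Sofic approximations -/

/-- The normalized Hamming distance `(1/n) |{j : σ j ≠ τ j}|` on the symmetric group `S_n`. -/
def hamming {n : ℕ} (σ τ : Equiv.Perm (Fin n)) : ℝ :=
  ((Finset.univ.filter fun j => σ j ≠ τ j).card : ℝ) / n

/-- A sofic approximation of `Γ`: maps `σ_i : Γ → S_{d_i}`, not assumed to be homomorphisms, which
are asymptotically multiplicative and asymptotically free in the Hamming distance. -/
structure SoficApproximation (Γ : Type*) [Group Γ] where
  d : ℕ → ℕ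
  σ : ∀ i, Γ → Equiv.Perm (Fin (d i))
  map_one : ∀ i, σ i 1 = 1
  tendsto_mul : ∀ g h : Γ,
    Tendsto (fun i => hamming (σ i (g * h)) (σ i g * σ i h)) atTop (𝓝 0)
  tendsto_ne : ∀ g h : Γ, g ≠ h →
    Tendsto (fun i => hamming (σ i g) (σ i h)) atTop (𝓝 1)

/-! ## Product norms and `ε`-dimension -/

/-- A product norm on `l^∞(ℕ)`: a norm that is monotone in the modulus and induces the topology of
pointwise convergence on the unit ball (both topologies on the ball are metrizable, so that it is
enough to compare convergent sequences). -/
structure ProductNorm where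
  toSeminorm : Seminorm ℂ (lp (fun _ : ℕ => ℂ) ∞)
  eq_zero : ∀ f, toSeminorm f = 0 → f = 0
  mono : ∀ f g : lp (fun _ : ℕ => ℂ) ∞, (∀ k, ‖f k‖ ≤ ‖g k‖) → toSeminorm f ≤ toSeminorm g
  tendsto_iff : ∀ (u : ℕ → lp (fun _ : ℕ => ℂ) ∞) (f : lp (fun _ : ℕ => ℂ) ∞),
    (∀ i, ‖u i‖ ≤ 1) → ‖f‖ ≤ 1 →
      (Tendsto (fun i => toSeminorm (u i - f)) atTop (𝓝 0) ↔
        ∀ k, Tendsto (fun i => u i k) atTop (𝓝 (f k)))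

/-- The sequence `‖f‖ = (‖f k‖)_k` in `l^∞(ℕ)`, for `f` in `l^∞(ℕ, V)`. -/
def normSeq {V : Type*} [NormedAddCommGroup V] (f : lp (fun _ : ℕ => V) ∞) :
    lp (fun _ : ℕ => ℂ) ∞ :=
  ⟨fun k => ((‖f k‖ : ℝ) : ℂ), by
    have h := memℓp_infty_iff.1 (lp.memℓp f)
    refine memℓp_infty_iff.2 ?_
    simpa using h⟩

/-- `ρ_V(f) = ρ(‖f‖)` on `l^∞(ℕ, V)`. -/
def ProductNorm.onSeq (ρ : ProductNorm) {V : Type*} [NormedAddCommGroup V]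
    (f : lp (fun _ : ℕ => V) ∞) : ℝ :=
  ρ.toSeminorm (normSeq f)

/-- `d_ε(A, ρ)`: the smallest dimension of a linear subspace `W` that `ε`-contains `A` with respect
to the (pseudo)norm `ρ`. -/
def epsDim {E : Type*} [AddCommGroup E] [Module ℂ E] (ρ : E → ℝ) (ε : ℝ) (A : Set E) : ℕ :=
  sInf {k | ∃ W : Submodule ℂ E, FiniteDimensional ℂ W ∧ Module.finrank ℂ W = k ∧
    ∀ x ∈ A, ∃ w ∈ W, ρ (x - w) < ε}

/-! ## The `l^p`-dimension of a representation -/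

/-- The permutation action of `τ ∈ S_n` on `l^p(n)`: `(τ ξ)(j) = ξ(τ⁻¹ j)`. -/
def permAct (p : ℝ≥0∞) [Fact (1 ≤ p)] {n : ℕ} (τ : Equiv.Perm (Fin n)) :
    PiLp p (fun _ : Fin n => ℂ) ≃ₗᵢ[ℂ] PiLp p (fun _ : Fin n => ℂ) :=
  LinearIsometryEquiv.piLpCongrLeft p ℂ ℂ τ

section Dimension

variable {Γ : Type*} [Group Γ] {X : Type*} [NormedAddCommGroup X] [NormedSpace ℂ X]

/-- `w` is a word `(g_1, …, g_k)` in letters of `F`, with `1 ≤ k ≤ m`. -/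
def IsWord (F : Finset Γ) (m : ℕ) (w : List Γ) : Prop :=
  1 ≤ w.length ∧ w.length ≤ m ∧ ∀ g ∈ w, g ∈ F

/-- `X_{F,m}`, the span of the vectors `g_1 ⋯ g_k x_j` with `g_1, …, g_k ∈ F`, `1 ≤ k ≤ m` and `x_j`
among the first `m` terms of the sequence `S`. -/
def spanFM (π : Representation ℂ Γ X) (S : ℕ → X) (F : Finset Γ) (m : ℕ) : Submodule ℂ X :=
  Submodule.span ℂ {y | ∃ w j, IsWord F m w ∧ j < m ∧ y = π w.prod (S j)}

/-- The value of `T` at `x`, for `x` in the domain of `T` (and `0` outside it). As soon as `1 ∈ F`,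
the domain `X_{F,m}` contains all the vectors at which the maps `T : X_{F,m} → V` are evaluated
below. -/
def evalAt {V : Type*} [NormedAddCommGroup V] [NormedSpace ℂ V] {D : Submodule ℂ X}
    (T : D →L[ℂ] V) (x : X) : V :=
  open Classical in if h : x ∈ D then T ⟨x, h⟩ else 0

/-- `Hom_Γ(S, F, m, δ, σ)`: the linear contractions `T : X_{F,m} → l^p(n)` such that
`‖T(g_1 ⋯ g_k x_j) - σ(g_1) ⋯ σ(g_k) T(x_j)‖ < δ` for all `g_1, …, g_k ∈ F`, `1 ≤ j, k ≤ m`. -/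
def almostEquivariant (p : ℝ≥0∞) [Fact (1 ≤ p)] (π : Representation ℂ Γ X) (S : ℕ → X)
    (F : Finset Γ) (m : ℕ) (δ : ℝ) {n : ℕ} (σ : Γ → Equiv.Perm (Fin n)) :
    Set (spanFM π S F m →L[ℂ] PiLp p (fun _ : Fin n => ℂ)) :=
  {T | ‖T‖ ≤ 1 ∧ ∀ w j, IsWord F m w → j < m →
    ‖evalAt T (π w.prod (S j)) - permAct p (w.map σ).prod (evalAt T (S j))‖ < δ}

/-- `α_S(T)`: the sequence in `l^∞(ℕ, V)` with terms `T(x_j)` for the first `m` indices `j`, and `0`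
for all the others. -/
def evalSeq {V : Type*} [NormedAddCommGroup V] [NormedSpace ℂ V] {D : Submodule ℂ X}
    (S : ℕ → X) (m : ℕ) (T : D →L[ℂ] V) : lp (fun _ : ℕ => V) ∞ :=
  ⟨fun j => if j < m then evalAt T (S j) else 0, by
    change Memℓp (fun j => if j < m then evalAt T (S j) else 0) ∞
    refine Memℓp.of_exponent_ge (q := 0) (memℓp_zero ?_) bot_le
    refine (Set.finite_lt_nat m).subset fun j hj => ?_
    by_contra h
    exact hj (if_neg h)⟩

/-- `(1 / dim V_i) d_ε(α_S(Hom_Γ(S, F, m, δ, σ_i)), ρ_{V_i})` for `V_i = l^p(d_i)`. -/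
def relDim (p : ℝ≥0∞) [Fact (1 ≤ p)] (A : SoficApproximation Γ) (π : Representation ℂ Γ X)
    (S : ℕ → X) (ρ : ProductNorm) (ε : ℝ) (F : Finset Γ) (m : ℕ) (δ : ℝ) (i : ℕ) : ℝ≥0∞ :=
  (epsDim ρ.onSeq ε (evalSeq S m '' almostEquivariant p π S F m δ (A.σ i)) : ℝ≥0∞) / A.d i

/-- The directed set of triples `(F, m, δ)`: `F` and `m` increase, `δ > 0` decreases to `0`. -/
def tripleFilter (Γ : Type*) : Filter (Finset Γ × ℕ × ℝ) :=
  atTop ×ˢ (atTop ×ˢ 𝓝[>] (0 : ℝ))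

/-- `dim_{Σ,l^p}(S, ρ)`, the supremum over `ε > 0` of the upper limit over `(F, m, δ)` of the upper
limit over `i`. -/
def upperDim (p : ℝ≥0∞) [Fact (1 ≤ p)] (A : SoficApproximation Γ) (π : Representation ℂ Γ X)
    (S : ℕ → X) (ρ : ProductNorm) : ℝ≥0∞ :=
  ⨆ (ε : ℝ) (_ : 0 < ε), limsup (fun t : Finset Γ × ℕ × ℝ =>
    limsup (fun i => relDim p A π S ρ ε t.1 t.2.1 t.2.2 i) atTop) (tripleFilter Γ)

/-- The lower dimension of `(S, ρ)`: the upper limit over `i` is replaced by the lower limit. -/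
def lowerDim (p : ℝ≥0∞) [Fact (1 ≤ p)] (A : SoficApproximation Γ) (π : Representation ℂ Γ X)
    (S : ℕ → X) (ρ : ProductNorm) : ℝ≥0∞ :=
  ⨆ (ε : ℝ) (_ : 0 < ε), limsup (fun t : Finset Γ × ℕ × ℝ =>
    liminf (fun i => relDim p A π S ρ ε t.1 t.2.1 t.2.2 i) atTop) (tripleFilter Γ)

/-- `S` is a bounded sequence in `X` that is dynamically generating: the translates of its terms
span a dense subspace. -/
def IsDynGenerating (π : Representation ℂ Γ X) (S : ℕ → X) : Prop :=
  (∃ C : ℝ, ∀ j, ‖S j‖ ≤ C) ∧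
    (Submodule.span ℂ {y | ∃ g j, y = π g (S j)}).topologicalClosure = ⊤

/-- `dim_{Σ,l^p}(X, Γ) = r`: the number `dim_{Σ,l^p}(S, ρ)` equals `r` whatever the bounded
dynamically generating sequence `S` and the product norm `ρ`, and there are such `S` and `ρ`. -/
def HasUpperDim (p : ℝ≥0∞) [Fact (1 ≤ p)] (A : SoficApproximation Γ) (π : Representation ℂ Γ X)
    (r : ℝ≥0∞) : Prop :=
  (∃ S, IsDynGenerating π S) ∧ Nonempty ProductNorm ∧
    ∀ S ρ, IsDynGenerating π S → upperDim p A π S ρ = r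

/-- The lower dimension of `X` equals `r`, in the same sense. -/
def HasLowerDim (p : ℝ≥0∞) [Fact (1 ≤ p)] (A : SoficApproximation Γ) (π : Representation ℂ Γ X)
    (r : ℝ≥0∞) : Prop :=
  (∃ S, IsDynGenerating π S) ∧ Nonempty ProductNorm ∧
    ∀ S ρ, IsDynGenerating π S → lowerDim p A π S ρ = r

end Dimension

/-! ## `l^p`-cohomology and `l^p`-homology of simplicial complexes -/

/-- A locally finite simplicial complex on the vertex set `V` on which `Γ` acts by simplicial
automorphisms. -/
structure GComplex (Γ V : Type*) [Group Γ] [MulAction Γ V] extends AbstractSimplicialComplex V where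
  smul_mem : ∀ (g : Γ), ∀ s ∈ faces, s.map (MulAction.toPerm g).toEmbedding ∈ faces
  locallyFinite : ∀ x : V, {s ∈ faces | x ∈ s}.Finite

section Cochains

variable {Γ V : Type*} [Group Γ] [MulAction Γ V]

/-- The tuples `(v_0, …, v_m)` that span an `m`-simplex of `K`. -/
def OrdSimplex (K : GComplex Γ V) (m : ℕ) : Type _ :=
  {v : Fin (m + 1) ↪ V // Finset.univ.map v ∈ K.faces}

namespace OrdSimplex

variable {K : GComplex Γ V} {m : ℕ}

/-- `(v_{τ 0}, …, v_{τ m})`. -/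
def perm (τ : Equiv.Perm (Fin (m + 1))) (v : OrdSimplex K m) : OrdSimplex K m :=
  ⟨τ.toEmbedding.trans v.1, by
    rw [← Finset.map_map, Finset.map_univ_equiv]
    exact v.2⟩

/-- `(v_0, …, v̂_j, …, v_{m+1})`, the `j`-th vertex omitted. -/
def face (j : Fin (m + 2)) (v : OrdSimplex K (m + 1)) : OrdSimplex K m :=
  ⟨(Fin.succAboveEmb j).trans v.1, by
    refine (K.isRelLowerSet_faces v.2).2 ?_ (by simp)
    rw [← Finset.map_map]
    exact Finset.map_subset_map.2 (Finset.subset_univ _)⟩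

/-- `(g v_0, …, g v_m)`. -/
def smul (g : Γ) (v : OrdSimplex K m) : OrdSimplex K m :=
  ⟨v.1.trans (MulAction.toPerm g).toEmbedding, by
    rw [← Finset.map_map]
    exact K.smul_mem g _ v.2⟩

instance : MulAction Γ (OrdSimplex K m) where
  smul := smul
  one_smul v := Subtype.ext (Function.Embedding.ext fun i => one_smul Γ (v.1 i))
  mul_smul g h v := Subtype.ext (Function.Embedding.ext fun i => mul_smul g h (v.1 i))

/-- There are finitely many simplices `(v_0, …, v_m, x)`. -/
theorem finite_extensions (v : OrdSimplex K m) :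
    {w : OrdSimplex K (m + 1) | w.face (Fin.last (m + 1)) = v}.Finite := by
  have hfin : (⋃ s ∈ {s ∈ K.faces | v.1 0 ∈ s}, (s : Set V)).Finite :=
    (K.locallyFinite (v.1 0)).biUnion fun s _ => s.finite_toSet
  refine Set.Finite.of_finite_image (f := fun w => w.1 (Fin.last (m + 1))) (hfin.subset ?_) ?_
  · rintro x ⟨w, hw, rfl⟩
    refine Set.mem_biUnion (x := Finset.univ.map w.1) ⟨w.2, ?_⟩ (by simp)
    rw [← (show w.face (Fin.last (m + 1)) = v from hw)]
    simp [face]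
  · intro w hw w' hw' h
    refine Subtype.ext (Function.Embedding.ext fun i => ?_)
    have hE : w.face (Fin.last (m + 1)) = w'.face (Fin.last (m + 1)) := Eq.trans hw (Eq.symm hw')
    refine Fin.lastCases h (fun i => ?_) i
    have := congrArg (fun u : OrdSimplex K m => u.1 i) hE
    simpa [face] using this

end OrdSimplex

set_option linter.unusedSectionVars false

variable (K : GComplex Γ V) (p : ℝ≥0∞) [Fact (1 ≤ p)] (m : ℕ)

/-- The antisymmetric functions in `l^p` of the set of ordered `m`-simplices. -/
def altSubmodule : Submodule ℂ (lp (fun _ : OrdSimplex K m => ℂ) p) where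
  carrier := {f | ∀ (τ : Equiv.Perm (Fin (m + 1))) (v : OrdSimplex K m),
    f (v.perm τ) = ((Equiv.Perm.sign τ : ℤ) : ℂ) * f v}
  add_mem' {f g} hf hg τ v := by simp [hf τ v, hg τ v, mul_add]
  zero_mem' τ v := by simp
  smul_mem' c f hf τ v := by simp [hf τ v, mul_left_comm]

/-- `l^p(Δ_m(K))`. -/
def LpCochain : Type _ := altSubmodule K p m

namespace LpCochain

instance : AddCommGroup (LpCochain K p m) := inferInstanceAs (AddCommGroup (altSubmodule K p m))
instance : Module ℂ (LpCochain K p m) := inferInstanceAs (Module ℂ (altSubmodule K p m))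

/-- The constant `((m+1)!)^{-1/p}`: every `m`-simplex carries `(m+1)!` orderings. -/
def normConst : ℝ := ((m + 1).factorial : ℝ) ^ (-(1 / p.toReal))

theorem normConst_pos (p : ℝ≥0∞) (m : ℕ) : 0 < normConst p m :=
  Real.rpow_pos_of_pos (by exact_mod_cast Nat.factorial_pos _) _

/-- `f ↦ ((m+1)!)^{-1/p} f`, into `l^p` of the set of ordered simplices. -/
def scaled : LpCochain K p m →ₗ[ℂ] lp (fun _ : OrdSimplex K m => ℂ) p :=
  ((normConst p m : ℝ) : ℂ) • (altSubmodule K p m).subtype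

theorem scaled_injective : Function.Injective (scaled K p m) := by
  intro f g h
  have hc : ((normConst p m : ℝ) : ℂ) ≠ 0 := by exact_mod_cast (normConst_pos p m).ne'
  exact Subtype.ext (smul_right_injective _ hc h)

/-- The norm `‖f‖_p = (∑ |f(v_0, …, v_m)|^p)^{1/p}`, with one summand for each (unordered) simplex
`[v_0, …, v_m]`: the `p`-th power of the norm is the sum over all ordered simplices, divided by
`(m+1)!`. -/
instance : NormedAddCommGroup (LpCochain K p m) :=
  NormedAddCommGroup.induced _ _ (scaled K p m) (scaled_injective K p m)

instance : NormedSpace ℂ (LpCochain K p m) := NormedSpace.induced ℂ _ _ (scaled K p m)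

variable {K p m} in
theorem norm_def (f : LpCochain K p m) :
    ‖f‖ = normConst p m * ‖(f.1 : lp (fun _ : OrdSimplex K m => ℂ) p)‖ := by
  change ‖((normConst p m : ℝ) : ℂ) • f.1‖ = _
  rw [norm_smul, Complex.norm_real, Real.norm_of_nonneg (normConst_pos p m).le]

/-- The underlying function on ordered simplices. -/
def fn : LpCochain K p m →ₗ[ℂ] (OrdSimplex K m → ℂ) where
  toFun f v := f.1 v
  map_add' _ _ := rfl
  map_smul' _ _ := rfl

end LpCochain

/-- `(δ f)(v_0, …, v_{m+1}) = ∑_j (-1)^j f(v_0, …, v̂_j, …, v_{m+1})`. -/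
def coboundary : (OrdSimplex K m → ℂ) →ₗ[ℂ] (OrdSimplex K (m + 1) → ℂ) where
  toFun f v := ∑ j : Fin (m + 2), (-1 : ℂ) ^ (j : ℕ) * f (v.face j)
  map_add' f g := by ext v; simp [mul_add, Finset.sum_add_distrib]
  map_smul' c f := by ext v; simp [Finset.mul_sum, mul_left_comm]

/-- `(∂ f)(v_0, …, v_m) = ∑_x f(v_0, …, v_m, x)`, over all `x` such that `v_0, …, v_m, x` span a
simplex. -/
def boundary : (OrdSimplex K (m + 1) → ℂ) →ₗ[ℂ] (OrdSimplex K m → ℂ) where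
  toFun f v := ∑ w ∈ v.finite_extensions.toFinset, f w
  map_add' f g := by ext v; simp [Finset.sum_add_distrib]
  map_smul' c f := by ext v; simp [Finset.mul_sum]

/-- `ker δ ∩ l^p(Δ_m)`. -/
def cocycles : Submodule ℂ (LpCochain K p m) :=
  LinearMap.ker (coboundary K m ∘ₗ LpCochain.fn K p m)

/-- `δ(l^p(Δ_{m-1}))` inside `l^p(Δ_m)` (and `0` for `m = 0`). -/
def coboundaries : ∀ m : ℕ, Submodule ℂ (LpCochain K p m)
  | 0 => ⊥
  | m + 1 => (LinearMap.range (coboundary K m ∘ₗ LpCochain.fn K p m)).comap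
      (LpCochain.fn K p (m + 1))

/-- `ker ∂ ∩ l^p(Δ_m)` (and all of `l^p(Δ_0)` for `m = 0`). -/
def cycles : ∀ m : ℕ, Submodule ℂ (LpCochain K p m)
  | 0 => ⊤
  | m + 1 => LinearMap.ker (boundary K m ∘ₗ LpCochain.fn K p (m + 1))

/-- `∂(l^p(Δ_{m+1}))` inside `l^p(Δ_m)`. -/
def boundaries : Submodule ℂ (LpCochain K p m) :=
  (LinearMap.range (boundary K m ∘ₗ LpCochain.fn K p (m + 1))).comap (LpCochain.fn K p m)

/-- The quotient `Z / (Z ∩ B̄)` of a space of (co)cycles by the closure of the (co)boundaries. -/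
abbrev ReducedQuotient {E : Type*} [NormedAddCommGroup E] [NormedSpace ℂ E]
    (Z B : Submodule ℂ E) : Type _ :=
  Z ⧸ B.topologicalClosure.comap Z.subtype

instance {E : Type*} [NormedAddCommGroup E] [NormedSpace ℂ E] (Z B : Submodule ℂ E) :
    IsClosed (B.topologicalClosure.comap Z.subtype : Set Z) :=
  B.isClosed_topologicalClosure.preimage continuous_subtype_val

/-- The reduced `l^p`-cohomology `H^m_{l^p}(K)`. -/
abbrev LpCohomology : Type _ := ReducedQuotient (cocycles K p m) (coboundaries K p m)

/-- The reduced `l^p`-homology `H_m^{l^p}(K)`. -/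
abbrev LpHomology : Type _ := ReducedQuotient (cycles K p m) (boundaries K p m)

/-! ### The action of `Γ` by left translation -/

section Action

variable {p}

theorem memLp_comp_equiv {ι : Type*} (e : ι ≃ ι) {f : ι → ℂ} (hf : Memℓp f p) :
    Memℓp (f ∘ e) p := by
  rcases p.trichotomy with rfl | rfl | h
  · exact absurd (Fact.out : (1 : ℝ≥0∞) ≤ 0) (by simp)
  · rw [memℓp_infty_iff] at hf ⊢
    refine hf.mono ?_
    rintro _ ⟨i, rfl⟩
    exact ⟨e i, rfl⟩
  · rw [memℓp_gen_iff h] at hf ⊢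
    exact (e.summable_iff (f := fun i => ‖f i‖ ^ p.toReal)).2 hf

theorem norm_comp_equiv {ι : Type*} (e : ι ≃ ι) (f : lp (fun _ : ι => ℂ) p) :
    ‖(⟨f ∘ e, memLp_comp_equiv e (lp.memℓp f)⟩ : lp (fun _ : ι => ℂ) p)‖ = ‖f‖ := by
  rcases p.trichotomy with rfl | rfl | h
  · exact absurd (Fact.out : (1 : ℝ≥0∞) ≤ 0) (by simp)
  · rw [lp.norm_eq_ciSup, lp.norm_eq_ciSup]
    exact e.iSup_comp (g := fun i => ‖f i‖)
  · rw [lp.norm_eq_tsum_rpow h, lp.norm_eq_tsum_rpow h]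
    congr 1
    exact e.tsum_eq (fun i => ‖f i‖ ^ p.toReal)

variable (p)

/-- `(g f)(v_0, …, v_m) = f(g⁻¹ v_0, …, g⁻¹ v_m)` on `l^p(Δ_m(K))`. -/
def translation : Representation ℂ Γ (LpCochain K p m) where
  toFun g :=
    { toFun := fun f => ⟨⟨fun v => f.1 (g⁻¹ • v),
          memLp_comp_equiv (MulAction.toPerm g⁻¹) (lp.memℓp f.1)⟩,
        fun τ v => f.2 τ (g⁻¹ • v)⟩
      map_add' := fun _ _ => rfl
      map_smul' := fun _ _ => rfl }
  map_one' := by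
    refine LinearMap.ext fun f => Subtype.ext (lp.ext (funext fun v => ?_))
    change f.1 ((1 : Γ)⁻¹ • v) = f.1 v
    rw [inv_one, one_smul]
  map_mul' g h := by
    refine LinearMap.ext fun f => Subtype.ext (lp.ext (funext fun v => ?_))
    change f.1 ((g * h)⁻¹ • v) = f.1 (h⁻¹ • g⁻¹ • v)
    rw [mul_inv_rev, mul_smul]

theorem fn_translation (g : Γ) (f : LpCochain K p m) (v : OrdSimplex K m) :
    LpCochain.fn K p m (translation K p m g f) v = LpCochain.fn K p m f (g⁻¹ • v) := rfl

theorem norm_translation (g : Γ) (f : LpCochain K p m) : ‖translation K p m g f‖ = ‖f‖ := by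
  rw [LpCochain.norm_def, LpCochain.norm_def]
  congr 1
  exact norm_comp_equiv (MulAction.toPerm g⁻¹) f.1

theorem continuous_translation (g : Γ) : Continuous (translation K p m g) :=
  AddMonoidHomClass.continuous_of_bound (translation K p m g) 1 fun f => by
    rw [norm_translation, one_mul]

variable {m} in
theorem coboundary_smul (g : Γ) (f : OrdSimplex K m → ℂ) (v : OrdSimplex K (m + 1)) :
    coboundary K m (fun u => f (g • u)) v = coboundary K m f (g • v) := rfl

variable {m} in
theorem boundary_smul (g : Γ) (f : OrdSimplex K (m + 1) → ℂ) (v : OrdSimplex K m) :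
    boundary K m (fun u => f (g • u)) v = boundary K m f (g • v) := by
  change ∑ w ∈ v.finite_extensions.toFinset, f (g • w) =
    ∑ w ∈ (g • v).finite_extensions.toFinset, f w
  refine Finset.sum_equiv (MulAction.toPerm g) (fun w => ?_) (fun w _ => rfl)
  simp only [Set.Finite.mem_toFinset, Set.mem_ofPred_eq, MulAction.toPerm_apply]
  exact (smul_left_cancel_iff (α := Γ) g (x := w.face (Fin.last (m + 1))) (y := v)).symm

theorem cocycles_invariant (g : Γ) :
    cocycles K p m ≤ (cocycles K p m).comap (translation K p m g) := by
  intro f hf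
  have hf' : coboundary K m (LpCochain.fn K p m f) = 0 := hf
  change coboundary K m (LpCochain.fn K p m (translation K p m g f)) = 0
  funext v
  exact (coboundary_smul K g⁻¹ (LpCochain.fn K p m f) v).trans (congrFun hf' _)

theorem coboundaries_invariant (g : Γ) :
    coboundaries K p m ≤ (coboundaries K p m).comap (translation K p m g) := by
  cases m with
  | zero => simp [coboundaries]
  | succ m =>
    rintro f ⟨h, hh⟩
    refine ⟨translation K p m g h, funext fun v => ?_⟩
    exact (coboundary_smul K g⁻¹ (LpCochain.fn K p m h) v).trans (congrFun hh _)

theorem cycles_invariant (g : Γ) :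
    cycles K p m ≤ (cycles K p m).comap (translation K p m g) := by
  cases m with
  | zero => simp [cycles]
  | succ m =>
    intro f hf
    have hf' : boundary K m (LpCochain.fn K p (m + 1) f) = 0 := hf
    change boundary K m (LpCochain.fn K p (m + 1) (translation K p (m + 1) g f)) = 0
    funext v
    exact (boundary_smul K g⁻¹ (LpCochain.fn K p (m + 1) f) v).trans (congrFun hf' _)

theorem boundaries_invariant (g : Γ) :
    boundaries K p m ≤ (boundaries K p m).comap (translation K p m g) := by
  rintro f ⟨h, hh⟩
  refine ⟨translation K p (m + 1) g h, funext fun v => ?_⟩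
  exact (boundary_smul K g⁻¹ (LpCochain.fn K p (m + 1) h) v).trans (congrFun hh _)

/-- The representation induced on `Z / (Z ∩ B̄)` by a representation that acts continuously and
leaves `Z` and `B` invariant. -/
def reducedRep {E : Type*} [NormedAddCommGroup E] [NormedSpace ℂ E] (π : Representation ℂ Γ E)
    (hπ : ∀ g, Continuous (π g)) (Z B : Submodule ℂ E) (hZ : ∀ g, Z ≤ Z.comap (π g))
    (hB : ∀ g, B ≤ B.comap (π g)) : Representation ℂ Γ (ReducedQuotient Z B) :=
  (π.subrepresentation Z hZ).quotient (B.topologicalClosure.comap Z.subtype) fun g x hx => by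
    have hx' : (x : E) ∈ closure (B : Set E) := hx
    have h : π g x ∈ closure (B : Set E) := map_mem_closure (hπ g) hx' fun _ hy => hB g hy
    exact h

/-- The action of `Γ` on `H^m_{l^p}(K)`. -/
def cohomologyRep : Representation ℂ Γ (LpCohomology K p m) :=
  reducedRep (translation K p m) (continuous_translation K p m) _ _
    (cocycles_invariant K p m) (coboundaries_invariant K p m)

/-- The action of `Γ` on `H_m^{l^p}(K)`. -/
def homologyRep : Representation ℂ Γ (LpHomology K p m) :=
  reducedRep (translation K p m) (continuous_translation K p m) _ _
    (cycles_invariant K p m) (boundaries_invariant K p m)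

end Action

end Cochains

/-! ## The Cayley graph of the free group -/

/-- The Cayley graph of the free group `F_n` with respect to its free generators `a_1, …, a_n`, as a
one-dimensional simplicial complex with the action of `F_n` by left translation. Its simplices are
the vertices `{x}` and the edges `{x, x a_j}`. -/
def cayleyComplex (n : ℕ) : GComplex (FreeGroup (Fin n)) (FreeGroup (Fin n)) where
  faces := {s | (∃ x, s = {x}) ∨ ∃ x j, s = {x, x * FreeGroup.of j}}
  isRelLowerSet_faces := by
    rintro s hs
    refine ⟨?_, ?_⟩
    · rcases hs with ⟨x, rfl⟩ | ⟨x, j, rfl⟩ <;> simp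
    · intro t hts ht
      have hts' : t ⊆ s := hts
      rcases hs with ⟨x, rfl⟩ | ⟨x, j, rfl⟩
      · exact Or.inl ⟨x, (Finset.subset_singleton_iff.1 hts').resolve_left ht.ne_empty⟩
      · by_cases h1 : x ∈ t <;> by_cases h2 : x * FreeGroup.of j ∈ t
        · exact Or.inr ⟨x, j, hts'.antisymm (by
            simp [Finset.insert_subset_iff, h1, h2])⟩
        · exact Or.inl ⟨x, by grind⟩
        · exact Or.inl ⟨x * FreeGroup.of j, by grind⟩
        · obtain ⟨y, hy⟩ := ht
          have := hts' hy
          grind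
  singleton_mem x := Or.inl ⟨x, rfl⟩
  smul_mem := by
    rintro g s (⟨x, rfl⟩ | ⟨x, j, rfl⟩)
    · exact Or.inl ⟨g * x, by simp⟩
    · exact Or.inr ⟨g * x, j, by
        simp [Finset.map_insert, mul_assoc]⟩
  locallyFinite := by
    intro x
    refine Set.Finite.subset ((Set.finite_singleton ({x} : Finset (FreeGroup (Fin n)))).union
      ((Set.finite_range fun j => ({x, x * FreeGroup.of j} : Finset (FreeGroup (Fin n)))).union
        (Set.finite_range fun j =>
          ({x * (FreeGroup.of j)⁻¹, x} : Finset (FreeGroup (Fin n)))))) ?_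
    rintro s ⟨⟨y, rfl⟩ | ⟨y, j, rfl⟩, hx⟩
    · rw [Finset.mem_singleton] at hx
      exact Or.inl (by rw [hx]; rfl)
    · rw [Finset.mem_insert, Finset.mem_singleton] at hx
      rcases hx with rfl | rfl
      · exact Or.inr (Or.inl ⟨j, rfl⟩)
      · exact Or.inr (Or.inr ⟨j, by simp⟩)

end LpBetti

end

/-!
The Cayley graph of the free group `Γ` on `a_1, …, a_n` is a tree, so that a `1`-cochain is an
arbitrary family `(f_1, …, f_n)` in `l^p(Γ)^n`, `f_j` being its restriction to the edges
`(g, g a_j)`; there are no simplices of dimension two or more.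

*Upper bounds.* If finitely many vectors `e_j` generate the representation and satisfy a relation,
then an almost equivariant map is determined, up to small errors, by the images of the `e_j`, which
form an approximate solution of the same relation in `l^p(d_i)` (`upperDim_le_of_model`). The
classes of the edges at `1` generate the cohomology, and satisfy `∑_j (a_j⁻¹ e_j - e_j) = 0`, the
coboundary of the indicator function of a vertex. By a Rokhlin argument for the single permutation
`σ_i(a_1⁻¹)`, this relation can be solved for one of its `n` components, with control of the errors,
on the complement of a small set (`cycleRel_model`). This leaves dimension about `(n - 1) d_i`.

*Lower bounds.* A bounded equivariant map to `l^p(Γ)^N` with the standard basis vectors in its image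
gives the lower bound `N` if `p ≤ 2` (`le_lowerDim_of_lpMap`): the regular representation can be
copied to `l^p(d_i)` near most points, and a subspace that is close in `l^2` to most basis vectors
has almost full dimension. For `p > 1` and `n ≥ 2` such maps with `N = n - 1` come from the
averaging operator `M = n⁻¹ ∑_j R_j` of right translations by the `a_j`, or by the `a_j⁻¹`: `1 - M`
is invertible on `l^p(Γ)` (`isUnit_one_sub_avg`), since `M = U + D` with `D U = 0`, `‖U‖ < 1` and
`‖D‖ < 1`, where `U` lengthens and `D` shortens words. Hence every cohomology class has a unique
representative with `∑_j f_j = 0`, and a flow, that is, an element of `ker ∂`, is determined by the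
differences `f_j - f_n`, which are arbitrary. In particular the homology is generated by `n - 1`
vectors, which gives its upper bound.

For `p = 1` the operator `1 - M` is not invertible. Here the maps
`f ↦ ∑_{g, j} f_j(g) φ_i(g) ξ_j` are used, where `φ_i` is the homomorphism that agrees with `σ_i` on
the generators and `ξ` solves `∑_j (φ_i(a_j)⁻¹ ξ_j - ξ_j) = 0`; they vanish on coboundaries and are
contractions on `l^1` as soon as the `ξ_j` are in the unit ball. The solutions form a space of
dimension at least `(n - 1) d_i`, and the unit ball of a space for the `l^1`-norm is not close to a
space of much smaller dimension (`finrank_le_of_l1_close`), because each space of dimension `r`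
contains a vector of supremum norm at most one with `r` coordinates of modulus one.

Finally, the value of an `l^1`-flow at an edge is its total flux into one of the two halves of the
tree, which is zero since the divergence can be summed over that half (`cycles_one_eq_bot`).
-/

noncomputable section

namespace LpBetti

/-! ### Product norms -/

@[simp]
theorem normSeq_apply {V : Type*} [NormedAddCommGroup V] (f : lp (fun _ : ℕ => V) ∞) (k : ℕ) :
    normSeq f k = ((‖f k‖ : ℝ) : ℂ) := rfl

/-- The geometric sequence `2⁻ᵏ` in `l^∞(ℕ)`. -/
def geomSeq : lp (fun _ : ℕ => ℂ) ∞ :=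
  ⟨fun k => (1 / 2 : ℂ) ^ k, by
    refine memℓp_infty ⟨1, ?_⟩
    rintro _ ⟨k, rfl⟩
    simpa using pow_le_one₀ (by norm_num : (0 : ℝ) ≤ 2⁻¹) (by norm_num) (n := k)⟩

theorem geomSeq_apply (k : ℕ) : geomSeq k = (1 / 2 : ℂ) ^ k := rfl

theorem norm_geomSeq_mul_apply (f : lp (fun _ : ℕ => ℂ) ∞) (k : ℕ) :
    ‖(geomSeq * f) k‖ = (1 / 2 : ℝ) ^ k * ‖f k‖ := by
  rw [lp.infty_coeFn_mul, Pi.mul_apply, norm_mul, geomSeq_apply]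
  simp

/-- The weighted supremum norm `f ↦ sup_k 2⁻ᵏ |f k|`, realized as the norm of the product of `f`
with the geometric sequence. -/
def ProductNorm.geom : ProductNorm where
  toSeminorm :=
    Seminorm.of (fun f => ‖geomSeq * f‖)
      (fun f g => by rw [mul_add]; exact norm_add_le _ _)
      (fun c f => by rw [mul_smul_comm, norm_smul])
  eq_zero f hf := by
    have hf' : geomSeq * f = 0 := norm_eq_zero.1 hf
    refine lp.ext (funext fun k => ?_)
    have := congrArg (fun g : lp (fun _ : ℕ => ℂ) ∞ => ‖g k‖) hf'
    simpa [geomSeq_apply] using this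
  mono f g h := by
    change ‖geomSeq * f‖ ≤ ‖geomSeq * g‖
    refine lp.norm_le_of_forall_le (norm_nonneg _) fun k => ?_
    refine le_trans ?_ (lp.norm_apply_le_norm (by simp) (geomSeq * g) k)
    rw [norm_geomSeq_mul_apply, norm_geomSeq_mul_apply]
    exact mul_le_mul_of_nonneg_left (h k) (by positivity)
  tendsto_iff u f hu hf := by
    change Tendsto (fun i => ‖geomSeq * (u i - f)‖) atTop (𝓝 0) ↔ _
    constructor
    · intro h k
      rw [tendsto_iff_norm_sub_tendsto_zero]
      have h2 := h.const_mul ((2 : ℝ) ^ k)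
      rw [mul_zero] at h2
      refine squeeze_zero (fun _ => norm_nonneg _) (fun i => ?_) h2
      have h3 := lp.norm_apply_le_norm (by simp) (geomSeq * (u i - f)) k
      rw [norm_geomSeq_mul_apply] at h3
      calc ‖u i k - f k‖ = 2 ^ k * ((1 / 2 : ℝ) ^ k * ‖(u i - f) k‖) := by
            rw [← mul_assoc, ← mul_pow]; norm_num
        _ ≤ _ := mul_le_mul_of_nonneg_left h3 (by positivity)
    · intro h
      rw [Metric.tendsto_atTop]
      intro ε hε
      obtain ⟨K, hK⟩ := exists_pow_lt_of_lt_one (show (0 : ℝ) < ε / 4 by positivity)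
        (show (1 / 2 : ℝ) < 1 by norm_num)
      have hev : ∀ᶠ i in atTop, ∀ k ∈ Finset.range K, ‖u i k - f k‖ < ε / 2 := by
        rw [Filter.eventually_all_finset]
        intro k _
        exact (tendsto_iff_norm_sub_tendsto_zero.1 (h k)).eventually_lt_const (by positivity)
      obtain ⟨I, hI⟩ := eventually_atTop.1 hev
      refine ⟨I, fun i hi => ?_⟩
      rw [Real.dist_0_eq_abs, abs_of_nonneg (norm_nonneg _)]
      refine lt_of_le_of_lt (lp.norm_le_of_forall_le (C := ε / 2) (by positivity) fun k => ?_)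
        (by linarith)
      rw [norm_geomSeq_mul_apply]
      by_cases hk : k < K
      · calc (1 / 2 : ℝ) ^ k * ‖(u i - f) k‖ ≤ 1 * ‖(u i - f) k‖ := by
              gcongr
              exact pow_le_one₀ (by norm_num) (by norm_num)
          _ ≤ ε / 2 := by
              rw [one_mul]; exact (hI i hi k (Finset.mem_range.2 hk)).le
      · have h1 : (1 / 2 : ℝ) ^ k ≤ ε / 4 :=
          (pow_le_pow_of_le_one (by norm_num) (by norm_num) (not_lt.1 hk)).trans hK.le
        have h2 : ‖(u i - f) k‖ ≤ 2 := by
          calc _ ≤ ‖u i - f‖ := lp.norm_apply_le_norm (by simp) _ k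
            _ ≤ ‖u i‖ + ‖f‖ := norm_sub_le _ _
            _ ≤ 2 := by linarith [hu i]
        calc _ ≤ ε / 4 * 2 := mul_le_mul h1 h2 (norm_nonneg _) (by positivity)
          _ = ε / 2 := by ring

theorem ProductNorm.nonempty : Nonempty ProductNorm := ⟨ProductNorm.geom⟩

/-- A product norm is small on bounded sequences that are small in many coordinates. -/
theorem ProductNorm.exists_lt (ρ : ProductNorm) {C ε : ℝ} (hε : 0 < ε) :
    ∃ (K : ℕ) (θ : ℝ), 0 < θ ∧ ∀ f : lp (fun _ : ℕ => ℂ) ∞, (∀ k, ‖f k‖ ≤ C) →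
      (∀ k < K, ‖f k‖ ≤ θ) → ρ.toSeminorm f < ε := by
  by_contra! hcon
  have hpos : ∀ i : ℕ, (0 : ℝ) < 1 / ((i : ℝ) + 1) := fun i => Nat.one_div_pos_of_nat
  choose u hu1 hu2 hu3 using fun i : ℕ => hcon i (1 / ((i : ℝ) + 1)) (hpos i)
  have hC : 0 ≤ C := (norm_nonneg _).trans (hu1 0 0)
  have hC1 : 0 < C + 1 := by linarith
  -- rescale the sequence into the unit ball
  set v : ℕ → lp (fun _ : ℕ => ℂ) ∞ := fun i => ((C + 1 : ℝ) : ℂ)⁻¹ • u i with hv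
  have hnc : ‖((C + 1 : ℝ) : ℂ)⁻¹‖ = (C + 1)⁻¹ := by
    rw [norm_inv, Complex.norm_real, Real.norm_of_nonneg hC1.le]
  have hvn : ∀ i, ‖v i‖ ≤ 1 := fun i => by
    rw [hv, norm_smul, hnc, inv_mul_le_iff₀ hC1, mul_one]
    exact (lp.norm_le_of_forall_le hC (hu1 i)).trans (by linarith)
  have hlim : Tendsto (fun i => ρ.toSeminorm (v i - 0)) atTop (𝓝 0) := by
    refine (ρ.tendsto_iff v 0 hvn (by simp)).2 fun k => ?_
    rw [lp.coeFn_zero, Pi.zero_apply, tendsto_zero_iff_norm_tendsto_zero]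
    refine squeeze_zero' (Eventually.of_forall fun _ => norm_nonneg _) ?_
      (tendsto_one_div_add_atTop_nhds_zero_nat (𝕜 := ℝ))
    filter_upwards [eventually_gt_atTop k] with i hi
    rw [hv, lp.coeFn_smul, Pi.smul_apply, norm_smul, hnc]
    calc (C + 1)⁻¹ * ‖u i k‖ ≤ 1 * ‖u i k‖ := by
          gcongr; exact inv_le_one_of_one_le₀ (by linarith)
      _ ≤ _ := by rw [one_mul]; exact hu2 i k hi
  obtain ⟨i, hi⟩ := (hlim.eventually_lt_const (show 0 < (C + 1)⁻¹ * ε by positivity)).exists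
  rw [sub_zero, hv, map_smul_eq_mul, hnc] at hi
  exact absurd (lt_of_mul_lt_mul_left hi (by positivity)) (not_lt.2 (hu3 i))

/-- A product norm controls each coordinate. -/
theorem ProductNorm.exists_norm_apply_le (ρ : ProductNorm) (k : ℕ) :
    ∃ c : ℝ, 0 < c ∧ ∀ f : lp (fun _ : ℕ => ℂ) ∞, c * ‖f k‖ ≤ ρ.toSeminorm f := by
  refine ⟨ρ.toSeminorm (lp.single ∞ k 1), lt_of_le_of_ne (apply_nonneg _ _) fun h => ?_,
    fun f => ?_⟩
  · have := congrArg (fun g : lp (fun _ : ℕ => ℂ) ∞ => g k) (ρ.eq_zero _ h.symm)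
    simp at this
  · have : ρ.toSeminorm (lp.single ∞ k (f k)) = ρ.toSeminorm (lp.single ∞ k 1) * ‖f k‖ := by
      rw [mul_comm, ← map_smul_eq_mul, ← lp.single_smul]; simp
    rw [← this]
    refine ρ.mono _ _ fun j => ?_
    rcases eq_or_ne j k with rfl | hj
    · simp
    · rw [lp.single_apply_ne _ _ _ hj]; simp

/-! ### Almost equivariant maps -/

section OrbitComb

variable {Γ ι V : Type*} [NormedAddCommGroup V] [NormedSpace ℂ V]

/-- The combination `∑ u(g, j) α(g) ξ_j` of translates of a family `ξ`, as a linear function of the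
family. The maps `α(g)` need not form a representation: `α` may come from a sofic approximation. -/
def orbitComb (α : Γ → Module.End ℂ V) (u : Γ × ι →₀ ℂ) : (ι → V) →ₗ[ℂ] V :=
  u.sum fun gj c => c • (α gj.1 ∘ₗ LinearMap.proj gj.2)

theorem orbitComb_apply (α : Γ → Module.End ℂ V) (u : Γ × ι →₀ ℂ) (ξ : ι → V) :
    orbitComb α u ξ = u.sum fun gj c => c • α gj.1 (ξ gj.2) := by
  simp [orbitComb, Finsupp.sum, LinearMap.sum_apply]

@[simp]
theorem orbitComb_zero (α : Γ → Module.End ℂ V) : orbitComb (ι := ι) α 0 = 0 := by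
  simp [orbitComb]

theorem orbitComb_add (α : Γ → Module.End ℂ V) (u v : Γ × ι →₀ ℂ) :
    orbitComb α (u + v) = orbitComb α u + orbitComb α v :=
  Finsupp.sum_add_index' (by simp) (by simp [add_smul])

theorem orbitComb_single (α : Γ → Module.End ℂ V) (g : Γ) (j : ι) (c : ℂ) (ξ : ι → V) :
    orbitComb α (Finsupp.single (g, j) c) ξ = c • α g (ξ j) := by
  rw [orbitComb_apply, Finsupp.sum_single_index (by simp)]

theorem exists_orbitComb_eq (α : Γ → Module.End ℂ V) (e : ι → V) {v : V}
    (hv : v ∈ Submodule.span ℂ {y | ∃ g j, y = α g (e j)}) : ∃ u, v = orbitComb α u e := by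
  induction hv using Submodule.span_induction with
  | mem x hx =>
    obtain ⟨g, j, rfl⟩ := hx
    exact ⟨Finsupp.single (g, j) 1, by rw [orbitComb_single, one_smul]⟩
  | zero => exact ⟨0, by simp⟩
  | add x y _ _ hx hy =>
    obtain ⟨u, rfl⟩ := hx
    obtain ⟨v, rfl⟩ := hy
    exact ⟨u + v, by rw [orbitComb_add, LinearMap.add_apply]⟩
  | smul c x _ hx =>
    obtain ⟨u, rfl⟩ := hx
    refine ⟨c • u, ?_⟩
    rw [orbitComb_apply, orbitComb_apply, Finsupp.sum_smul_index (by simp), Finsupp.smul_sum]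
    simp [mul_smul]

theorem continuous_orbitComb (α : Γ → Module.End ℂ V) (hα : ∀ g, Continuous (α g))
    (u : Γ × ι →₀ ℂ) : Continuous (orbitComb α u) := by
  have : ⇑(orbitComb α u) = fun ξ => ∑ gj ∈ u.support, u gj • α gj.1 (ξ gj.2) := by
    funext ξ
    rw [orbitComb_apply, Finsupp.sum]
  rw [this]
  exact continuous_finsetSum _ fun gj _ =>
    continuous_const.smul ((hα gj.1).comp (continuous_apply gj.2))

theorem norm_orbitComb_le (α : Γ → Module.End ℂ V) (hα : ∀ g v, ‖α g v‖ ≤ ‖v‖)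
    (u : Γ × ι →₀ ℂ) (ξ : ι → V) {θ : ℝ}
    (hξ : ∀ gj ∈ u.support, ‖ξ gj.2‖ ≤ θ) :
    ‖orbitComb α u ξ‖ ≤ (u.sum fun _ c => ‖c‖) * θ := by
  rw [orbitComb_apply, Finsupp.sum, Finsupp.sum, Finset.sum_mul]
  refine (norm_sum_le _ _).trans (Finset.sum_le_sum fun gj hgj => ?_)
  rw [norm_smul]
  exact mul_le_mul_of_nonneg_left ((hα _ _).trans (hξ _ hgj)) (norm_nonneg _)

end OrbitComb

theorem permAct_apply (p : ℝ≥0∞) [Fact (1 ≤ p)] {n : ℕ} (τ : Equiv.Perm (Fin n))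
    (ξ : PiLp p (fun _ : Fin n => ℂ)) (x : Fin n) : permAct p τ ξ x = ξ (τ⁻¹ x) := rfl

theorem permAct_mul (p : ℝ≥0∞) [Fact (1 ≤ p)] {n : ℕ} (τ υ : Equiv.Perm (Fin n))
    (ξ : PiLp p (fun _ : Fin n => ℂ)) : permAct p (τ * υ) ξ = permAct p τ (permAct p υ ξ) := rfl

theorem permAct_one (p : ℝ≥0∞) [Fact (1 ≤ p)] {n : ℕ} (ξ : PiLp p (fun _ : Fin n => ℂ)) :
    permAct p 1 ξ = ξ := rfl

theorem permAct_single (p : ℝ≥0∞) [Fact (1 ≤ p)] {n : ℕ} (τ : Equiv.Perm (Fin n)) (x : Fin n)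
    (c : ℂ) : permAct p τ (PiLp.single p x c) = PiLp.single p (τ x) c := by
  ext y
  simp only [permAct_apply, PiLp.single_apply, Equiv.Perm.inv_eq_iff_eq]

/-- The operators on `l^p(n)` given by a map into the symmetric group. -/
def permEnd (p : ℝ≥0∞) [Fact (1 ≤ p)] {Γ : Type*} {n : ℕ} (σ : Γ → Equiv.Perm (Fin n)) (g : Γ) :
    Module.End ℂ (PiLp p (fun _ : Fin n => ℂ)) :=
  (permAct p (σ g)).toLinearEquiv.toLinearMap

@[simp]
theorem permEnd_apply (p : ℝ≥0∞) [Fact (1 ≤ p)] {Γ : Type*} {n : ℕ} (σ : Γ → Equiv.Perm (Fin n))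
    (g : Γ) (ξ : PiLp p (fun _ : Fin n => ℂ)) : permEnd p σ g ξ = permAct p (σ g) ξ := rfl

theorem norm_permEnd (p : ℝ≥0∞) [Fact (1 ≤ p)] {Γ : Type*} {n : ℕ} (σ : Γ → Equiv.Perm (Fin n))
    (g : Γ) (ξ : PiLp p (fun _ : Fin n => ℂ)) : ‖permEnd p σ g ξ‖ = ‖ξ‖ :=
  (permAct p (σ g)).norm_map ξ

section Eval

variable {X V : Type*} [NormedAddCommGroup X] [NormedSpace ℂ X] [NormedAddCommGroup V]
  [NormedSpace ℂ V] {D : Submodule ℂ X} (T : D →L[ℂ] V)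

theorem evalAt_of_mem {x : X} (hx : x ∈ D) : evalAt T x = T ⟨x, hx⟩ := dif_pos hx

theorem evalAt_zero : evalAt T 0 = 0 := by
  rw [evalAt_of_mem T D.zero_mem]
  exact map_zero T

theorem evalAt_add {x y : X} (hx : x ∈ D) (hy : y ∈ D) :
    evalAt T (x + y) = evalAt T x + evalAt T y := by
  rw [evalAt_of_mem T hx, evalAt_of_mem T hy, evalAt_of_mem T (D.add_mem hx hy), ← map_add]
  rfl

theorem evalAt_sub {x y : X} (hx : x ∈ D) (hy : y ∈ D) :
    evalAt T (x - y) = evalAt T x - evalAt T y := by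
  rw [evalAt_of_mem T hx, evalAt_of_mem T hy, evalAt_of_mem T (D.sub_mem hx hy), ← map_sub]
  rfl

theorem evalAt_smul (c : ℂ) {x : X} (hx : x ∈ D) : evalAt T (c • x) = c • evalAt T x := by
  rw [evalAt_of_mem T hx, evalAt_of_mem T (D.smul_mem c hx), ← map_smul]
  rfl

theorem norm_evalAt_le {T : D →L[ℂ] V} (hT : ‖T‖ ≤ 1) (x : X) : ‖evalAt T x‖ ≤ ‖x‖ := by
  by_cases hx : x ∈ D
  · rw [evalAt_of_mem T hx]
    exact T.le_of_opNorm_le_of_le hT le_rfl |>.trans (by simp)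
  · rw [evalAt, dif_neg hx, norm_zero]
    exact norm_nonneg x

end Eval

theorem eventually_tripleFilter {Γ : Type*} (F : Finset Γ) (m : ℕ) {δ : ℝ} (hδ : 0 < δ) :
    ∀ᶠ t in tripleFilter Γ, F ⊆ t.1 ∧ m ≤ t.2.1 ∧ 0 < t.2.2 ∧ t.2.2 < δ :=
  (eventually_ge_atTop F).prod_mk ((eventually_ge_atTop m).prod_mk
    (Ioo_mem_nhdsGT hδ)) |>.mono fun _ h => ⟨h.1, h.2.1, h.2.2.1, h.2.2.2⟩

instance {Γ : Type*} : (tripleFilter Γ).NeBot := by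
  unfold tripleFilter
  infer_instance

section Hom

variable {Γ : Type*} [Group Γ] {X : Type*} [NormedAddCommGroup X] [NormedSpace ℂ X]
  {p : ℝ≥0∞} [Fact (1 ≤ p)] {π : Representation ℂ Γ X} {S : ℕ → X}

theorem eventually_mem_spanFM {v : X} (hv : v ∈ Submodule.span ℂ {y | ∃ g j, y = π g (S j)}) :
    ∀ᶠ t in tripleFilter Γ, v ∈ spanFM π S t.1 t.2.1 := by
  induction hv using Submodule.span_induction with
  | mem x hx =>
    obtain ⟨g, j, rfl⟩ := hx
    filter_upwards [eventually_tripleFilter {g} (j + 1) one_pos] with t ht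
    refine Submodule.subset_span ⟨[g], j, ⟨le_rfl, ?_, ?_⟩, ?_, by simp⟩
    · simpa using (Nat.le_add_left 1 j).trans ht.2.1
    · simpa using ht.1
    · exact ht.2.1
  | zero => simp
  | add x y _ _ hx hy => filter_upwards [hx, hy] with t h1 h2 using Submodule.add_mem _ h1 h2
  | smul c x _ hx => filter_upwards [hx] with t h using Submodule.smul_mem _ c h

theorem map_mem_span_orbit {ι : Type*} {S : ι → X} (g : Γ) {v : X}
    (hv : v ∈ Submodule.span ℂ {y | ∃ g j, y = π g (S j)}) :
    π g v ∈ Submodule.span ℂ {y | ∃ g j, y = π g (S j)} := by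
  refine (Submodule.span_le (p := (Submodule.span ℂ {y | ∃ g j, y = π g (S j)}).comap (π g))).2
    ?_ hv
  rintro _ ⟨h, j, rfl⟩
  exact Submodule.subset_span ⟨g * h, j, by rw [map_mul]; rfl⟩

/-- On a fixed vector of the span of the orbits, sufficiently equivariant maps are as equivariant as
desired. -/
theorem eventually_norm_evalAt_sub_lt (g : Γ) {v : X}
    (hv : v ∈ Submodule.span ℂ {y | ∃ g j, y = π g (S j)}) {κ : ℝ} (hκ : 0 < κ) :
    ∀ᶠ t in tripleFilter Γ, ∀ (n : ℕ) (σ : Γ → Equiv.Perm (Fin n)),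
      ∀ T : spanFM π S t.1 t.2.1 →L[ℂ] PiLp p (fun _ : Fin n => ℂ),
        T ∈ almostEquivariant p π S t.1 t.2.1 t.2.2 σ →
        ‖evalAt T (π g v) - permAct p (σ g) (evalAt T v)‖ < κ := by
  induction hv using Submodule.span_induction generalizing κ with
  | mem x hx =>
    classical
    obtain ⟨h, l, rfl⟩ := hx
    filter_upwards [eventually_tripleFilter {g, h} (l + 2) (half_pos hκ)] with t ht n σ T hT
    obtain ⟨hF, hm, -, hδ⟩ := ht
    have hg : g ∈ t.1 := hF (by simp)
    have hh : h ∈ t.1 := hF (by simp)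
    have h1 := hT.2 [g, h] l ⟨by simp, by simp; omega, by simp [hg, hh]⟩ (by omega)
    have h2 := hT.2 [h] l ⟨by simp, by simp; omega, by simp [hh]⟩ (by omega)
    simp only [List.prod_cons, List.prod_nil, mul_one, List.map_cons, List.map_nil] at h1 h2
    rw [permAct_mul, map_mul, Module.End.mul_apply] at h1
    rw [← (permAct p (σ g)).norm_map, map_sub] at h2
    calc _ ≤ _ + _ := norm_sub_le_norm_sub_add_norm_sub _
            (permAct p (σ g) (permAct p (σ h) (evalAt T (S l)))) _
      _ < κ := by rw [norm_sub_rev (permAct p (σ g) _)]; linarith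
  | zero => simp [evalAt_zero, hκ]
  | add x y hx hy ihx ihy =>
    filter_upwards [ihx (half_pos hκ), ihy (half_pos hκ), eventually_mem_spanFM hx,
      eventually_mem_spanFM hy, eventually_mem_spanFM (map_mem_span_orbit g hx),
      eventually_mem_spanFM (map_mem_span_orbit g hy)] with t h1 h2 m1 m2 m3 m4 n σ T hT
    rw [map_add, evalAt_add T m1 m2, evalAt_add T m3 m4, map_add, add_sub_add_comm]
    exact (norm_add_le _ _).trans_lt (by linarith [h1 n σ T hT, h2 n σ T hT])
  | smul c x hx ih =>
    have hc : 0 < ‖c‖ + 1 := by positivity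
    filter_upwards [ih (div_pos hκ hc), eventually_mem_spanFM hx,
      eventually_mem_spanFM (map_mem_span_orbit g hx)] with t h m1 m2 n σ T hT
    rw [map_smul, evalAt_smul T c m1, evalAt_smul T c m2, map_smul, ← smul_sub, norm_smul]
    calc ‖c‖ * _ ≤ ‖c‖ * (κ / (‖c‖ + 1)) := by gcongr; exact (h n σ T hT).le
      _ < (‖c‖ + 1) * (κ / (‖c‖ + 1)) := by gcongr; linarith
      _ = κ := by field_simp

theorem eventually_norm_evalAt_orbitComb_sub_lt {ι : Type*} (u : Γ × ι →₀ ℂ) (y : ι → X)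
    (hy : ∀ j, y j ∈ Submodule.span ℂ {y | ∃ g j, y = π g (S j)}) {κ : ℝ} (hκ : 0 < κ) :
    ∀ᶠ t in tripleFilter Γ, ∀ (n : ℕ) (σ : Γ → Equiv.Perm (Fin n)),
      ∀ T : spanFM π S t.1 t.2.1 →L[ℂ] PiLp p (fun _ : Fin n => ℂ),
        T ∈ almostEquivariant p π S t.1 t.2.1 t.2.2 σ →
        ‖evalAt T (orbitComb π u y) - orbitComb (permEnd p σ) u fun j => evalAt T (y j)‖ < κ := by
  have hmem : ∀ u : Γ × ι →₀ ℂ, orbitComb π u y ∈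
      Submodule.span ℂ {y | ∃ g j, y = π g (S j)} := fun u => by
    rw [orbitComb_apply]
    exact Submodule.sum_mem _ fun gj _ => Submodule.smul_mem _ _ (map_mem_span_orbit _ (hy _))
  induction u using Finsupp.induction_linear generalizing κ with
  | zero => simp [evalAt_zero, hκ]
  | add u v hu hv =>
    filter_upwards [hu (half_pos hκ), hv (half_pos hκ), eventually_mem_spanFM (hmem u),
      eventually_mem_spanFM (hmem v)] with t h1 h2 m1 m2 n σ T hT
    rw [orbitComb_add, orbitComb_add, LinearMap.add_apply, LinearMap.add_apply,
      evalAt_add T m1 m2, add_sub_add_comm]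
    exact (norm_add_le _ _).trans_lt (by linarith [h1 n σ T hT, h2 n σ T hT])
  | single gj c =>
    obtain ⟨g, j⟩ := gj
    have hc : 0 < ‖c‖ + 1 := by positivity
    filter_upwards [eventually_norm_evalAt_sub_lt (p := p) g (hy j) (div_pos hκ hc),
      eventually_mem_spanFM (map_mem_span_orbit g (hy j))] with t h m2 n σ T hT
    rw [orbitComb_single, orbitComb_single, evalAt_smul T c m2, permEnd_apply, ← smul_sub,
      norm_smul]
    calc ‖c‖ * _ ≤ ‖c‖ * (κ / (‖c‖ + 1)) := by gcongr; exact (h n σ T hT).le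
      _ < (‖c‖ + 1) * (κ / (‖c‖ + 1)) := by gcongr; linarith
      _ = κ := by field_simp

/-- If `z` is within `θ` of a combination of translates of the `y_j`, then `T(z)` is within `θ` of
the same combination of the `T(y_j)`, for all sufficiently equivariant contractions `T`. -/
theorem eventually_norm_evalAt_sub_orbitComb_lt {ι : Type*} (u : Γ × ι →₀ ℂ) (y : ι → X)
    (hy : ∀ j, y j ∈ Submodule.span ℂ {y | ∃ g j, y = π g (S j)}) {z : X}
    (hz : z ∈ Submodule.span ℂ {y | ∃ g j, y = π g (S j)}) {θ : ℝ}
    (hzu : ‖z - orbitComb π u y‖ < θ) :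
    ∀ᶠ t in tripleFilter Γ, ∀ (n : ℕ) (σ : Γ → Equiv.Perm (Fin n)),
      ∀ T : spanFM π S t.1 t.2.1 →L[ℂ] PiLp p (fun _ : Fin n => ℂ),
        T ∈ almostEquivariant p π S t.1 t.2.1 t.2.2 σ →
        ‖evalAt T z - orbitComb (permEnd p σ) u fun j => evalAt T (y j)‖ < θ := by
  have hmem : orbitComb π u y ∈ Submodule.span ℂ {y | ∃ g j, y = π g (S j)} := by
    rw [orbitComb_apply]
    exact Submodule.sum_mem _ fun gj _ => Submodule.smul_mem _ _ (map_mem_span_orbit _ (hy _))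
  filter_upwards [eventually_norm_evalAt_orbitComb_sub_lt (p := p) u y hy (sub_pos.2 hzu),
    eventually_mem_spanFM hz, eventually_mem_spanFM hmem] with t h m1 m2 n σ T hT
  have h1 := norm_evalAt_le hT.1 (z - orbitComb π u y)
  rw [evalAt_sub T m1 m2] at h1
  refine (norm_sub_le_norm_sub_add_norm_sub _ (evalAt T (orbitComb π u y)) _).trans_lt ?_
  linarith [h n σ T hT]

end Hom

/-! ### Comparison of the dimension with finite-dimensional models -/

section Model

theorem epsDim_le_finrank {E : Type*} [AddCommGroup E] [Module ℂ E] {ρ : E → ℝ} {ε : ℝ} {A : Set E}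
    (W : Submodule ℂ E) [FiniteDimensional ℂ W] (h : ∀ x ∈ A, ∃ w ∈ W, ρ (x - w) < ε) :
    epsDim ρ ε A ≤ Module.finrank ℂ W :=
  Nat.sInf_le ⟨W, inferInstance, rfl, h⟩

theorem le_epsDim {E : Type*} [AddCommGroup E] [Module ℂ E] {ρ : E → ℝ} {ε : ℝ} {A : Set E} {r : ℝ}
    (W₀ : Submodule ℂ E) [FiniteDimensional ℂ W₀] (hW₀ : ∀ x ∈ A, ∃ w ∈ W₀, ρ (x - w) < ε)
    (h : ∀ W : Submodule ℂ E, FiniteDimensional ℂ W → (∀ x ∈ A, ∃ w ∈ W, ρ (x - w) < ε) →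
      r ≤ Module.finrank ℂ W) : r ≤ epsDim ρ ε A := by
  obtain ⟨W, hW, hk, hA⟩ := Nat.sInf_mem (s := {k | ∃ W : Submodule ℂ E, FiniteDimensional ℂ W ∧
    Module.finrank ℂ W = k ∧ ∀ x ∈ A, ∃ w ∈ W, ρ (x - w) < ε}) ⟨_, W₀, inferInstance, rfl, hW₀⟩
  have := h W hW hA
  rw [hk] at this
  exact this

/-- The finitely supported sequence with terms `ℓ_k(v)` for `k < K`. -/
def truncSeq {E V : Type*} [AddCommGroup E] [Module ℂ E] [NormedAddCommGroup V] [NormedSpace ℂ V]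
    (ℓ : ℕ → E →ₗ[ℂ] V) (K : ℕ) : E →ₗ[ℂ] lp (fun _ : ℕ => V) ∞ :=
  ∑ k ∈ Finset.range K, lp.lsingle ∞ k ∘ₗ ℓ k

theorem truncSeq_apply {E V : Type*} [AddCommGroup E] [Module ℂ E] [NormedAddCommGroup V]
    [NormedSpace ℂ V] (ℓ : ℕ → E →ₗ[ℂ] V) (K : ℕ) (v : E) (j : ℕ) :
    truncSeq ℓ K v j = if j < K then ℓ j v else 0 := by
  have h : ∀ k, lp.lsingle (𝕜 := ℂ) (E := fun _ : ℕ => V) ∞ k (ℓ k v) j =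
      if j = k then ℓ k v else 0 := fun k => by
    change lp.single (E := fun _ : ℕ => V) ∞ k (ℓ k v) j = _
    rw [lp.single_apply, Pi.single_apply]
  simp only [truncSeq, LinearMap.sum_apply, LinearMap.comp_apply, lp.coeFn_sum, Finset.sum_apply,
    h, Finset.sum_ite_eq, Finset.mem_range]

theorem evalSeq_apply {X V : Type*} [NormedAddCommGroup X] [NormedSpace ℂ X] [NormedAddCommGroup V]
    [NormedSpace ℂ V] {D : Submodule ℂ X} (S : ℕ → X) (m : ℕ) (T : D →L[ℂ] V) (j : ℕ) :
    evalSeq S m T j = if j < m then evalAt T (S j) else 0 := rfl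

variable {Γ : Type*} [Group Γ] {X : Type*} [NormedAddCommGroup X] [NormedSpace ℂ X]
  {p : ℝ≥0∞} [Fact (1 ≤ p)] {π : Representation ℂ Γ X} {S : ℕ → X}

theorem lowerDim_le_upperDim (A : SoficApproximation Γ) (ρ : ProductNorm) :
    lowerDim p A π S ρ ≤ upperDim p A π S ρ :=
  iSup₂_mono fun _ _ => limsup_le_limsup (Eventually.of_forall fun _ => liminf_le_limsup)

/-- Let `e` be a finite family whose translates span a dense subspace and which
satisfies a relation `∑ u(g, j) g e_j = 0`. Almost equivariant maps are determined up to a small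
error by the images of the `e_j`, which satisfy the same relation approximately. Hence the dimension
is at most `r` if the approximate solutions of the relation in `l^p(d_i)` are close to spaces of
dimension about `r d_i`. -/
theorem upperDim_le_of_model {ι : Type*} [Finite ι] (A : SoficApproximation Γ)
    (hπ : ∀ g, Continuous (π g)) (hS : IsDynGenerating π S) (ρ : ProductNorm) (e : ι → X)
    (he : (Submodule.span ℂ {y | ∃ g j, y = π g (e j)}).topologicalClosure = ⊤)
    (u : Γ × ι →₀ ℂ) (hu : orbitComb π u e = 0) (r : ℕ)
    (hmodel : ∀ κ > (0 : ℝ), ∀ θ > (0 : ℝ), ∃ η > (0 : ℝ), ∀ᶠ i in atTop,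
      ∃ W : Submodule ℂ (ι → PiLp p (fun _ : Fin (A.d i) => ℂ)),
        (Module.finrank ℂ W : ℝ) ≤ (r + κ) * A.d i ∧
        ∀ ξ, ‖orbitComb (permEnd p (A.σ i)) u ξ‖ < η → ∃ w ∈ W, ∀ j, ‖ξ j - w j‖ ≤ θ) :
    upperDim p A π S ρ ≤ r := by
  have := Fintype.ofFinite ι
  obtain ⟨⟨C, hC⟩, hSd⟩ := hS
  refine iSup₂_le fun ε hε => ENNReal.le_of_forall_pos_le_add fun κ hκ _ => ?_
  obtain ⟨K, θ, hθ, hsmall⟩ := ρ.exists_lt (C := C + 1) hε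
  have hC0 : 0 ≤ C := (norm_nonneg _).trans (hC 0)
  set θ' := min θ 1 with hθ'
  have hθ'0 : 0 < θ' := lt_min hθ one_pos
  -- approximate the terms of `S` by combinations of translates of the `e_j`
  have hk : ∀ k, ∃ v : Γ × ι →₀ ℂ, ‖S k - orbitComb π v e‖ < θ' / 2 := fun k => by
    have : S k ∈ closure (Submodule.span ℂ {y | ∃ g j, y = π g (e j)} : Set X) := by
      rw [← Submodule.topologicalClosure_coe, he]; trivial
    obtain ⟨b, hb, hd⟩ := Metric.mem_closure_iff.1 this _ (half_pos hθ'0)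
    obtain ⟨v, rfl⟩ := exists_orbitComb_eq (⇑π) e hb
    exact ⟨v, by rwa [← dist_eq_norm]⟩
  choose v hv using hk
  set M : ℝ := ∑ k ∈ Finset.range K, (v k).sum fun _ c => ‖c‖ with hM
  have hvnn : ∀ k, 0 ≤ (v k).sum fun _ c => ‖c‖ := fun k =>
    Finset.sum_nonneg fun _ _ => norm_nonneg _
  have hM0 : 0 ≤ M := Finset.sum_nonneg fun k _ => hvnn k
  obtain ⟨η, hη, hmod⟩ := hmodel κ (by exact_mod_cast hκ) (θ' / 2 / (M + 1)) (by positivity)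
  -- choose approximations of the `e_j` in the span of the translates of `S`
  have hopen : IsOpen ({y : ι → X | ‖(0 : X) - orbitComb π u y‖ < η} ∩
      ⋂ k ∈ Finset.range K, {y : ι → X | ‖S k - orbitComb π (v k) y‖ < θ' / 2}) := by
    refine IsOpen.inter ?_ (isOpen_biInter_finset fun k _ => ?_)
    · exact isOpen_lt (continuous_const.sub (continuous_orbitComb _ hπ u)).norm continuous_const
    · exact isOpen_lt (continuous_const.sub (continuous_orbitComb _ hπ _)).norm continuous_const
  have hdense : Dense (Set.pi Set.univ fun _ : ι =>
      (Submodule.span ℂ {y | ∃ g j, y = π g (S j)} : Set X)) := by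
    refine dense_pi _ fun _ _ => ?_
    rw [dense_iff_closure_eq, ← Submodule.topologicalClosure_coe, hSd]
    rfl
  obtain ⟨y, ⟨hy1, hy2⟩, hy3⟩ := hdense.inter_open_nonempty _ hopen ⟨e, by
    refine ⟨by simpa [hu] using hη, ?_⟩
    simp only [Set.mem_iInter]
    exact fun k _ => hv k⟩
  simp only [Set.mem_iInter] at hy2
  have hy3' : ∀ j, y j ∈ Submodule.span ℂ {y | ∃ g j, y = π g (S j)} := fun j => hy3 j trivial
  refine limsup_le_of_le (by isBoundedDefault) ?_
  have hev : ∀ᶠ t in tripleFilter Γ, ∀ k ∈ Finset.range K, ∀ (n : ℕ) (σ : Γ → Equiv.Perm (Fin n)),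
      ∀ T : spanFM π S t.1 t.2.1 →L[ℂ] PiLp p (fun _ : Fin n => ℂ),
        T ∈ almostEquivariant p π S t.1 t.2.1 t.2.2 σ →
        ‖evalAt T (S k) - orbitComb (permEnd p σ) (v k) fun j => evalAt T (y j)‖ < θ' / 2 := by
    rw [Filter.eventually_all_finset]
    exact fun k hk => eventually_norm_evalAt_sub_orbitComb_lt _ y hy3'
      (Submodule.subset_span ⟨1, k, by simp⟩) (hy2 k hk)
  filter_upwards [hev, eventually_norm_evalAt_sub_orbitComb_lt (p := p) u y hy3'
    (Submodule.zero_mem _) hy1, eventually_tripleFilter (Γ := Γ) ∅ K one_pos] with t h1 h2 h3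
  refine limsup_le_of_le (by isBoundedDefault) ?_
  filter_upwards [hmod] with i hi
  obtain ⟨W, hWr, hW⟩ := hi
  set Φ := truncSeq (fun k => orbitComb (permEnd p (A.σ i)) (v k)) K
  have hdim : epsDim ρ.onSeq ε (evalSeq S t.2.1 '' almostEquivariant p π S t.1 t.2.1 t.2.2 (A.σ i))
      ≤ Module.finrank ℂ W := by
    refine (epsDim_le_finrank (W.map Φ) ?_).trans (Submodule.finrank_map_le _ _)
    rintro _ ⟨T, hT, rfl⟩
    have hrel := h2 _ _ T hT
    rw [evalAt_zero, zero_sub, norm_neg] at hrel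
    obtain ⟨w, hw, hwξ⟩ := hW _ hrel
    have hclose : ∀ k < K, ‖evalAt T (S k) - orbitComb (permEnd p (A.σ i)) (v k) w‖ ≤ θ' := by
      intro k hk
      have e1 := h1 k (Finset.mem_range.2 hk) _ _ T hT
      have e2 := norm_orbitComb_le (permEnd p (A.σ i)) (fun g ξ => (norm_permEnd p _ g ξ).le) (v k)
        ((fun j => evalAt T (y j)) - w) fun gj _ => hwξ gj.2
      rw [map_sub] at e2
      have e3 : ((v k).sum fun _ c => ‖c‖) * (θ' / 2 / (M + 1)) ≤ θ' / 2 := by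
        have : ((v k).sum fun _ c => ‖c‖) ≤ M + 1 :=
          (Finset.single_le_sum (f := fun k => (v k).sum fun _ c => ‖c‖) (fun k _ => hvnn k)
            (Finset.mem_range.2 hk)).trans (by linarith)
        rw [← mul_div_assoc, div_le_iff₀ (by positivity), mul_comm]
        gcongr
      exact (norm_sub_le_norm_sub_add_norm_sub _ _ _).trans
        ((add_le_add e1.le (e2.trans e3)).trans (by linarith))
    refine ⟨Φ w, Submodule.mem_map_of_mem hw, hsmall _ (fun k => ?_) (fun k hk => ?_)⟩
    · rw [normSeq_apply, Complex.norm_real, norm_norm, lp.coeFn_sub, Pi.sub_apply, evalSeq_apply,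
        truncSeq_apply]
      by_cases hk : k < K
      · rw [if_pos hk, if_pos (hk.trans_le h3.2.1)]
        exact (hclose k hk).trans ((min_le_right _ _).trans (by linarith))
      · rw [if_neg hk, sub_zero]
        split_ifs
        · exact (norm_evalAt_le hT.1 _).trans ((hC k).trans (by linarith))
        · rw [norm_zero]; linarith
    · rw [normSeq_apply, Complex.norm_real, norm_norm, lp.coeFn_sub, Pi.sub_apply, evalSeq_apply,
        truncSeq_apply, if_pos hk, if_pos (hk.trans_le h3.2.1)]
      exact (hclose k hk).trans (min_le_left _ _)
  refine ENNReal.div_le_of_le_mul ?_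
  have h4 : ((epsDim ρ.onSeq ε
      (evalSeq S t.2.1 '' almostEquivariant p π S t.1 t.2.1 t.2.2 (A.σ i)) : ℕ) : ℝ) ≤
      (r + κ) * A.d i := le_trans (by exact_mod_cast hdim) hWr
  have h5 : ((epsDim ρ.onSeq ε
      (evalSeq S t.2.1 '' almostEquivariant p π S t.1 t.2.1 t.2.2 (A.σ i)) : ℕ) : NNReal) ≤
      (r + κ) * A.d i := by exact_mod_cast h4
  exact_mod_cast h5

omit [Group Γ] in
theorem finite_setOf_isWord (F : Finset Γ) (m : ℕ) : {w | IsWord F m w}.Finite := by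
  refine ((List.finite_length_le F m).image (List.map Subtype.val)).subset fun w hw => ?_
  exact ⟨w.attachWith (· ∈ F) hw.2.2, by simpa using hw.2.1, by simp⟩

/-- The restriction of `B⁻¹ T` to a subspace, a contraction if `‖T‖ ≤ B`. -/
def scaledRestrict {V : Type*} [NormedAddCommGroup V] [NormedSpace ℂ V] (B : ℝ) (T : X →L[ℂ] V)
    (D : Submodule ℂ X) : D →L[ℂ] V :=
  (B : ℂ)⁻¹ • T.comp D.subtypeL

theorem norm_scaledRestrict_le {V : Type*} [NormedAddCommGroup V] [NormedSpace ℂ V] {B : ℝ}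
    (hB : 0 < B) {T : X →L[ℂ] V} (hT : ‖T‖ ≤ B) (D : Submodule ℂ X) :
    ‖scaledRestrict B T D‖ ≤ 1 := by
  refine ContinuousLinearMap.opNorm_le_bound _ zero_le_one fun x => ?_
  change ‖(B : ℂ)⁻¹ • T x‖ ≤ _
  rw [norm_smul, norm_inv, Complex.norm_real, Real.norm_of_nonneg hB.le, inv_mul_le_iff₀ hB,
    one_mul]
  exact T.le_of_opNorm_le hT x

theorem evalAt_scaledRestrict {V : Type*} [NormedAddCommGroup V] [NormedSpace ℂ V] (B : ℝ)
    (T : X →L[ℂ] V) {D : Submodule ℂ X} {x : X} (hx : x ∈ D) :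
    evalAt (scaledRestrict B T D) x = (B : ℂ)⁻¹ • T x :=
  evalAt_of_mem _ hx

theorem norm_map_sub_orbitComb_le {V : Type*} [NormedAddCommGroup V] [NormedSpace ℂ V]
    {ι : Type*} {B M θ : ℝ} (hB : 0 < B) (hM : 0 < M) (hθ : 0 ≤ θ) {T : X →L[ℂ] V} (hT : ‖T‖ ≤ B)
    {α : Γ → Module.End ℂ V} (hα : ∀ g v, ‖α g v‖ ≤ ‖v‖) {v : Γ × ι →₀ ℂ}
    (hv : (v.sum fun _ c => ‖c‖) ≤ M) {S : ι → X} {e : X} {w : ι → V}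
    (he : ‖e - orbitComb π v S‖ ≤ θ / (4 * B))
    (hTS : ∀ gk ∈ v.support, ‖T (π gk.1 (S gk.2)) - α gk.1 (T (S gk.2))‖ ≤ θ / (4 * M))
    (hTw : ∀ gk ∈ v.support, ‖T (S gk.2) - w gk.2‖ ≤ θ / (4 * M)) :
    ‖T e - orbitComb α v w‖ ≤ θ := by
  have e1 : ‖T e - T (orbitComb π v S)‖ ≤ θ / 4 := by
    rw [← map_sub]
    calc _ ≤ B * (θ / (4 * B)) := T.le_of_opNorm_le_of_le hT he
      _ = θ / 4 := by field_simp
  have e2 : ‖T (orbitComb π v S) - orbitComb α v fun k => T (S k)‖ ≤ θ / 4 := by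
    rw [orbitComb_apply, orbitComb_apply, Finsupp.sum, Finsupp.sum, map_sum,
      ← Finset.sum_sub_distrib]
    calc _ ≤ ∑ gk ∈ v.support, ‖v gk‖ * (θ / (4 * M)) := by
          refine (norm_sum_le _ _).trans (Finset.sum_le_sum fun gk hgk => ?_)
          rw [map_smul, ← smul_sub, norm_smul]
          exact mul_le_mul_of_nonneg_left (hTS gk hgk) (norm_nonneg _)
      _ ≤ M * (θ / (4 * M)) := by
          rw [← Finset.sum_mul]
          exact mul_le_mul_of_nonneg_right hv (by positivity)
      _ = θ / 4 := by field_simp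
  have e3 : ‖(orbitComb α v fun k => T (S k)) - orbitComb α v w‖ ≤ θ / 4 := by
    rw [← map_sub]
    calc _ ≤ (v.sum fun _ c => ‖c‖) * (θ / (4 * M)) := norm_orbitComb_le _ hα _ _ hTw
      _ ≤ M * (θ / (4 * M)) := mul_le_mul_of_nonneg_right hv (by positivity)
      _ = θ / 4 := by field_simp
  calc _ ≤ _ + _ := norm_sub_le_norm_sub_add_norm_sub _ (T (orbitComb π v S)) _
    _ ≤ θ / 4 + (θ / 4 + θ / 4) := add_le_add e1
        ((norm_sub_le_norm_sub_add_norm_sub _ _ _).trans (add_le_add e2 e3))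
    _ ≤ θ := by linarith

/-- The dimension is at least `r` if there are families of uniformly bounded, almost
equivariant maps defined on the whole space whose values at a finite family `e` are not close to
spaces of dimension less than about `r d_i`. -/
theorem le_lowerDim_of_model {ι : Type*} [Finite ι] (A : SoficApproximation Γ)
    (hd : ∀ᶠ i in atTop, 0 < A.d i)
    (hS : IsDynGenerating π S) (ρ : ProductNorm) (e : ι → X) (r : ℕ) {B : ℝ} (hB : 0 < B)
    (hmodel : ∀ κ > (0 : ℝ), ∃ θ > (0 : ℝ), ∀ Q : Finset (List Γ × X), ∀ η > (0 : ℝ),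
      ∀ᶠ i in atTop, ∃ 𝒯 : Set (X →L[ℂ] PiLp p (fun _ : Fin (A.d i) => ℂ)),
        (∀ T ∈ 𝒯, ‖T‖ ≤ B) ∧
        (∀ T ∈ 𝒯, ∀ q ∈ Q,
          ‖T (π q.1.prod q.2) - permAct p (q.1.map (A.σ i)).prod (T q.2)‖ < η) ∧
        ∀ W : Submodule ℂ (ι → PiLp p (fun _ : Fin (A.d i) => ℂ)),
          (∀ T ∈ 𝒯, ∃ w ∈ W, ∀ j, ‖T (e j) - w j‖ ≤ θ) →
          (r - κ) * A.d i ≤ Module.finrank ℂ W) :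
    (r : ℝ≥0∞) ≤ lowerDim p A π S ρ := by
  classical
  have := Fintype.ofFinite ι
  have hSd := hS.2
  refine ENNReal.le_of_forall_pos_le_add fun κ hκ _ => ?_
  obtain ⟨θ, hθ, hmod⟩ := hmodel κ (by exact_mod_cast hκ)
  -- approximate the `e_j` by combinations of translates of the terms of `S`
  have hk : ∀ j, ∃ v : Γ × ℕ →₀ ℂ, ‖e j - orbitComb π v S‖ < θ / (4 * B) := fun j => by
    have : e j ∈ closure (Submodule.span ℂ {y | ∃ g j, y = π g (S j)} : Set X) := by
      rw [← Submodule.topologicalClosure_coe, hSd]; trivial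
    obtain ⟨b, hb, hd⟩ := Metric.mem_closure_iff.1 this (θ / (4 * B)) (by positivity)
    obtain ⟨v, rfl⟩ := exists_orbitComb_eq (⇑π) S hb
    exact ⟨v, by rwa [← dist_eq_norm]⟩
  choose v hv using hk
  obtain ⟨K, hK⟩ : ∃ K : ℕ, ∀ j, ∀ gk ∈ (v j).support, gk.2 < K := by
    refine ⟨(Finset.univ.biUnion fun j => (v j).support.image Prod.snd).sup id + 1,
      fun j gk hgk => Nat.lt_succ_of_le ?_⟩
    exact Finset.le_sup (f := id) (Finset.mem_biUnion.2
      ⟨j, Finset.mem_univ _, Finset.mem_image_of_mem _ hgk⟩)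
  have hvnn : ∀ j, 0 ≤ (v j).sum fun _ c => ‖c‖ := fun k =>
    Finset.sum_nonneg fun _ _ => norm_nonneg _
  obtain ⟨M, hM0, hM⟩ : ∃ M : ℝ, 0 < M ∧ ∀ j, ((v j).sum fun _ c => ‖c‖) ≤ M := by
    refine ⟨(∑ j, (v j).sum fun _ c => ‖c‖) + 1, ?_, fun j => ?_⟩
    · have := Finset.sum_nonneg (s := Finset.univ) fun j _ => hvnn j
      linarith
    · have := Finset.single_le_sum (f := fun j => (v j).sum fun _ c => ‖c‖)
        (fun j _ => hvnn j) (Finset.mem_univ j)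
      linarith
  obtain ⟨c, hc0, hc⟩ : ∃ c : ℝ, 0 < c ∧ ∀ k < K, ∀ f : lp (fun _ : ℕ => ℂ) ∞,
      c * ‖f k‖ ≤ ρ.toSeminorm f := by
    choose b hb0 hb using ρ.exists_norm_apply_le
    refine ⟨(Finset.range (K + 1)).inf' ⟨0, by simp⟩ b, (Finset.lt_inf'_iff _).2
      fun k _ => hb0 k, fun k hk f => le_trans ?_ (hb k f)⟩
    gcongr
    exact Finset.inf'_le _ (Finset.mem_range.2 (hk.trans K.lt_succ_self))
  set δ : ℝ := θ / (4 * B * M) with hδ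
  have hδ0 : 0 < δ := by positivity
  have hε : 0 < c * δ := by positivity
  rw [← tsub_le_iff_right]
  refine le_trans ?_ (le_iSup₂ (f := fun (ε : ℝ) (_ : 0 < ε) =>
    limsup (fun t : Finset Γ × ℕ × ℝ =>
      liminf (fun i => relDim p A π S ρ ε t.1 t.2.1 t.2.2 i) atTop) (tripleFilter Γ)) (c * δ) hε)
  refine le_limsup_of_frequently_le (Eventually.frequently ?_) (by isBoundedDefault)
  filter_upwards [eventually_tripleFilter (Γ := Γ) {1} (K + 1) one_pos] with t ht
  obtain ⟨hF, hm, ht0, -⟩ := ht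
  obtain ⟨F, m, δ'⟩ := t
  simp only at hF hm ht0 ⊢
  have h1F : (1 : Γ) ∈ F := hF (by simp)
  have hSmem : ∀ j < m, S j ∈ spanFM π S F m := fun j hj =>
    Submodule.subset_span ⟨[1], j, ⟨le_rfl, by simp; omega, by simpa using h1F⟩, hj, by simp⟩
  have hwmem : ∀ w, IsWord F m w → ∀ j < m, π w.prod (S j) ∈ spanFM π S F m := fun w hw j hj =>
    Submodule.subset_span ⟨w, j, hw, hj, rfl⟩
  refine le_liminf_of_le (by isBoundedDefault) ?_
  have hQ := hmod (((finite_setOf_isWord F m).toFinset ×ˢ (Finset.range m).image S) ∪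
    Finset.univ.biUnion fun j => (v j).support.image fun gk => ([gk.1], S gk.2))
    (min (B * δ') (θ / (4 * M))) (lt_min (by positivity) (by positivity))
  filter_upwards [hQ, hd] with i hi hdi
  obtain ⟨𝒯, h𝒯B, h𝒯Q, h𝒯W⟩ := hi
  have hmain : ((r : ℝ) - κ) * A.d i ≤ epsDim ρ.onSeq (c * δ)
      (evalSeq S m '' almostEquivariant p π S F m δ' (A.σ i)) := by
    refine le_epsDim (LinearMap.range (truncSeq (fun k => if h : k < m then LinearMap.proj
      (R := ℂ) (φ := fun _ : Fin m => PiLp p (fun _ : Fin (A.d i) => ℂ)) ⟨k, h⟩ else 0) m)) ?_ ?_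
    · rintro _ ⟨T, hT, rfl⟩
      refine ⟨evalSeq S m T, ⟨fun k => evalAt T (S k), lp.ext (funext fun k => ?_)⟩, ?_⟩
      · rw [truncSeq_apply, evalSeq_apply]
        split_ifs with h
        · rfl
        · rfl
      · rw [sub_self, ProductNorm.onSeq, show normSeq (0 : lp (fun _ : ℕ =>
          PiLp p (fun _ : Fin (A.d i) => ℂ)) ∞) = 0 from lp.ext (funext fun k => by simp), map_zero]
        exact hε
    · intro W hW hcov
      set Ψ : lp (fun _ : ℕ => PiLp p (fun _ : Fin (A.d i) => ℂ)) ∞ →ₗ[ℂ]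
          (ι → PiLp p (fun _ : Fin (A.d i) => ℂ)) :=
        LinearMap.pi fun j => orbitComb (permEnd p (A.σ i)) (v j) ∘ₗ
          LinearMap.pi fun k => (B : ℂ) • lp.evalₗ (𝕜 := ℂ) (E := fun _ : ℕ =>
            PiLp p (fun _ : Fin (A.d i) => ℂ)) ∞ k with hΨ
      refine (h𝒯W (W.map Ψ) fun T hT => ?_).trans
        (by exact_mod_cast Submodule.finrank_map_le Ψ W)
      set T' := scaledRestrict B T (spanFM π S F m) with hT'
      have hT'mem : T' ∈ almostEquivariant p π S F m δ' (A.σ i) := by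
        constructor
        · exact norm_scaledRestrict_le hB (h𝒯B T hT) _
        · intro w j hw hj
          rw [hT', evalAt_scaledRestrict B T (hwmem w hw j hj),
            evalAt_scaledRestrict B T (hSmem j hj), map_smul, ← smul_sub, norm_smul, norm_inv,
            Complex.norm_real, Real.norm_of_nonneg hB.le, inv_mul_lt_iff₀ hB]
          refine (h𝒯Q T hT (w, S j) (Finset.mem_union_left _ ?_)).trans_le (min_le_left _ _)
          simp only [Finset.mem_product, Set.Finite.mem_toFinset, Finset.mem_image,
            Finset.mem_range]
          exact ⟨hw, j, hj, rfl⟩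
      obtain ⟨w, hw, hwρ⟩ := hcov _ ⟨T', hT'mem, rfl⟩
      refine ⟨Ψ w, Submodule.mem_map_of_mem hw, fun j => ?_⟩
      have hcoord : ∀ k < K, ‖T (S k) - (B : ℂ) • w k‖ ≤ B * δ := fun k hk => by
        have h1 := (hc k hk _).trans_lt hwρ
        have h2 := lt_of_mul_lt_mul_left h1 hc0.le
        rw [normSeq_apply, Complex.norm_real, norm_norm, lp.coeFn_sub, Pi.sub_apply,
          evalSeq_apply, if_pos (by omega), hT',
          evalAt_scaledRestrict B T (hSmem k (by omega))] at h2
        have h3 : T (S k) - (B : ℂ) • w k = (B : ℂ) • ((B : ℂ)⁻¹ • T (S k) - w k) := by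
          rw [smul_sub, smul_inv_smul₀ (by exact_mod_cast hB.ne')]
        rw [h3, norm_smul, Complex.norm_real, Real.norm_of_nonneg hB.le]
        gcongr
      refine norm_map_sub_orbitComb_le (π := π) hB hM0 hθ.le (h𝒯B T hT)
        (fun g ξ => (norm_permEnd p _ g ξ).le) (hM j) (hv j).le (fun gk hgk => ?_)
        fun gk hgk => (hcoord gk.2 (hK j gk hgk)).trans_eq (by rw [hδ]; field_simp)
      have := h𝒯Q T hT ([gk.1], S gk.2) (Finset.mem_union_right _
        (Finset.mem_biUnion.2 ⟨j, Finset.mem_univ _,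
          Finset.mem_image_of_mem (fun gk : Γ × ℕ => ([gk.1], S gk.2)) hgk⟩))
      simpa using (this.trans_le (min_le_right _ _)).le
  refine ENNReal.le_div_iff_mul_le (Or.inl (by exact_mod_cast hdi.ne')) (Or.inl (by simp)) |>.2 ?_
  rw [ENNReal.sub_mul (by simp), tsub_le_iff_right]
  rw [sub_mul, sub_le_iff_le_add] at hmain
  have h5 : ((r : NNReal) * A.d i : NNReal) ≤ (epsDim ρ.onSeq (c * δ)
      (evalSeq S m '' almostEquivariant p π S F m δ' (A.σ i)) : NNReal) + κ * A.d i := by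
    exact_mod_cast hmain
  exact_mod_cast h5

end Model

/-! ### Sofic approximations of free groups -/

/-- A sequence of subsets `B_i` of `{1, …, d_i}` whose densities tend to `0`. -/
def Negligible (d : ℕ → ℕ) (B : ∀ i, Finset (Fin (d i))) : Prop :=
  Tendsto (fun i => ((B i).card : ℝ) / d i) atTop (𝓝 0)

namespace Negligible

variable {d : ℕ → ℕ} {B C : ∀ i, Finset (Fin (d i))}

theorem mono (hC : Negligible d C) (h : ∀ i, B i ⊆ C i) : Negligible d B :=
  squeeze_zero (fun i => by positivity) (fun i => by
    have := Finset.card_le_card (h i)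
    gcongr) hC

theorem union (hB : Negligible d B) (hC : Negligible d C) : Negligible d fun i => B i ∪ C i := by
  have := hB.add hC
  rw [add_zero] at this
  refine squeeze_zero (fun i => by positivity) (fun i => ?_) this
  rw [← add_div]
  have := Finset.card_union_le (B i) (C i)
  gcongr
  exact_mod_cast this

theorem empty (d : ℕ → ℕ) : Negligible d fun _ => ∅ := by
  simp [Negligible]

theorem biUnion {κ : Type*} (s : Finset κ) {B : κ → ∀ i, Finset (Fin (d i))}
    (h : ∀ k ∈ s, Negligible d (B k)) : Negligible d fun i => s.biUnion fun k => B k i := by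
  classical
  induction s using Finset.induction_on with
  | empty => simpa using empty d
  | insert a s _ ih =>
    simp only [Finset.biUnion_insert]
    exact (h a (by simp)).union (ih fun k hk => h k (Finset.mem_insert_of_mem hk))

/-- The preimage of a negligible sequence under permutations. -/
theorem preimage (hB : Negligible d B) (τ : ∀ i, Equiv.Perm (Fin (d i))) :
    Negligible d fun i => Finset.univ.filter fun x => τ i x ∈ B i := by
  refine hB.congr fun i => ?_
  congr 2
  refine (Finset.card_bij (fun x _ => τ i x) (by simp) (fun _ _ _ _ h => (τ i).injective h) ?_).symm
  exact fun y hy => ⟨(τ i).symm y, by simpa using hy, by simp⟩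

theorem eventually_card_le (hB : Negligible d B) {κ : ℝ} (hκ : 0 < κ) :
    ∀ᶠ i in atTop, ((B i).card : ℝ) ≤ κ * d i := by
  filter_upwards [hB.eventually_lt_const hκ] with i hi
  rcases Nat.eq_zero_or_pos (d i) with h0 | h0
  · have : (B i).card ≤ d i := (Finset.card_le_univ _).trans_eq (Fintype.card_fin _)
    have : (B i).card = 0 := by omega
    simp [this, h0]
  · exact ((div_lt_iff₀ (by exact_mod_cast h0)).1 hi).le

end Negligible

namespace SoficApproximation

section

variable {Γ : Type*} [Group Γ] (A : SoficApproximation Γ)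

theorem negligible_mul (g h : Γ) :
    Negligible A.d fun i => Finset.univ.filter fun x => A.σ i (g * h) x ≠ A.σ i g (A.σ i h x) :=
  A.tendsto_mul g h

theorem eventually_pos [Nontrivial Γ] : ∀ᶠ i in atTop, 0 < A.d i := by
  obtain ⟨g, h, hgh⟩ := exists_pair_ne Γ
  filter_upwards [(A.tendsto_ne g h hgh).eventually_const_lt zero_lt_one] with i hi
  refine Nat.pos_of_ne_zero fun h0 => ?_
  simp [hamming, h0] at hi

theorem negligible_eq {g h : Γ} (hgh : g ≠ h) :
    Negligible A.d fun i => Finset.univ.filter fun x => A.σ i g x = A.σ i h x := by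
  have : Nontrivial Γ := ⟨g, h, hgh⟩
  have h1 := (A.tendsto_ne g h hgh).const_sub 1
  rw [sub_self] at h1
  refine h1.congr' ?_
  filter_upwards [A.eventually_pos] with i hi
  have hi' : (A.d i : ℝ) ≠ 0 := by exact_mod_cast hi.ne'
  have h2 := Finset.card_filter_add_card_filter_not (s := (Finset.univ : Finset (Fin (A.d i))))
    (fun x => A.σ i g x = A.σ i h x)
  rw [Finset.card_univ, Fintype.card_fin] at h2
  rw [hamming, eq_div_iff hi', sub_mul, div_mul_cancel₀ _ hi', one_mul, sub_eq_iff_eq_add]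
  exact_mod_cast h2.symm

end

variable {n : ℕ} (A : SoficApproximation (FreeGroup (Fin n)))

/-- The homomorphisms into the symmetric groups with the same values on the free generators as a
sofic approximation of the free group. -/
def hom (i : ℕ) : FreeGroup (Fin n) →* Equiv.Perm (Fin (A.d i)) :=
  FreeGroup.lift fun j => A.σ i (FreeGroup.of j)

theorem negligible_hom_ne (g : FreeGroup (Fin n)) :
    Negligible A.d fun i => Finset.univ.filter fun x => A.hom i g x ≠ A.σ i g x := by
  induction g using FreeGroup.induction_on with
  | C1 => simpa [A.map_one] using Negligible.empty A.d
  | of j => simpa [hom] using Negligible.empty A.d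
  | inv_of j _ =>
    refine (A.negligible_mul (FreeGroup.of j) (FreeGroup.of j)⁻¹).mono fun i x => ?_
    simp only [Finset.mem_filter, Finset.mem_univ, true_and, mul_inv_cancel, A.map_one,
      Equiv.Perm.coe_one, id]
    intro h h2
    apply h
    rw [_root_.map_inv, Equiv.Perm.inv_eq_iff_eq]
    simpa [hom] using h2
  | mul g h hg hh =>
    refine (((hg.preimage fun i => A.σ i h).union hh).union (A.negligible_mul g h)).mono
      fun i x => ?_
    simp only [Finset.mem_union, Finset.mem_filter, Finset.mem_univ, true_and, _root_.map_mul,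
      Equiv.Perm.mul_apply]
    intro h1
    by_contra! h2
    exact h1 (by rw [h2.1.2, h2.1.1, h2.2])

theorem negligible_hom_eq {g h : FreeGroup (Fin n)} (hgh : g ≠ h) :
    Negligible A.d fun i => Finset.univ.filter fun x => A.hom i g x = A.hom i h x := by
  refine (((A.negligible_hom_ne g).union (A.negligible_hom_ne h)).union
    (A.negligible_eq hgh)).mono fun i x => ?_
  simp only [Finset.mem_union, Finset.mem_filter, Finset.mem_univ, true_and]
  intro h1
  by_contra! h2
  exact h2.2 (by rw [← h2.1.1, ← h2.1.2, h1])

theorem negligible_word_ne (w : List (FreeGroup (Fin n))) :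
    Negligible A.d fun i => Finset.univ.filter fun x =>
      (w.map (A.σ i)).prod x ≠ A.hom i w.prod x := by
  induction w with
  | nil => simpa using Negligible.empty A.d
  | cons g w ih =>
    refine (ih.union ((A.negligible_hom_ne g).preimage fun i => A.hom i w.prod)).mono
      fun i x => ?_
    simp only [Finset.mem_union, Finset.mem_filter, Finset.mem_univ, true_and, List.map_cons,
      List.prod_cons, _root_.map_mul, Equiv.Perm.mul_apply]
    intro h1
    by_contra! h2
    exact h1 (by rw [h2.1, h2.2])

end SoficApproximation

/-! ### Rokhlin towers and approximate solutions of the relation -/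

/-- For a permutation of a finite set with `d` elements there is a set `B` with at most `d / L`
elements such that every backward orbit segment of length `2 L` meets `B` or the set of the periodic
points of period less than `L`: a maximal set whose first `L` translates are disjoint. -/
theorem exists_rokhlin {α : Type*} [Fintype α] [DecidableEq α] (τ : Equiv.Perm α) {L : ℕ}
    (hL : 0 < L) :
    ∃ B : Finset α, B.card * L ≤ Fintype.card α ∧ ∀ x, ∃ k < 2 * L, (τ ^ k)⁻¹ x ∈
      B ∪ (Finset.Ioo 0 L).biUnion fun k => Finset.univ.filter fun x => (τ ^ k) x = x := by
  classical
  let P : Finset α → Prop := fun B =>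
    Set.InjOn (fun q : α × ℕ => (τ ^ q.2) q.1) (B ×ˢ Finset.range L : Finset (α × ℕ))
  obtain ⟨B, hBmem, hBmax⟩ := Finset.exists_maximal (s := Finset.univ.filter P)
    ⟨∅, by simp [P]⟩
  have hB : P B := (Finset.mem_filter.1 hBmem).2
  refine ⟨B, ?_, fun x => ?_⟩
  · have := Finset.card_le_card_of_injOn (t := Finset.univ) _ (fun _ _ => Finset.mem_univ _) hB
    simpa using this
  · by_contra! hx
    have hx' := hx L (by omega)
    set y := (τ ^ L)⁻¹ x with hy
    have hxy : (τ ^ L) y = x := by rw [hy]; simp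
    rw [Finset.mem_union, not_or] at hx'
    obtain ⟨hyB, hyP⟩ := hx'
    simp only [Finset.mem_biUnion, Finset.mem_Ioo, Finset.mem_filter, Finset.mem_univ, true_and,
      not_exists, not_and] at hyP
    -- by maximality `B ∪ {y}` does not have disjoint translates
    have hPy : ¬ P (insert y B) := fun h => hyB
      (hBmax (by simpa using h) (Finset.subset_insert y B) (Finset.mem_insert_self y B))
    apply hPy
    have key : ∀ k < L, ∀ b ∈ B, ∀ l < L, (τ ^ k) y ≠ (τ ^ l) b := by
      intro k hk b hb l hl h
      refine hx (L - k + l) (by omega) (Finset.mem_union_left _ ?_)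
      have : (τ ^ (L - k + l)) b = x := by
        rw [pow_add, Equiv.Perm.mul_apply, ← h, ← Equiv.Perm.mul_apply, ← pow_add,
          Nat.sub_add_cancel hk.le, hxy]
      rw [← this]
      simpa using hb
    have key2 : ∀ k l, k < l → l < L → (τ ^ k) y ≠ (τ ^ l) y := by
      intro k l hkl hl h
      refine hyP (l - k) ⟨by omega, by omega⟩ ((τ ^ k).injective ?_)
      rw [← Equiv.Perm.mul_apply, ← pow_add, Nat.add_sub_cancel' hkl.le, ← h]
    rintro ⟨b, k⟩ hbk ⟨c, l⟩ hcl h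
    simp only [Finset.coe_product, Set.mem_prod, Finset.mem_coe, Finset.mem_insert,
      Finset.mem_range] at hbk hcl h
    obtain ⟨hb, hk⟩ := hbk
    obtain ⟨hc, hl⟩ := hcl
    rcases hb with rfl | hb <;> rcases hc with rfl | hc
    · rcases lt_trichotomy k l with h1 | h1 | h1
      · exact absurd h (key2 _ _ h1 hl)
      · rw [h1]
      · exact absurd h.symm (key2 _ _ h1 hk)
    · exact absurd h (key _ hk _ hc _ hl)
    · exact absurd h.symm (key _ hl _ hb _ hk)
    · exact hB (by simp [hb, hk]) (by simp [hc, hl]) h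

theorem norm_piLp_le_of_le {p : ℝ≥0∞} [Fact (1 ≤ p)] {ι : Type*} [Fintype ι]
    {f g : PiLp p (fun _ : ι => ℂ)} (h : ∀ x, ‖f x‖ ≤ ‖g x‖) : ‖f‖ ≤ ‖g‖ := by
  rcases p.trichotomy with rfl | rfl | hp
  · exact absurd (Fact.out : (1 : ℝ≥0∞) ≤ 0) (by simp)
  · rw [PiLp.norm_eq_ciSup, PiLp.norm_eq_ciSup]
    exact ciSup_mono (Set.finite_range _).bddAbove h
  · rw [PiLp.norm_eq_sum hp, PiLp.norm_eq_sum hp]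
    gcongr with x
    exact h x

/-- The sum `∑ ζ(τ^{-l} x)` over the `l ≥ 0` such that `x, τ⁻¹ x, …, τ^{-l} x` do not meet `B`, cut
off at `l < m`. -/
def backSum (p : ℝ≥0∞) [Fact (1 ≤ p)] {n : ℕ} (τ : Equiv.Perm (Fin n)) (B : Finset (Fin n)) (m : ℕ)
    (ζ : PiLp p (fun _ : Fin n => ℂ)) : PiLp p (fun _ : Fin n => ℂ) :=
  ∑ l ∈ Finset.range m, WithLp.toLp p fun x =>
    if ∀ k ≤ l, (τ ^ k)⁻¹ x ∉ B then ζ ((τ ^ l)⁻¹ x) else 0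

section

variable {p : ℝ≥0∞} [Fact (1 ≤ p)] {n : ℕ} {τ : Equiv.Perm (Fin n)} {B : Finset (Fin n)} {m : ℕ}

theorem backSum_apply (ζ : PiLp p (fun _ : Fin n => ℂ)) (x : Fin n) :
    backSum p τ B m ζ x = ∑ l ∈ Finset.range m,
      if ∀ k ≤ l, (τ ^ k)⁻¹ x ∉ B then ζ ((τ ^ l)⁻¹ x) else 0 := by
  simp [backSum]

theorem norm_backSum_le (ζ : PiLp p (fun _ : Fin n => ℂ)) : ‖backSum p τ B m ζ‖ ≤ m * ‖ζ‖ := by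
  refine (norm_sum_le _ _).trans ?_
  refine (Finset.sum_le_sum (g := fun _ => ‖ζ‖) fun l _ => ?_).trans (by simp)
  rw [← (permAct p (τ ^ l)).norm_map ζ]
  refine norm_piLp_le_of_le fun x => ?_
  rw [permAct_apply]
  change ‖if _ then _ else _‖ ≤ _
  split_ifs
  · exact le_rfl
  · simp

/-- Outside `B` the function `f = backSum ζ` solves `f(τ⁻¹ x) - f(x) = -ζ(x)`: the two sums run over
the same orbit segment, except for its end point `x`. -/
theorem backSum_sub (hB : ∀ x, ∃ k < m, (τ ^ k)⁻¹ x ∈ B) (ζ : PiLp p (fun _ : Fin n => ℂ))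
    {x : Fin n} (hx : x ∉ B) : backSum p τ B m ζ (τ⁻¹ x) - backSum p τ B m ζ x = -ζ x := by
  have hshift : ∀ k, (τ ^ k)⁻¹ (τ⁻¹ x) = (τ ^ (k + 1))⁻¹ x := fun k => by
    rw [← Equiv.Perm.mul_apply, ← mul_inv_rev, ← pow_succ']
  set a : ℕ → ℂ := fun l => if ∀ k ≤ l, (τ ^ k)⁻¹ x ∉ B then ζ ((τ ^ l)⁻¹ x) else 0 with ha
  have h1 : backSum p τ B m ζ (τ⁻¹ x) = ∑ l ∈ Finset.range m, a (l + 1) := by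
    rw [backSum_apply]
    refine Finset.sum_congr rfl fun l _ => ?_
    simp only [hshift, ha]
    congr 1
    refine propext ⟨fun h k hk => ?_, fun h k hk => h (k + 1) (by omega)⟩
    rcases k with - | k
    · simpa using hx
    · exact h k (by omega)
  have h2 : backSum p τ B m ζ x = ∑ l ∈ Finset.range m, a l := backSum_apply ζ x
  have h3 : a m = 0 := by
    obtain ⟨k, hk, hkB⟩ := hB x
    exact if_neg fun h => h k hk.le hkB
  have h4 : a 0 = ζ x := if_pos fun k hk => by
    obtain rfl := Nat.le_zero.1 hk
    exact hx
  have h5 := Finset.sum_range_succ a m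
  rw [Finset.sum_range_succ', h3, h4] at h5
  rw [h1, h2]
  linear_combination h5

end

/-- The relation `∑_j (a_j⁻¹ e_j - e_j) = 0` satisfied by the standard generators of the first
cohomology of the Cayley tree, as a finitely supported family of coefficients. -/
def cycleRel (n : ℕ) : FreeGroup (Fin n) × Fin n →₀ ℂ :=
  ∑ j, (Finsupp.single ((FreeGroup.of j)⁻¹, j) 1 - Finsupp.single (1, j) 1)

theorem orbitComb_sum_single_sub {Γ ι V : Type*} [Fintype ι] [NormedAddCommGroup V]
    [NormedSpace ℂ V] (α : Γ → Module.End ℂ V) (g h : ι → Γ) (ξ : ι → V) :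
    orbitComb α (∑ j, (Finsupp.single (g j, j) 1 - Finsupp.single (h j, j) 1)) ξ =
      ∑ j, (α (g j) (ξ j) - α (h j) (ξ j)) := by
  have key : ∀ s : Finset ι,
      orbitComb α (∑ j ∈ s, (Finsupp.single (g j, j) 1 - Finsupp.single (h j, j) 1)) ξ =
        ∑ j ∈ s, (α (g j) (ξ j) - α (h j) (ξ j)) := by
    classical
    intro s
    induction s using Finset.induction_on with
    | empty => simp
    | insert a s ha ih =>
      rw [Finset.sum_insert ha, Finset.sum_insert ha, orbitComb_add, LinearMap.add_apply, ih,
        sub_eq_add_neg, ← Finsupp.single_neg, orbitComb_add, LinearMap.add_apply,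
        orbitComb_single, orbitComb_single]
      simp [sub_eq_add_neg]
  exact key _

theorem orbitComb_cycleRel {n : ℕ} {V : Type*} [NormedAddCommGroup V] [NormedSpace ℂ V]
    (α : FreeGroup (Fin n) → Module.End ℂ V) (ξ : Fin n → V) :
    orbitComb α (cycleRel n) ξ = ∑ j, (α (FreeGroup.of j)⁻¹ (ξ j) - α 1 (ξ j)) :=
  orbitComb_sum_single_sub α _ _ ξ

theorem of_pow_ne_one {n : ℕ} (j : Fin n) {k : ℕ} (hk : 0 < k) :
    (FreeGroup.of j)⁻¹ ^ k ≠ 1 := by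
  intro h
  have := congrArg (FreeGroup.lift fun _ : Fin n => Multiplicative.ofAdd (1 : ℤ)) h
  simp only [map_pow, map_inv, FreeGroup.lift_apply_of, map_one] at this
  have h2 := congrArg Multiplicative.toAdd this
  simp at h2
  omega

/-- The approximate solutions of the relation in `l^p(d_i)^n` are close to a space of dimension
about `(n - 1) d_i`: given all other components, the relation can be solved for the component of one
generator along its orbits, cut into segments of bounded length so that the errors do not add up. -/
theorem cycleRel_model {n : ℕ} (hn : 1 ≤ n) (A : SoficApproximation (FreeGroup (Fin n)))
    (p : ℝ≥0∞) [Fact (1 ≤ p)] {κ θ : ℝ} (hκ : 0 < κ) (hθ : 0 < θ) :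
    ∃ η > (0 : ℝ), ∀ᶠ i in atTop,
      ∃ W : Submodule ℂ (Fin n → PiLp p (fun _ : Fin (A.d i) => ℂ)),
        (Module.finrank ℂ W : ℝ) ≤ ((n - 1 : ℕ) + κ) * A.d i ∧
        ∀ ξ, ‖orbitComb (permEnd p (A.σ i)) (cycleRel n) ξ‖ < η →
          ∃ w ∈ W, ∀ j, ‖ξ j - w j‖ ≤ θ := by
  classical
  obtain ⟨L, hL⟩ := exists_nat_gt (2 / κ)
  have hL0 : (0 : ℝ) < L := lt_trans (by positivity) hL
  have hL0' : 0 < L := by exact_mod_cast hL0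
  let j₀ : Fin n := ⟨0, hn⟩
  refine ⟨θ / (2 * L), by positivity, ?_⟩
  have hper : Negligible A.d fun i => (Finset.Ioo 0 L).biUnion fun k =>
      Finset.univ.filter fun x => (A.σ i (FreeGroup.of j₀)⁻¹ ^ k) x = x := by
    refine Negligible.biUnion _ fun k hk => ?_
    have hk0 := (Finset.mem_Ioo.1 hk).1
    refine ((A.negligible_word_ne (List.replicate k (FreeGroup.of j₀)⁻¹)).union
      (A.negligible_hom_eq (of_pow_ne_one j₀ hk0))).mono fun i x => ?_
    simp only [Finset.mem_union, Finset.mem_filter, Finset.mem_univ, true_and, List.map_replicate,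
      List.prod_replicate]
    intro h1
    by_contra! h2
    refine h2.2 ?_
    rw [← h2.1, h1]
    simp
  filter_upwards [hper.eventually_card_le (half_pos hκ)] with i hi
  set τ := A.σ i (FreeGroup.of j₀)⁻¹ with hτ
  obtain ⟨B₀, hB₀, hB⟩ := exists_rokhlin τ hL0'
  set B := B₀ ∪ (Finset.Ioo 0 L).biUnion fun k => Finset.univ.filter fun x => (τ ^ k) x = x
    with hBdef
  set R : (Fin n → PiLp p (fun _ : Fin (A.d i) => ℂ)) →ₗ[ℂ] PiLp p (fun _ : Fin (A.d i) => ℂ) :=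
    orbitComb (permEnd p (A.σ i)) (cycleRel n) with hR
  have hRapp : ∀ ξ x, R ξ x = ∑ j, (ξ j ((A.σ i (FreeGroup.of j)⁻¹)⁻¹ x) - ξ j x) := by
    intro ξ x
    rw [hR, orbitComb_cycleRel, WithLp.ofLp_sum, Finset.sum_apply]
    simp only [permEnd_apply, A.map_one, permAct_one]
    rfl
  -- the families that solve the relation exactly outside the cutting set `B`
  let W : Submodule ℂ (Fin n → PiLp p (fun _ : Fin (A.d i) => ℂ)) :=
    { carrier := {ξ | ∀ x, x ∉ B → R ξ x = 0}
      add_mem' := fun {a b} ha hb x hx => by simp [ha x hx, hb x hx]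
      zero_mem' := fun x _ => by simp
      smul_mem' := fun c a ha x hx => by simp [ha x hx] }
  refine ⟨W, ?_, fun ξ hξ => ?_⟩
  -- such a family is determined by `ξ_j`, `j ≠ j₀`, and by the values of `ξ_{j₀}` on `B`
  · let Φ : W →ₗ[ℂ] ({j : Fin n // j ≠ j₀} → Fin (A.d i) → ℂ) × (B → ℂ) :=
      { toFun := fun ξ => (fun j x => ξ.1 j x, fun x => ξ.1 j₀ x)
        map_add' := fun _ _ => rfl
        map_smul' := fun _ _ => rfl }
    have hΦ : Function.Injective Φ := by
      rw [injective_iff_map_eq_zero]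
      intro ξ hξ
      have h1 : ∀ j, j ≠ j₀ → ∀ x, ξ.1 j x = 0 := fun j hj x =>
        congrFun (congrFun (congrArg Prod.fst hξ) ⟨j, hj⟩) x
      have h2 : ∀ x ∈ B, ξ.1 j₀ x = 0 := fun x hx => congrFun (congrArg Prod.snd hξ) ⟨x, hx⟩
      have h3 : ∀ x, x ∉ B → ξ.1 j₀ x = ξ.1 j₀ (τ⁻¹ x) := fun x hx => by
        have := ξ.2 x hx
        rw [hRapp, Finset.sum_eq_single j₀ (fun j _ hj => by simp [h1 j hj]) (by simp)] at this
        exact (sub_eq_zero.1 this).symm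
      have h4 : ∀ k x, (τ ^ k)⁻¹ x ∈ B → ξ.1 j₀ x = 0 := by
        intro k
        induction k with
        | zero => exact fun x hx => h2 x (by simpa using hx)
        | succ k ih =>
          intro x hx
          by_cases hxB : x ∈ B
          · exact h2 x hxB
          · rw [h3 x hxB]
            refine ih _ ?_
            rwa [← Equiv.Perm.mul_apply, ← mul_inv_rev, ← pow_succ']
      refine Subtype.ext (funext fun j => PiLp.ext fun x => ?_)
      by_cases hj : j = j₀
      · rw [hj]
        obtain ⟨k, -, hk⟩ := hB x
        exact h4 k x hk
      · exact h1 j hj x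
    have h1 := LinearMap.finrank_le_finrank_of_injective hΦ
    rw [Module.finrank_prod, Module.finrank_pi_fintype] at h1
    simp only [Module.finrank_fintype_fun_eq_card, Finset.sum_const, Finset.card_univ,
      Fintype.card_fin, smul_eq_mul, Fintype.card_coe] at h1
    rw [Fintype.card_subtype_compl, Fintype.card_fin, Fintype.card_subtype_eq] at h1
    have h2 : (B.card : ℝ) ≤ κ * A.d i := by
      have e1 : (B.card : ℝ) ≤ B₀.card + κ / 2 * A.d i := by
        refine le_trans (by exact_mod_cast Finset.card_union_le _ _) (add_le_add le_rfl hi)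
      have e2 : (B₀.card : ℝ) ≤ κ / 2 * A.d i := by
        have e3 : (B₀.card : ℝ) * L ≤ A.d i := by
          have : B₀.card * L ≤ A.d i := by simpa using hB₀
          exact_mod_cast this
        have e4 : 1 ≤ κ / 2 * L := by
          rw [div_lt_iff₀ hκ] at hL
          linarith
        nlinarith [Nat.cast_nonneg (α := ℝ) B₀.card]
      linarith
    calc (Module.finrank ℂ W : ℝ) ≤ ((n - 1 : ℕ) * A.d i + B.card : ℝ) := by exact_mod_cast h1
      _ ≤ _ := by rw [add_mul]; linarith
  -- correct the component `j₀` of an approximate solution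
  · set c := backSum p τ B (2 * L) (R ξ) with hc
    refine ⟨ξ + Pi.single j₀ c, fun x hx => ?_, fun j => ?_⟩
    · have h1 : R (Pi.single j₀ c) x = c (τ⁻¹ x) - c x := by
        rw [hRapp, Finset.sum_eq_single j₀ (fun j _ hj => by simp [hj]) (by simp)]
        simp [hτ]
      rw [map_add, PiLp.add_apply, h1, hc, backSum_sub hB _ hx, add_neg_cancel]
    · rw [Pi.add_apply, sub_add_cancel_left, norm_neg]
      by_cases hj : j = j₀
      · subst hj
        rw [Pi.single_eq_same]
        refine (norm_backSum_le _).trans ?_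
        calc ((2 * L : ℕ) : ℝ) * ‖R ξ‖ ≤ (2 * L : ℕ) * (θ / (2 * L)) := by gcongr
          _ = θ := by push_cast; field_simp
      · rw [Pi.single_eq_of_ne hj, norm_zero]
        exact hθ.le

/-! ### Widths of finite-dimensional sets -/

section Widths

variable {κ : Type*} [Fintype κ] [DecidableEq κ]

theorem sum_norm_starProjection_single_sq (W : Submodule ℂ (EuclideanSpace ℂ κ)) :
    ∑ q, ‖W.starProjection (EuclideanSpace.single q 1)‖ ^ 2 = Module.finrank ℂ W := by
  let b := stdOrthonormalBasis ℂ W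
  have h : ∀ q, ‖W.starProjection (EuclideanSpace.single q 1)‖ ^ 2 =
      ∑ l, ‖(b l : EuclideanSpace ℂ κ) q‖ ^ 2 := fun q => by
    rw [Submodule.starProjection_apply, ← Submodule.coe_norm, ← b.sum_sq_norm_inner_right]
    refine Finset.sum_congr rfl fun l _ => ?_
    rw [Submodule.inner_orthogonalProjectionOnto_eq_of_mem_left, EuclideanSpace.inner_single_right]
    simp
  simp_rw [h]
  rw [Finset.sum_comm]
  have h2 : ∀ l, ∑ q, ‖(b l : EuclideanSpace ℂ κ) q‖ ^ 2 = 1 := fun l => by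
    rw [← EuclideanSpace.norm_sq_eq, Submodule.norm_coe, b.orthonormal.1 l, one_pow]
  simp [h2]

/-- A space that is close to many vectors of the standard orthonormal basis has large dimension. -/
theorem card_mul_le_finrank (W : Submodule ℂ (EuclideanSpace ℂ κ)) (Q : Finset κ) {δ : ℝ}
    (h : ∀ q ∈ Q, ∃ w ∈ W, ‖EuclideanSpace.single q (1 : ℂ) - w‖ ^ 2 ≤ δ) :
    Q.card * (1 - δ) ≤ Module.finrank ℂ W := by
  rw [← sum_norm_starProjection_single_sq W]
  calc (Q.card * (1 - δ) : ℝ) = ∑ q ∈ Q, (1 - δ) := by rw [Finset.sum_const, nsmul_eq_mul]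
    _ ≤ ∑ q ∈ Q, ‖W.starProjection (EuclideanSpace.single q 1)‖ ^ 2 := by
        refine Finset.sum_le_sum fun q hq => ?_
        obtain ⟨w, hw, hd⟩ := h q hq
        have h1 : ‖EuclideanSpace.single q (1 : ℂ) -
            W.starProjection (EuclideanSpace.single q (1 : ℂ))‖ ≤
            ‖EuclideanSpace.single q (1 : ℂ) - w‖ := by
          rw [Submodule.starProjection_minimal]
          exact ciInf_le ⟨0, by rintro _ ⟨w, rfl⟩; exact norm_nonneg _⟩ (⟨w, hw⟩ : W)
        have h2 := Submodule.norm_sq_eq_add_norm_sq_starProjection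
          (EuclideanSpace.single q (1 : ℂ)) W
        rw [Submodule.starProjection_orthogonal_val, PiLp.norm_single] at h2
        have h3 := pow_le_pow_left₀ (norm_nonneg _) h1 2
        simp only [norm_one, one_pow] at h2
        linarith
    _ ≤ _ := Finset.sum_le_sum_of_subset_of_nonneg (Finset.subset_univ _)
        fun _ _ _ => by positivity

/-- A subspace of dimension `r` of `ℂ^κ` contains a vector of supremum norm at most `1` with at
least `r` coordinates of modulus `1`: move a vector in directions that vanish on the coordinates
that have modulus `1` already. -/
theorem exists_flat_vector (Z : Submodule ℂ (EuclideanSpace ℂ κ)) :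
    ∃ u ∈ Z, (∀ q, ‖u q‖ ≤ 1) ∧
      Module.finrank ℂ Z ≤ (Finset.univ.filter fun q => ‖u q‖ = 1).card := by
  suffices H : ∀ k ≤ Module.finrank ℂ Z, ∃ u ∈ Z, (∀ q, ‖u q‖ ≤ 1) ∧
      k ≤ (Finset.univ.filter fun q => ‖u q‖ = 1).card from H _ le_rfl
  intro k
  induction k with
  | zero => exact fun _ => ⟨0, Z.zero_mem, by simp, by simp⟩
  | succ k ih =>
    intro hk
    obtain ⟨u, hu, hu1, huk⟩ := ih (by omega)
    set I := Finset.univ.filter fun q => ‖u q‖ = 1 with hI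
    rcases huk.lt_or_eq with hlt | heq
    · exact ⟨u, hu, hu1, hlt⟩
    let Φ : Z →ₗ[ℂ] (I → ℂ) :=
      { toFun := fun v q => v.1 q
        map_add' := fun _ _ => rfl
        map_smul' := fun _ _ => rfl }
    obtain ⟨⟨v, hv⟩, hvΦ, hv0⟩ := (Submodule.ne_bot_iff _).1
      (LinearMap.ker_ne_bot_of_finrank_lt (f := Φ) (by
        rw [Module.finrank_fintype_fun_eq_card, Fintype.card_coe]; omega))
    have hvI : ∀ q ∈ I, v q = 0 := fun q hq => congrFun hvΦ ⟨q, hq⟩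
    obtain ⟨q₀, hq₀⟩ : ∃ q, v q ≠ 0 := by
      by_contra! h
      exact hv0 (Subtype.ext (PiLp.ext h))
    have hq₀I : q₀ ∈ Iᶜ := Finset.mem_compl.2 fun h => hq₀ (hvI _ h)
    let f : ℝ → ℝ := fun t => Iᶜ.sup' ⟨q₀, hq₀I⟩ fun q => ‖u q + t * v q‖
    have hf : Continuous f := by
      refine Continuous.finset_sup'_apply _ fun q _ => ?_
      fun_prop
    have hf0 : f 0 ≤ 1 := Finset.sup'_le _ _ fun q _ => by simpa using hu1 q
    obtain ⟨t, -, ht⟩ : ∃ t ∈ Set.Icc 0 (2 / ‖v q₀‖), f t = 1 := by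
      have hpos : 0 < ‖v q₀‖ := norm_pos_iff.2 hq₀
      refine intermediate_value_Icc (by positivity) hf.continuousOn ⟨hf0, ?_⟩
      refine le_trans ?_ (Finset.le_sup' _ hq₀I)
      have h1 : ‖((2 / ‖v q₀‖ : ℝ) : ℂ) * v q₀‖ = 2 := by
        rw [norm_mul, Complex.norm_real, Real.norm_of_nonneg (by positivity),
          div_mul_cancel₀ _ hpos.ne']
      have h2 := norm_sub_le (u q₀ + ((2 / ‖v q₀‖ : ℝ) : ℂ) * v q₀) (u q₀)
      rw [add_sub_cancel_left, h1] at h2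
      linarith [hu1 q₀]
    have hmem : u + (t : ℂ) • v ∈ Z := Z.add_mem hu (Z.smul_mem _ hv)
    have happ : ∀ q, (u + (t : ℂ) • v) q = u q + t * v q := fun q => rfl
    refine ⟨_, hmem, fun q => ?_, ?_⟩
    · rw [happ]
      by_cases hq : q ∈ I
      · rw [hvI q hq, mul_zero, add_zero]
        exact hu1 q
      · rw [← ht]
        exact Finset.le_sup' (fun q => ‖u q + t * v q‖) (Finset.mem_compl.2 hq)
    · obtain ⟨q₁, hq₁, hq₁'⟩ := Finset.exists_mem_eq_sup' ⟨q₀, hq₀I⟩ fun q => ‖u q + t * v q‖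
      have hq₁'' : ‖u q₁ + t * v q₁‖ = 1 := hq₁'.symm.trans ht
      have hsub : insert q₁ I ⊆ Finset.univ.filter fun q => ‖(u + (t : ℂ) • v) q‖ = 1 := by
        intro q hq
        rw [Finset.mem_filter, happ]
        refine ⟨Finset.mem_univ _, ?_⟩
        rcases Finset.mem_insert.1 hq with rfl | hq
        · exact hq₁''
        · rw [hvI q hq, mul_zero, add_zero]
          exact (Finset.mem_filter.1 hq).2
      have := Finset.card_le_card hsub
      rw [Finset.card_insert_of_notMem (Finset.mem_compl.1 hq₁)] at this
      omega

/-- If the unit ball of `Z` for the `l¹`-norm is within `θ` of `W`, then the dimension of `W` is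
at least that of `Z` up to the error `θ · |κ|`. A flat vector of `Z ∩ Wᗮ`, normalized in `l¹`, is
far from `W`. -/
theorem finrank_le_of_l1_close (Z W : Submodule ℂ (EuclideanSpace ℂ κ)) {θ : ℝ} (hθ : 0 ≤ θ)
    (h : ∀ z ∈ Z, ∑ q, ‖z q‖ ≤ 1 → ∃ w ∈ W, ∑ q, ‖z q - w q‖ ≤ θ) :
    (Module.finrank ℂ Z : ℝ) ≤ Module.finrank ℂ W + θ * Fintype.card κ := by
  obtain ⟨u, ⟨huZ, huW⟩, hu1, hur⟩ := exists_flat_vector (Z ⊓ Wᗮ)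
  have hdim : Module.finrank ℂ Z ≤
      Module.finrank ℂ W + Module.finrank ℂ (Z ⊓ Wᗮ : Submodule ℂ _) := by
    have h1 := Submodule.finrank_sup_add_finrank_inf_eq Z Wᗮ
    have h2 := Submodule.finrank_add_finrank_orthogonal W
    have h3 := Submodule.finrank_le (Z ⊔ Wᗮ)
    omega
  suffices hr : (Module.finrank ℂ (Z ⊓ Wᗮ : Submodule ℂ _) : ℝ) ≤ θ * Fintype.card κ by
    have : (Module.finrank ℂ Z : ℝ) ≤ Module.finrank ℂ W +
      Module.finrank ℂ (Z ⊓ Wᗮ : Submodule ℂ _) := by exact_mod_cast hdim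
    linarith
  set r := Module.finrank ℂ (Z ⊓ Wᗮ : Submodule ℂ _) with hr
  rcases Nat.eq_zero_or_pos r with h0 | h0
  · rw [h0]; simp; positivity
  have hsq : (r : ℝ) ≤ ‖u‖ ^ 2 := by
    rw [EuclideanSpace.norm_sq_eq]
    calc (r : ℝ) ≤ ∑ q ∈ Finset.univ.filter (fun q => ‖u q‖ = 1), ‖u q‖ ^ 2 := by
          rw [Finset.sum_congr rfl (g := fun _ => (1 : ℝ)) fun q hq => by
            rw [(Finset.mem_filter.1 hq).2, one_pow]]
          simpa using hur
      _ ≤ _ := Finset.sum_le_sum_of_subset_of_nonneg (Finset.subset_univ _)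
          fun _ _ _ => by positivity
  set s := ∑ q, ‖u q‖ with hs
  have hsN : s ≤ Fintype.card κ := (Finset.sum_le_sum fun q _ => hu1 q).trans (by simp)
  have hs0 : 0 < s := by
    refine lt_of_le_of_ne (Finset.sum_nonneg fun _ _ => norm_nonneg _) fun h0' => ?_
    have h1 := (Finset.sum_eq_zero_iff_of_nonneg fun _ _ => norm_nonneg _).1 h0'.symm
    have h2 : u = 0 := PiLp.ext fun q => norm_eq_zero.1 (h1 q (Finset.mem_univ q))
    rw [h2, norm_zero] at hsq
    have : (0 : ℝ) < r := by exact_mod_cast h0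
    norm_num at hsq
    linarith
  obtain ⟨w, hw, hd⟩ := h ((s : ℂ)⁻¹ • u) (Z.smul_mem _ huZ) (by
    simp only [PiLp.smul_apply, smul_eq_mul, norm_mul, norm_inv, Complex.norm_real,
      Real.norm_of_nonneg hs0.le]
    rw [← Finset.mul_sum, ← hs, inv_mul_cancel₀ hs0.ne'])
  have hin : inner ℂ u ((s : ℂ)⁻¹ • u - w) = (s : ℂ)⁻¹ * (‖u‖ : ℂ) ^ 2 := by
    rw [inner_sub_right, inner_smul_right, inner_self_eq_norm_sq_to_K,
      (Submodule.mem_orthogonal' W u).1 huW w hw, sub_zero]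
    rfl
  have hle : s⁻¹ * ‖u‖ ^ 2 ≤ θ := by
    have h1 : ‖inner ℂ u ((s : ℂ)⁻¹ • u - w)‖ = s⁻¹ * ‖u‖ ^ 2 := by
      rw [hin, norm_mul, norm_inv, norm_pow, Complex.norm_real, Complex.norm_real, norm_norm,
        Real.norm_of_nonneg hs0.le]
    rw [← h1, PiLp.inner_apply]
    refine (norm_sum_le _ _).trans (le_trans (Finset.sum_le_sum fun q _ => ?_) hd)
    refine (norm_inner_le_norm _ _).trans ?_
    calc _ ≤ 1 * _ := mul_le_mul_of_nonneg_right (hu1 q) (norm_nonneg _)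
      _ = _ := by rw [one_mul]; rfl
  rw [inv_mul_le_iff₀ hs0] at hle
  calc (r : ℝ) ≤ s * θ := hsq.trans hle
    _ ≤ _ := by rw [mul_comm]; gcongr

end Widths

/-! ### Representations that map to a multiple of the regular representation -/

/-- Composition with a bijection of the index set, as an isometry of `l^p`. -/
def lpReindex (p : ℝ≥0∞) [Fact (1 ≤ p)] {κ : Type*} (e : κ ≃ κ) :
    lp (fun _ : κ => ℂ) p →ₗᵢ[ℂ] lp (fun _ : κ => ℂ) p where
  toFun f := ⟨f ∘ e, memLp_comp_equiv e (lp.memℓp f)⟩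
  map_add' _ _ := rfl
  map_smul' _ _ := rfl
  norm_map' f := norm_comp_equiv e f

@[simp]
theorem lpReindex_apply (p : ℝ≥0∞) [Fact (1 ≤ p)] {κ : Type*} (e : κ ≃ κ)
    (f : lp (fun _ : κ => ℂ) p) (q : κ) : lpReindex p e f q = f (e q) := rfl

theorem lpReindex_single (p : ℝ≥0∞) [Fact (1 ≤ p)] {κ : Type*} [DecidableEq κ] (e : κ ≃ κ) (q : κ)
    (c : ℂ) : lpReindex p e (lp.single p q c) = lp.single p (e.symm q) c := by
  refine lp.ext (funext fun r => ?_)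
  simp only [lpReindex_apply, lp.single_apply, Pi.single_apply, Equiv.eq_symm_apply]

/-- Left translation by `g⁻¹` on the index set `Γ × ι`, so that `(g f)(h, j) = f(g⁻¹ h, j)`. -/
def leftShift {Γ : Type*} [Group Γ] (ι : Type*) (g : Γ) : Γ × ι ≃ Γ × ι :=
  (Equiv.mulLeft g⁻¹).prodCongr (Equiv.refl ι)

@[simp]
theorem leftShift_apply {Γ ι : Type*} [Group Γ] (g : Γ) (q : Γ × ι) :
    leftShift ι g q = (g⁻¹ * q.1, q.2) := rfl

@[simp]
theorem leftShift_symm_apply {Γ ι : Type*} [Group Γ] (g : Γ) (q : Γ × ι) :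
    (leftShift ι g).symm q = (g * q.1, q.2) := by
  simp [Equiv.symm_apply_eq]

theorem one_le_toReal {p : ℝ≥0∞} [Fact (1 ≤ p)] (hp : p ≠ ∞) : 1 ≤ p.toReal := by
  simpa using ENNReal.toReal_mono hp (Fact.out : 1 ≤ p)

theorem sum_norm_sq_le {p : ℝ≥0∞} [Fact (1 ≤ p)] (hp2 : p ≤ 2) {ι : Type*} [Fintype ι]
    (f : PiLp p (fun _ : ι => ℂ)) : ∑ x, ‖f x‖ ^ 2 ≤ ‖f‖ ^ 2 := by
  have hptop : p ≠ ∞ := (hp2.trans_lt (by simp)).ne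
  have hp1 : 1 ≤ p.toReal := one_le_toReal hptop
  have hp0 : 0 < p.toReal := by linarith
  have hp2' : p.toReal ≤ 2 := by
    have := ENNReal.toReal_mono (by simp) hp2
    simpa using this
  rcases eq_or_ne f 0 with rfl | hf
  · simp
  have hs : 0 < ‖f‖ := norm_pos_iff.2 hf
  have hsum : ∑ x, ‖f x‖ ^ p.toReal = ‖f‖ ^ p.toReal := by
    rw [PiLp.norm_eq_sum hp0, ← Real.rpow_mul (Finset.sum_nonneg fun _ _ => by positivity),
      one_div_mul_cancel hp0.ne', Real.rpow_one]
  have hsplit : ∀ t : ℝ, 0 ≤ t → t ^ 2 = t ^ p.toReal * t ^ (2 - p.toReal) := fun t ht => by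
    rw [← Real.rpow_add_of_nonneg ht hp0.le (by linarith), add_sub_cancel, Real.rpow_two]
  calc ∑ x, ‖f x‖ ^ 2 ≤ ∑ x, ‖f x‖ ^ p.toReal * ‖f‖ ^ (2 - p.toReal) := by
        refine Finset.sum_le_sum fun x _ => ?_
        rw [hsplit _ (norm_nonneg _)]
        gcongr
        exact PiLp.norm_apply_le f x
    _ = ‖f‖ ^ 2 := by rw [← Finset.sum_mul, hsum, hsplit _ hs.le]

/-- Families in `l^p(d)` regarded as elements of a Hilbert space. -/
def flatten (p : ℝ≥0∞) [Fact (1 ≤ p)] (ι : Type*) [Fintype ι] (d : ℕ) :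
    (ι → PiLp p (fun _ : Fin d => ℂ)) ≃ₗ[ℂ] EuclideanSpace ℂ (ι × Fin d) where
  toFun ξ := WithLp.toLp 2 fun q => ξ q.1 q.2
  invFun v := fun j => WithLp.toLp p fun x => v (j, x)
  map_add' _ _ := rfl
  map_smul' _ _ := rfl
  left_inv _ := rfl
  right_inv _ := rfl

section Spread

variable {Γ ι : Type*} {p : ℝ≥0∞} [Fact (1 ≤ p)] {d : ℕ}

/-- The map `l^p(Γ × ι) → l^p(d)` that restricts the `j`-th component to `E` and moves it to
`l^p(d)` along `g ↦ φ(g) x`. -/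
def spread (p : ℝ≥0∞) [Fact (1 ≤ p)] (φ : Γ → Equiv.Perm (Fin d)) (E : Finset Γ) (x : Fin d)
    (j : ι) : lp (fun _ : Γ × ι => ℂ) p →L[ℂ] PiLp p (fun _ : Fin d => ℂ) :=
  ∑ g ∈ E, (lp.evalCLM ℂ (fun _ : Γ × ι => ℂ) p (g, j)).smulRight (PiLp.single p (φ g x) 1)

theorem spread_apply (φ : Γ → Equiv.Perm (Fin d)) (E : Finset Γ) (x : Fin d) (j : ι)
    (f : lp (fun _ : Γ × ι => ℂ) p) :
    spread p φ E x j f = ∑ g ∈ E, f (g, j) • PiLp.single p (φ g x) (1 : ℂ) := by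
  simp only [spread, sum_apply]
  rfl

theorem spread_single [DecidableEq Γ] [DecidableEq ι] (φ : Γ → Equiv.Perm (Fin d))
    {E : Finset Γ} (x : Fin d) (j l : ι) {g : Γ} (hg : g ∈ E) (c : ℂ) :
    spread p φ E x j (lp.single p (g, l) c) =
      if l = j then c • PiLp.single p (φ g x) (1 : ℂ) else 0 := by
  rw [spread_apply, Finset.sum_eq_single g]
  · rw [lp.single_apply, Pi.single_apply]
    by_cases h : l = j
    · simp [h]
    · rw [if_neg h, if_neg (by simp [Ne.symm h]), zero_smul]
  · intro h _ hne
    rw [lp.single_apply_ne _ _ _ (by simp [hne]), zero_smul]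
  · exact fun h => absurd hg h

theorem norm_spread_le (hp : p ≠ ∞) (φ : Γ → Equiv.Perm (Fin d)) (E : Finset Γ) (x : Fin d)
    (j : ι) (hinj : Set.InjOn (fun g => φ g x) E) : ‖spread (ι := ι) p φ E x j‖ ≤ 1 := by
  classical
  have hp1 : 1 ≤ p.toReal := one_le_toReal hp
  have hp0 : 0 < p.toReal := by linarith
  refine ContinuousLinearMap.opNorm_le_bound _ zero_le_one fun f => ?_
  rw [one_mul, ← Real.rpow_le_rpow_iff (norm_nonneg _) (norm_nonneg _) hp0,
    PiLp.norm_eq_sum hp0, ← Real.rpow_mul (Finset.sum_nonneg fun _ _ => by positivity),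
    one_div_mul_cancel hp0.ne', Real.rpow_one]
  have happ : ∀ y, spread p φ E x j f y = ∑ g ∈ E, if y = φ g x then f (g, j) else 0 := by
    intro y
    rw [spread_apply, WithLp.ofLp_sum, Finset.sum_apply]
    refine Finset.sum_congr rfl fun g _ => ?_
    rw [PiLp.smul_apply, PiLp.single_apply, smul_eq_mul, mul_ite, mul_one, mul_zero]
  calc ∑ y, ‖spread p φ E x j f y‖ ^ p.toReal
      = ∑ y ∈ E.image fun g => φ g x, ‖spread p φ E x j f y‖ ^ p.toReal := by
        refine (Finset.sum_subset (Finset.subset_univ _) fun y _ hy => ?_).symm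
        rw [happ, Finset.sum_eq_zero, norm_zero, Real.zero_rpow hp0.ne']
        intro g hg
        rw [if_neg]
        rintro rfl
        exact hy (Finset.mem_image_of_mem (fun g => φ g x) hg)
    _ = ∑ g ∈ E, ‖f (g, j)‖ ^ p.toReal := by
        rw [Finset.sum_image hinj]
        refine Finset.sum_congr rfl fun g hg => ?_
        rw [happ, Finset.sum_eq_single g (fun h hh hne => if_neg fun h' => hne
          (hinj hh hg h'.symm)) (fun h => absurd hg h), if_pos rfl]
    _ = ∑ q ∈ E.image fun g => (g, j), ‖f q‖ ^ p.toReal := by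
        rw [Finset.sum_image (by simp [Set.InjOn])]
    _ ≤ ‖f‖ ^ p.toReal := lp.sum_rpow_le_norm_rpow hp0 f _

end Spread

/-- If a representation maps equivariantly to `l^p(Γ)^N`, `p ≤ 2`, and the standard basis vectors
lie in the image, then its lower dimension is at least `N`. The test maps are `spread φ E x j ∘ Θ`
for the points `x` at which the sofic approximation is multiplicative and free on a finite set `E`.
They send the preimages of the basis vectors to the basis vectors of `l^p(d)^N`, and for `p ≤ 2`
smallness in `l^p` gives smallness in `l^2`, so that `card_mul_le_finrank` applies. -/
theorem le_lowerDim_of_lpMap {n : ℕ} (hn : 1 ≤ n) (A : SoficApproximation (FreeGroup (Fin n)))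
    {X : Type*} [NormedAddCommGroup X] [NormedSpace ℂ X] {p : ℝ≥0∞} [Fact (1 ≤ p)] (hp2 : p ≤ 2)
    {π : Representation ℂ (FreeGroup (Fin n)) X} {S : ℕ → X} (hS : IsDynGenerating π S)
    (ρ : ProductNorm) (N : ℕ)
    (Θ : X →L[ℂ] lp (fun _ : FreeGroup (Fin n) × Fin N => ℂ) p)
    (hΘ : ∀ g x, Θ (π g x) = lpReindex p (leftShift (Fin N) g) (Θ x))
    (e : Fin N → X) (he : ∀ j, Θ (e j) = lp.single p (1, j) 1) :
    (N : ℝ≥0∞) ≤ lowerDim p A π S ρ := by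
  classical
  have hptop : p ≠ ∞ := (hp2.trans_lt (by simp)).ne
  have : Nontrivial (FreeGroup (Fin n)) :=
    ⟨(FreeGroup.of (⟨0, hn⟩ : Fin n))⁻¹, 1, by simp⟩
  refine le_lowerDim_of_model A A.eventually_pos hS ρ e N (B := ‖Θ‖ + 1) (by positivity)
    fun κ hκ => ⟨min 1 (κ / (2 * (N ^ 2 + 1))), by positivity, fun Q η hη => ?_⟩
  -- finitely supported approximations of the vectors in `Q`
  have happrox : ∀ v : X, ∃ F : Finset (FreeGroup (Fin n) × Fin N),
      ‖Θ v - ∑ q ∈ F, lp.single p q (Θ v q)‖ < η / 2 := fun v => by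
    have h1 := lp.hasSum_single hptop (Θ v)
    obtain ⟨F, hF⟩ := (Metric.tendsto_atTop.1 h1) (η / 2) (half_pos hη)
    refine ⟨F, ?_⟩
    rw [← dist_eq_norm, dist_comm]
    exact hF F le_rfl
  choose F hF using happrox
  let E : Finset (FreeGroup (Fin n)) := {1} ∪ Q.biUnion fun q =>
    (F q.2).image Prod.fst ∪ (F q.2).image fun r => q.1.prod * r.1
  let bad : ∀ i, Finset (Fin (A.d i)) := fun i =>
    ((E.offDiag.biUnion fun gh => Finset.univ.filter fun x => A.hom i gh.1 x = A.hom i gh.2 x) ∪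
      (Q ×ˢ E).biUnion fun qh => Finset.univ.filter fun x => A.hom i qh.2 x ∈
        Finset.univ.filter fun y => (qh.1.1.map (A.σ i)).prod y ≠ A.hom i qh.1.1.prod y)
  have hbad : Negligible A.d bad := by
    refine Negligible.union (Negligible.biUnion _ fun gh hgh => ?_)
      (Negligible.biUnion _ fun qh _ => ?_)
    · exact A.negligible_hom_eq (Finset.mem_offDiag.1 hgh).2.2
    · exact (A.negligible_word_ne qh.1.1).preimage _
  filter_upwards [hbad.eventually_card_le (show 0 < κ / (2 * (N + 1)) by positivity)] with i hi
  have hgood1 : ∀ x, x ∉ bad i → Set.InjOn (fun g => A.hom i g x) E := by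
    intro x hx g hg h hh hgh
    by_contra hne
    refine hx (Finset.mem_union_left _ (Finset.mem_biUnion.2 ⟨(g, h), ?_, ?_⟩))
    · exact Finset.mem_offDiag.2 ⟨hg, hh, hne⟩
    · simpa using hgh
  have hgood2 : ∀ x, x ∉ bad i → ∀ q ∈ Q, ∀ h ∈ E, (q.1.map (A.σ i)).prod (A.hom i h x) =
      A.hom i (q.1.prod * h) x := by
    intro x hx q hq h hh
    by_contra hne
    refine hx (Finset.mem_union_right _ (Finset.mem_biUnion.2 ⟨(q, h), ?_, ?_⟩))
    · exact Finset.mem_product.2 ⟨hq, hh⟩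
    · simpa using hne
  refine ⟨{T | ∃ x ∉ bad i, ∃ j, T = (spread p (A.hom i) E x j).comp Θ}, ?_, ?_, ?_⟩
  · rintro T ⟨x, hx, j, rfl⟩
    refine (ContinuousLinearMap.opNorm_comp_le _ _).trans ?_
    have := mul_le_mul_of_nonneg_right (norm_spread_le (ι := Fin N) hptop (A.hom i) E x j
      (hgood1 x hx)) (norm_nonneg Θ)
    linarith
  · rintro T ⟨x, hx, j, rfl⟩ ⟨w, v⟩ hq
    simp only [ContinuousLinearMap.comp_apply, hΘ]
    set f := Θ v
    set f' := ∑ q ∈ F v, lp.single p q (f q) with hf'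
    set s := spread (ι := Fin N) p (A.hom i) E x j with hs
    have hsn := norm_spread_le (ι := Fin N) hptop (A.hom i) E x j (hgood1 x hx)
    have hmem1 : ∀ r ∈ F v, r.1 ∈ E := fun r hr => Finset.mem_union_right _
      (Finset.mem_biUnion.2 ⟨(w, v), hq, Finset.mem_union_left _ (Finset.mem_image_of_mem _ hr)⟩)
    have hmem2 : ∀ r ∈ F v, w.prod * r.1 ∈ E := fun r hr => Finset.mem_union_right _
      (Finset.mem_biUnion.2 ⟨(w, v), hq, Finset.mem_union_right _
        (Finset.mem_image_of_mem (fun r : FreeGroup (Fin n) × Fin N => w.prod * r.1) hr)⟩)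
    -- on finitely supported vectors the map is exactly equivariant
    have hexact : s (lpReindex p (leftShift (Fin N) w.prod) f') =
        permAct p (w.map (A.σ i)).prod (s f') := by
      rw [hf', map_sum, map_sum, map_sum, map_sum]
      refine Finset.sum_congr rfl fun r hr => ?_
      obtain ⟨h, l⟩ := r
      rw [lpReindex_single, leftShift_symm_apply, hs, spread_single _ _ _ _ (hmem2 _ hr),
        spread_single _ _ _ _ (hmem1 _ hr)]
      split_ifs
      · rw [map_smul, permAct_single]
        simp only
        rw [hgood2 x hx (w, v) hq h (hmem1 _ hr)]
      · rw [map_zero]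
    have e1 : ‖s (lpReindex p (leftShift (Fin N) w.prod) f) -
        s (lpReindex p (leftShift (Fin N) w.prod) f')‖ < η / 2 := by
      rw [← map_sub, ← map_sub]
      refine (s.le_of_opNorm_le hsn _).trans_lt ?_
      rw [one_mul, LinearIsometry.norm_map]
      exact hF v
    have e2 : ‖permAct p (w.map (A.σ i)).prod (s f') -
        permAct p (w.map (A.σ i)).prod (s f)‖ < η / 2 := by
      rw [← map_sub, LinearIsometryEquiv.norm_map, ← map_sub]
      refine (s.le_of_opNorm_le hsn _).trans_lt ?_
      rw [one_mul, norm_sub_rev]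
      exact hF v
    rw [← hexact] at e2
    exact (norm_sub_le_norm_sub_add_norm_sub _ _ _).trans_lt (by linarith)
  · intro W hW
    set θ := min 1 (κ / (2 * ((N : ℝ) ^ 2 + 1))) with hθ
    have hθ0 : 0 ≤ θ := by positivity
    have hmain := card_mul_le_finrank (W.map (flatten p (Fin N) (A.d i)).toLinearMap)
      (Finset.univ ×ˢ (bad i)ᶜ) (δ := N * θ ^ 2) (by
        rintro ⟨j, x⟩ hq
        have hx : x ∉ bad i := by simpa using hq
        obtain ⟨w, hw, hd⟩ := hW _ ⟨x, hx, j, rfl⟩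
        refine ⟨_, Submodule.mem_map_of_mem hw, ?_⟩
        have hTe : ∀ l, ((spread p (A.hom i) E x j).comp Θ) (e l) =
            if l = j then PiLp.single p x (1 : ℂ) else 0 := fun l => by
          rw [ContinuousLinearMap.comp_apply, he, spread_single _ _ _ _
            (Finset.mem_union_left _ (Finset.mem_singleton_self _)), one_smul, map_one]
          rfl
        rw [EuclideanSpace.norm_sq_eq, Fintype.sum_prod_type]
        calc _ = ∑ l, ∑ y, ‖(((spread p (A.hom i) E x j).comp Θ) (e l) - w l) y‖ ^ 2 := by
              refine Finset.sum_congr rfl fun l _ => Finset.sum_congr rfl fun y _ => ?_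
              congr 2
              rw [hTe]
              change (EuclideanSpace.single (j, x) (1 : ℂ)) (l, y) - w l y = _ - w l y
              congr 1
              by_cases hl : l = j
              · simp [hl]
              · simp [hl]
          _ ≤ ∑ l : Fin N, θ ^ 2 := by
              refine Finset.sum_le_sum fun l _ => (sum_norm_sq_le hp2 _).trans ?_
              exact pow_le_pow_left₀ (norm_nonneg _) (hd l) 2
          _ = N * θ ^ 2 := by simp)
    rw [LinearEquiv.finrank_map_eq] at hmain
    refine le_trans ?_ hmain
    rw [Finset.card_product, Finset.card_univ, Fintype.card_fin, Finset.card_compl,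
      Fintype.card_fin, Nat.cast_mul, Nat.cast_sub ((Finset.card_le_univ _).trans_eq (by simp))]
    have hθ1 : θ ^ 2 ≤ κ / (2 * ((N : ℝ) ^ 2 + 1)) := by
      calc θ ^ 2 = θ * θ := sq θ
        _ ≤ 1 * (κ / (2 * ((N : ℝ) ^ 2 + 1))) := mul_le_mul (min_le_left _ _) (min_le_right _ _)
            hθ0 zero_le_one
        _ = _ := one_mul _
    have hθ2 : (N : ℝ) ^ 2 * θ ^ 2 ≤ κ / 2 := by
      calc _ ≤ ((N : ℝ) ^ 2 + 1) * (κ / (2 * ((N : ℝ) ^ 2 + 1))) := by gcongr; linarith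
        _ = κ / 2 := by field_simp
    have hb : (N : ℝ) * (bad i).card ≤ κ / 2 * A.d i := by
      calc _ ≤ ((N : ℝ) + 1) * (κ / (2 * (N + 1)) * A.d i) := by gcongr; linarith
        _ = _ := by field_simp
    have hNb : 0 ≤ (N : ℝ) ^ 2 * θ ^ 2 * (bad i).card := by positivity
    have hd0 : (0 : ℝ) ≤ A.d i := by positivity
    have : (N : ℝ) ^ 2 * θ ^ 2 * A.d i ≤ κ / 2 * A.d i := by gcongr
    nlinarith

/-! ### Restriction and extension by zero on `l^p` -/

section CompExtend

variable {p : ℝ≥0∞} [Fact (1 ≤ p)] {κ κ' : Type*} {e : κ' → κ}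

theorem memℓp_comp_injective (he : Function.Injective e) {f : κ → ℂ} (hf : Memℓp f p) :
    Memℓp (f ∘ e) p := by
  rcases p.trichotomy with rfl | rfl | h
  · exact absurd (Fact.out : (1 : ℝ≥0∞) ≤ 0) (by simp)
  · rw [memℓp_infty_iff] at hf ⊢
    refine hf.mono ?_
    rintro _ ⟨i, rfl⟩
    exact ⟨e i, rfl⟩
  · rw [memℓp_gen_iff h] at hf ⊢
    exact hf.comp_injective he

theorem memℓp_extend (he : Function.Injective e) {f : κ' → ℂ} (hf : Memℓp f p) :
    Memℓp (Function.extend e f 0) p := by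
  rcases p.trichotomy with rfl | rfl | h
  · exact absurd (Fact.out : (1 : ℝ≥0∞) ≤ 0) (by simp)
  · rw [memℓp_infty_iff] at hf ⊢
    obtain ⟨C, hC⟩ := hf
    refine ⟨max C 0, ?_⟩
    rintro _ ⟨q, rfl⟩
    by_cases hq : ∃ r, e r = q
    · obtain ⟨r, rfl⟩ := hq
      simp only [he.extend_apply]
      exact le_max_of_le_left (hC ⟨r, rfl⟩)
    · simp [Function.extend_apply' _ _ _ hq]
  · rw [memℓp_gen_iff h] at hf ⊢
    refine (he.summable_iff fun q hq => ?_).1 (by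
      simpa [Function.comp_def, he.extend_apply] using hf)
    rw [Function.extend_apply' _ _ _ (by simpa using hq)]
    simp [h.ne']

/-- Composition with an injective map of the index sets. -/
def lpComp (p : ℝ≥0∞) [Fact (1 ≤ p)] (e : κ' → κ) (he : Function.Injective e) :
    lp (fun _ : κ => ℂ) p →L[ℂ] lp (fun _ : κ' => ℂ) p :=
  LinearMap.mkContinuous
    { toFun := fun f => ⟨f ∘ e, memℓp_comp_injective he (lp.memℓp f)⟩
      map_add' := fun _ _ => rfl
      map_smul' := fun _ _ => rfl } 1 fun f => by
    rw [one_mul]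
    rcases p.trichotomy with rfl | rfl | h
    · exact absurd (Fact.out : (1 : ℝ≥0∞) ≤ 0) (by simp)
    · exact lp.norm_le_of_forall_le (norm_nonneg _) fun q => lp.norm_apply_le_norm (by simp) f (e q)
    · refine lp.norm_le_of_forall_sum_le h (norm_nonneg _) fun s => ?_
      refine le_trans (le_of_eq ?_) (lp.sum_rpow_le_norm_rpow h f (s.map ⟨e, he⟩))
      rw [Finset.sum_map]
      rfl

@[simp]
theorem lpComp_apply (he : Function.Injective e) (f : lp (fun _ : κ => ℂ) p) (q : κ') :
    lpComp p e he f q = f (e q) := rfl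

/-- Extension by zero along an injective map of the index sets. -/
def lpExtend (p : ℝ≥0∞) [Fact (1 ≤ p)] (e : κ' → κ) (he : Function.Injective e) :
    lp (fun _ : κ' => ℂ) p →L[ℂ] lp (fun _ : κ => ℂ) p :=
  LinearMap.mkContinuous
    { toFun := fun f => ⟨Function.extend e f 0, memℓp_extend he (lp.memℓp f)⟩
      map_add' := fun f g => lp.ext (funext fun q => by
        change Function.extend e (⇑(f + g)) 0 q =
          Function.extend e f 0 q + Function.extend e g 0 q
        by_cases hq : ∃ r, e r = q
        · obtain ⟨r, rfl⟩ := hq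
          rw [he.extend_apply, he.extend_apply, he.extend_apply]
          rfl
        · rw [Function.extend_apply' _ _ _ hq, Function.extend_apply' _ _ _ hq,
            Function.extend_apply' _ _ _ hq]
          simp)
      map_smul' := fun c f => lp.ext (funext fun q => by
        change Function.extend e (⇑(c • f)) 0 q = c * Function.extend e f 0 q
        by_cases hq : ∃ r, e r = q
        · obtain ⟨r, rfl⟩ := hq
          simp [he.extend_apply]
        · simp [Function.extend_apply' _ _ _ hq]) } 1 fun f => by
    rw [one_mul]
    rcases p.trichotomy with rfl | rfl | h
    · exact absurd (Fact.out : (1 : ℝ≥0∞) ≤ 0) (by simp)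
    · refine lp.norm_le_of_forall_le (norm_nonneg _) fun q => ?_
      change ‖Function.extend e f 0 q‖ ≤ _
      by_cases hq : ∃ r, e r = q
      · obtain ⟨r, rfl⟩ := hq
        rw [he.extend_apply]
        exact lp.norm_apply_le_norm (by simp) f r
      · simp [Function.extend_apply' _ _ _ hq]
    · refine lp.norm_le_of_tsum_le h (norm_nonneg _) ?_
      rw [lp.norm_rpow_eq_tsum h f]
      refine le_of_eq ?_
      rw [← he.tsum_eq]
      · refine tsum_congr fun q => ?_
        change ‖Function.extend e f 0 (e q)‖ ^ _ = _
        rw [he.extend_apply]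
      · intro q hq
        by_contra hq'
        refine hq ?_
        change ‖Function.extend e f 0 q‖ ^ _ = _
        rw [Function.extend_apply' _ _ _ (by simpa using hq')]
        simp [h.ne']

@[simp]
theorem lpExtend_apply (he : Function.Injective e) (f : lp (fun _ : κ' => ℂ) p) (q : κ') :
    lpExtend p e he f (e q) = f q :=
  he.extend_apply _ _ _

theorem lpExtend_apply_of_notMem (he : Function.Injective e) (f : lp (fun _ : κ' => ℂ) p) {q : κ}
    (hq : ¬ ∃ r, e r = q) : lpExtend p e he f q = 0 :=
  Function.extend_apply' _ _ _ hq

end CompExtend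

/-! ### Simplices of the Cayley tree -/

section Cayley

variable {n : ℕ}

theorem OrdSimplex.ext_one {Γ V : Type*} [Group Γ] [MulAction Γ V] {K : GComplex Γ V}
    {v w : OrdSimplex K 1} (h0 : v.1 0 = w.1 0) (h1 : v.1 1 = w.1 1) : v = w := by
  refine Subtype.ext (Function.Embedding.ext fun i => ?_)
  match i with
  | 0 => exact h0
  | 1 => exact h1

theorem of_mul_of_ne_one (j k : Fin n) : FreeGroup.of j * FreeGroup.of k ≠ 1 := by
  intro h
  have := congrArg (FreeGroup.lift fun _ : Fin n => Multiplicative.ofAdd (1 : ℤ)) h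
  simp only [map_mul, FreeGroup.lift_apply_of, map_one] at this
  have h2 := congrArg Multiplicative.toAdd this
  simp at h2

/-- The pair `(x, y)` of distinct elements as an embedding. -/
def pairEmb {V : Type*} {x y : V} (h : x ≠ y) : Fin 2 ↪ V :=
  ⟨![x, y], fun a b hab => by
    fin_cases a <;> fin_cases b
    · rfl
    · exact absurd hab h
    · exact absurd hab.symm h
    · rfl⟩

theorem map_univ_pairEmb {V : Type*} [DecidableEq V] {x y : V} (h : x ≠ y) :
    Finset.univ.map (pairEmb h) = {x, y} := by
  ext z
  simp only [Finset.mem_map, Finset.mem_univ, true_and, Finset.mem_insert, Finset.mem_singleton]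
  constructor
  · rintro ⟨i, rfl⟩
    match i with
    | 0 => exact Or.inl rfl
    | 1 => exact Or.inr rfl
  · rintro (rfl | rfl)
    · exact ⟨0, rfl⟩
    · exact ⟨1, rfl⟩

theorem ne_mul_of (q : FreeGroup (Fin n) × Fin n) : q.1 ≠ q.1 * FreeGroup.of q.2 := by
  simp

/-- The vertex `x`. -/
def vtx (x : FreeGroup (Fin n)) : OrdSimplex (cayleyComplex n) 0 :=
  ⟨⟨fun _ => x, fun _ _ _ => Subsingleton.elim (α := Fin 1) _ _⟩,
    Or.inl ⟨x, by
      rw [Finset.eq_singleton_iff_unique_mem]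
      refine ⟨Finset.mem_map.2 ⟨0, Finset.mem_univ _, rfl⟩, fun y hy => ?_⟩
      obtain ⟨i, -, rfl⟩ := Finset.mem_map.1 hy
      rfl⟩⟩

/-- The oriented edge `(g, g a_j)`. -/
def posEdge (q : FreeGroup (Fin n) × Fin n) : OrdSimplex (cayleyComplex n) 1 :=
  ⟨pairEmb (ne_mul_of q), Or.inr ⟨q.1, q.2, map_univ_pairEmb _⟩⟩

/-- The oriented edge `(g a_j, g)`. -/
def negEdge (q : FreeGroup (Fin n) × Fin n) : OrdSimplex (cayleyComplex n) 1 :=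
  ⟨pairEmb (ne_mul_of q).symm,
    Or.inr ⟨q.1, q.2, (map_univ_pairEmb _).trans (Finset.pair_comm _ _)⟩⟩

theorem vtx_surjective : Function.Surjective (vtx (n := n)) := fun v =>
  ⟨v.1 0, Subtype.ext (Function.Embedding.ext fun i => by
    rw [Subsingleton.elim (α := Fin 1) i 0]
    rfl)⟩

theorem vtx_injective : Function.Injective (vtx (n := n)) := fun _ _ h =>
  congrArg (fun v : OrdSimplex (cayleyComplex n) 0 => v.1 0) h

theorem posEdge_injective : Function.Injective (posEdge (n := n)) := fun q r h => by
  have h0 : q.1 = r.1 := congrArg (fun v : OrdSimplex (cayleyComplex n) 1 => v.1 0) h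
  have h1 : q.1 * FreeGroup.of q.2 = r.1 * FreeGroup.of r.2 :=
    congrArg (fun v : OrdSimplex (cayleyComplex n) 1 => v.1 1) h
  rw [h0] at h1
  exact Prod.ext h0 (FreeGroup.of_injective (mul_left_cancel h1))

theorem negEdge_injective : Function.Injective (negEdge (n := n)) := fun q r h => by
  have h0 : q.1 = r.1 := congrArg (fun v : OrdSimplex (cayleyComplex n) 1 => v.1 1) h
  have h1 : q.1 * FreeGroup.of q.2 = r.1 * FreeGroup.of r.2 :=
    congrArg (fun v : OrdSimplex (cayleyComplex n) 1 => v.1 0) h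
  rw [h0] at h1
  exact Prod.ext h0 (FreeGroup.of_injective (mul_left_cancel h1))

theorem posEdge_ne_negEdge (q r : FreeGroup (Fin n) × Fin n) : posEdge q ≠ negEdge r := fun h => by
  have h0 : q.1 = r.1 * FreeGroup.of r.2 :=
    congrArg (fun v : OrdSimplex (cayleyComplex n) 1 => v.1 0) h
  have h1 : q.1 * FreeGroup.of q.2 = r.1 :=
    congrArg (fun v : OrdSimplex (cayleyComplex n) 1 => v.1 1) h
  rw [h0, mul_assoc] at h1
  exact of_mul_of_ne_one _ _ (mul_eq_left.1 h1)

theorem exists_eq_edge (v : OrdSimplex (cayleyComplex n) 1) :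
    (∃ q, v = posEdge q) ∨ ∃ q, v = negEdge q := by
  have hne : v.1 0 ≠ v.1 1 := fun h => by simpa using v.1.injective h
  have hmem : ∀ i, v.1 i ∈ Finset.univ.map v.1 := fun i => by simp
  have m0 := hmem 0
  have m1 := hmem 1
  rcases v.2 with ⟨x, hx⟩ | ⟨x, j, hx⟩
  · rw [hx, Finset.mem_singleton] at m0 m1
    exact absurd (m0.trans m1.symm) hne
  · rw [hx, Finset.mem_insert, Finset.mem_singleton] at m0 m1
    rcases m0 with h0 | h0 <;> rcases m1 with h1 | h1
    · exact absurd (h0.trans h1.symm) hne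
    · exact Or.inl ⟨(x, j), OrdSimplex.ext_one h0 h1⟩
    · exact Or.inr ⟨(x, j), OrdSimplex.ext_one h0 h1⟩
    · exact absurd (h0.trans h1.symm) hne

theorem isEmpty_ordSimplex {m : ℕ} (hm : 2 ≤ m) : IsEmpty (OrdSimplex (cayleyComplex n) m) :=
  ⟨fun v => by
    have hc : (Finset.univ.map v.1).card = m + 1 := by simp
    have : (Finset.univ.map v.1).card ≤ 2 := by
      rcases v.2 with ⟨x, hx⟩ | ⟨x, j, hx⟩
      · rw [hx]; simp
      · rw [hx]; exact Finset.card_le_two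
    omega⟩

theorem smul_posEdge (g : FreeGroup (Fin n)) (q : FreeGroup (Fin n) × Fin n) :
    g • posEdge q = posEdge (g * q.1, q.2) :=
  OrdSimplex.ext_one rfl (mul_assoc _ _ _).symm

theorem perm_swap_posEdge (q : FreeGroup (Fin n) × Fin n) :
    (posEdge q).perm (Equiv.swap 0 1) = negEdge q :=
  OrdSimplex.ext_one rfl rfl

theorem face_zero_posEdge (q : FreeGroup (Fin n) × Fin n) :
    (posEdge q).face 0 = vtx (q.1 * FreeGroup.of q.2) :=
  Subtype.ext (Function.Embedding.ext fun i => by rw [Subsingleton.elim (α := Fin 1) i 0]; rfl)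

theorem face_one_posEdge (q : FreeGroup (Fin n) × Fin n) : (posEdge q).face 1 = vtx q.1 :=
  Subtype.ext (Function.Embedding.ext fun i => by rw [Subsingleton.elim (α := Fin 1) i 0]; rfl)

theorem face_one_negEdge (q : FreeGroup (Fin n) × Fin n) :
    (negEdge q).face 1 = vtx (q.1 * FreeGroup.of q.2) :=
  Subtype.ext (Function.Embedding.ext fun i => by rw [Subsingleton.elim (α := Fin 1) i 0]; rfl)

theorem cochain_negEdge {p : ℝ≥0∞} [Fact (1 ≤ p)] (f : LpCochain (cayleyComplex n) p 1)
    (q : FreeGroup (Fin n) × Fin n) : f.1 (negEdge q) = -f.1 (posEdge q) := by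
  rw [← perm_swap_posEdge, f.2]
  simp

theorem coboundary_posEdge (f : OrdSimplex (cayleyComplex n) 0 → ℂ)
    (q : FreeGroup (Fin n) × Fin n) :
    coboundary (cayleyComplex n) 0 f (posEdge q) =
      f (vtx (q.1 * FreeGroup.of q.2)) - f (vtx q.1) := by
  change ∑ j : Fin 2, (-1 : ℂ) ^ (j : ℕ) * f ((posEdge q).face j) = _
  rw [Fin.sum_univ_two, face_zero_posEdge, face_one_posEdge]
  simp [sub_eq_add_neg]

theorem boundary_vtx (f : OrdSimplex (cayleyComplex n) 1 → ℂ) (x : FreeGroup (Fin n)) :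
    boundary (cayleyComplex n) 0 f (vtx x) =
      ∑ j, (f (posEdge (x, j)) + f (negEdge (x * (FreeGroup.of j)⁻¹, j))) := by
  classical
  change ∑ w ∈ (vtx x).finite_extensions.toFinset, f w = _
  have hset : (vtx x).finite_extensions.toFinset =
      (Finset.univ.image fun j => posEdge (x, j)) ∪
        Finset.univ.image fun j => negEdge (x * (FreeGroup.of j)⁻¹, j) := by
    ext w
    simp only [Set.Finite.mem_toFinset, Set.mem_ofPred_eq, Finset.mem_union, Finset.mem_image,
      Finset.mem_univ, true_and]
    constructor
    · intro h
      rcases exists_eq_edge w with ⟨⟨g, j⟩, rfl⟩ | ⟨⟨g, j⟩, rfl⟩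
      · left
        have h' := vtx_injective ((face_one_posEdge (g, j)).symm.trans h)
        exact ⟨j, by rw [← h']⟩
      · right
        have h' := vtx_injective ((face_one_negEdge (g, j)).symm.trans h)
        exact ⟨j, by rw [← h']; simp⟩
    · rintro (⟨j, rfl⟩ | ⟨j, rfl⟩)
      · exact face_one_posEdge _
      · exact (face_one_negEdge _).trans (by simp)
  rw [hset, Finset.sum_union, Finset.sum_image, Finset.sum_image, ← Finset.sum_add_distrib]
  · intro i _ j _ h
    exact congrArg Prod.snd (negEdge_injective h)
  · intro i _ j _ h
    exact congrArg Prod.snd (posEdge_injective h)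
  · rw [Finset.disjoint_left]
    intro w h1 h2
    obtain ⟨i, -, rfl⟩ := Finset.mem_image.1 h1
    obtain ⟨j, -, h⟩ := Finset.mem_image.1 h2
    exact posEdge_ne_negEdge _ _ h.symm

/-- An `l^p`-function on the positively oriented edges, extended antisymmetrically. -/
def ofEdges (p : ℝ≥0∞) [Fact (1 ≤ p)] (h : lp (fun _ : FreeGroup (Fin n) × Fin n => ℂ) p) :
    LpCochain (cayleyComplex n) p 1 :=
  ⟨lpExtend p posEdge posEdge_injective h - lpExtend p negEdge negEdge_injective h, by
    intro τ v
    have hpp : ∀ q, ¬ ∃ r, negEdge r = posEdge (n := n) q := fun q ⟨r, h⟩ =>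
      posEdge_ne_negEdge q r h.symm
    have hpn : ∀ q, ¬ ∃ r, posEdge r = negEdge (n := n) q := fun q ⟨r, h⟩ =>
      posEdge_ne_negEdge r q h
    have hswap : ∀ q, (negEdge (n := n) q).perm (Equiv.swap 0 1) = posEdge q := fun q =>
      OrdSimplex.ext_one rfl rfl
    have hτ : τ = 1 ∨ τ = Equiv.swap 0 1 := by
      revert τ
      decide
    rcases hτ with rfl | rfl
    · have : v.perm 1 = v := OrdSimplex.ext_one rfl rfl
      rw [this]
      simp
    · rcases exists_eq_edge v with ⟨q, rfl⟩ | ⟨q, rfl⟩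
      · rw [perm_swap_posEdge]
        simp [lpExtend_apply_of_notMem _ _ (hpp q), lpExtend_apply_of_notMem _ _ (hpn q)]
      · rw [hswap]
        simp [lpExtend_apply_of_notMem _ _ (hpp q), lpExtend_apply_of_notMem _ _ (hpn q)]⟩

theorem ofEdges_posEdge (p : ℝ≥0∞) [Fact (1 ≤ p)]
    (h : lp (fun _ : FreeGroup (Fin n) × Fin n => ℂ) p) (q : FreeGroup (Fin n) × Fin n) :
    (ofEdges p h).1 (posEdge q) = h q := by
  have : ¬ ∃ r, negEdge r = posEdge (n := n) q := fun ⟨r, h⟩ => posEdge_ne_negEdge q r h.symm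
  change (lpExtend p posEdge posEdge_injective h - lpExtend p negEdge negEdge_injective h :
    lp (fun _ : OrdSimplex (cayleyComplex n) 1 => ℂ) p) (posEdge q) = _
  simp [lpExtend_apply_of_notMem _ _ this]

theorem cochain_ext {p : ℝ≥0∞} [Fact (1 ≤ p)] {f g : LpCochain (cayleyComplex n) p 1}
    (h : ∀ q, f.1 (posEdge q) = g.1 (posEdge q)) : f = g := by
  refine Subtype.ext (lp.ext (funext fun v => ?_))
  rcases exists_eq_edge v with ⟨q, rfl⟩ | ⟨q, rfl⟩
  · exact h q
  · rw [cochain_negEdge, cochain_negEdge, h]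

/-- The coordinates of a `1`-cochain: its values on the positively oriented edges. -/
def edgeCoord (n : ℕ) (p : ℝ≥0∞) [Fact (1 ≤ p)] :
    LpCochain (cayleyComplex n) p 1 ≃L[ℂ] lp (fun _ : FreeGroup (Fin n) × Fin n => ℂ) p :=
  LinearEquiv.toContinuousLinearEquivOfBounds
    { toFun := fun f => lpComp p posEdge posEdge_injective f.1
      map_add' := fun _ _ => rfl
      map_smul' := fun _ _ => rfl
      invFun := ofEdges p
      left_inv := fun f => cochain_ext fun q => ofEdges_posEdge p _ q
      right_inv := fun h => lp.ext (funext fun q => ofEdges_posEdge p h q) }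
    (LpCochain.normConst p 1)⁻¹ (LpCochain.normConst p 1 * 2)
    (fun f => by
      change ‖lpComp p posEdge posEdge_injective f.1‖ ≤ _
      rw [LpCochain.norm_def, inv_mul_cancel_left₀ (LpCochain.normConst_pos p 1).ne']
      refine ((lpComp p posEdge posEdge_injective).le_of_opNorm_le
        (LinearMap.mkContinuous_norm_le _ zero_le_one _) _).trans_eq (one_mul _))
    (fun h => by
      change ‖ofEdges p h‖ ≤ _
      rw [LpCochain.norm_def, mul_assoc]
      refine mul_le_mul_of_nonneg_left ?_ (LpCochain.normConst_pos p 1).le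
      refine (norm_sub_le _ _).trans ?_
      have h1 := (lpExtend p (posEdge (n := n)) posEdge_injective).le_of_opNorm_le
        (LinearMap.mkContinuous_norm_le _ zero_le_one _) h
      have h2 := (lpExtend p (negEdge (n := n)) negEdge_injective).le_of_opNorm_le
        (LinearMap.mkContinuous_norm_le _ zero_le_one _) h
      linarith)

@[simp]
theorem edgeCoord_apply (p : ℝ≥0∞) [Fact (1 ≤ p)] (f : LpCochain (cayleyComplex n) p 1)
    (q : FreeGroup (Fin n) × Fin n) : edgeCoord n p f q = f.1 (posEdge q) := rfl

theorem edgeCoord_translation (p : ℝ≥0∞) [Fact (1 ≤ p)] (g : FreeGroup (Fin n))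
    (f : LpCochain (cayleyComplex n) p 1) :
    edgeCoord n p (translation (cayleyComplex n) p 1 g f) =
      lpReindex p (leftShift (Fin n) g) (edgeCoord n p f) := by
  refine lp.ext (funext fun q => ?_)
  change f.1 (g⁻¹ • posEdge q) = _
  rw [smul_posEdge]
  rfl

theorem edgeCoord_symm_translation (p : ℝ≥0∞) [Fact (1 ≤ p)] (g : FreeGroup (Fin n))
    (h : lp (fun _ : FreeGroup (Fin n) × Fin n => ℂ) p) :
    translation (cayleyComplex n) p 1 g ((edgeCoord n p).symm h) =
      (edgeCoord n p).symm (lpReindex p (leftShift (Fin n) g) h) := by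
  rw [ContinuousLinearEquiv.eq_symm_apply, edgeCoord_translation,
    ContinuousLinearEquiv.apply_symm_apply]

/-- The function on the group that corresponds to a `0`-cochain. -/
def vertexCoord (n : ℕ) (p : ℝ≥0∞) [Fact (1 ≤ p)] :
    LpCochain (cayleyComplex n) p 0 →ₗ[ℂ] lp (fun _ : FreeGroup (Fin n) => ℂ) p where
  toFun f := lpComp p vtx vtx_injective f.1
  map_add' _ _ := rfl
  map_smul' _ _ := rfl

theorem vertexCoord_surjective (p : ℝ≥0∞) [Fact (1 ≤ p)] :
    Function.Surjective (vertexCoord n p) := by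
  intro h
  refine ⟨⟨lpExtend p vtx vtx_injective h, fun τ v => ?_⟩, lp.ext (funext fun x => ?_)⟩
  · have h1 : τ = 1 := Subsingleton.elim (α := Equiv.Perm (Fin 1)) _ _
    rw [h1, show v.perm 1 = v from rfl]
    simp
  · exact lpExtend_apply vtx_injective h x

end Cayley

/-! ### Averaging operators on the free group -/

section Averaging

variable {n : ℕ}

/-- A product `c g` with a letter `c` starts with `c` unless `c` is cancelled. -/
theorem mk_mul_mem_startsWith_iff (w : Fin n × Bool) (g : FreeGroup (Fin n)) :
    FreeGroup.mk [w] * g ∈ FreeGroup.startsWith w ↔ g ∉ FreeGroup.startsWith (w.1, !w.2) := by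
  refine ⟨fun h hg => ?_, FreeGroup.startsWith_mk_mul g⟩
  have hred : FreeGroup.IsReduced g.toWord := FreeGroup.isReduced_toWord
  rcases hL : g.toWord with - | ⟨a, t⟩
  · simp [FreeGroup.startsWith, hL] at hg
  · have ha : a = (w.1, !w.2) := by simpa [FreeGroup.startsWith, hL] using hg
    subst ha
    rw [hL] at hred
    have hmul : FreeGroup.mk [w] * g = FreeGroup.mk t := by
      rw [← g.mk_toWord, hL, FreeGroup.mul_mk]
      exact Quot.sound (FreeGroup.Red.Step.cons_not (x := w.1) (b := w.2))
    have ht : FreeGroup.IsReduced t := by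
      rcases t with - | ⟨c, t⟩
      · simp
      · exact (FreeGroup.isReduced_cons_cons.1 hred).2
    rw [hmul] at h
    rcases t with - | ⟨c, t⟩
    · simp [FreeGroup.startsWith] at h
    · have hc : c = w := by
        simpa [FreeGroup.startsWith, FreeGroup.toWord_mk, ht.reduce_eq] using h
      subst hc
      have := (FreeGroup.isReduced_cons_cons.1 hred).1
      simp at this

/-- The letter `a_j` or `a_j⁻¹`. -/
def letter (j : Fin n) (b : Bool) : FreeGroup (Fin n) := FreeGroup.mk [(j, b)]

theorem letter_true (j : Fin n) : letter j true = FreeGroup.of j := rfl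

theorem letter_inv (j : Fin n) (b : Bool) : (letter j b)⁻¹ = letter j !b := by
  simp [letter, FreeGroup.inv_mk, FreeGroup.invRev]

theorem letter_false (j : Fin n) : letter j false = (FreeGroup.of j)⁻¹ := by
  rw [← letter_true, letter_inv, Bool.not_true]

/-- The set of the elements of the free group whose reduced word ends with a given letter. -/
def endsWith (j : Fin n) (b : Bool) : Set (FreeGroup (Fin n)) :=
  {y | y⁻¹ ∈ FreeGroup.startsWith (j, !b)}

theorem endsWith_unique {j k : Fin n} {b c : Bool} {y : FreeGroup (Fin n)} (h : y ∈ endsWith j b)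
    (h' : y ∈ endsWith k c) : j = k ∧ b = c := by
  have h1 : (y⁻¹).toWord[0]? = some (j, !b) := h
  have h2 : (y⁻¹).toWord[0]? = some (k, !c) := h'
  rw [h1] at h2
  simpa using h2

theorem mul_letter_inv_mem_endsWith {j : Fin n} {b : Bool} {y : FreeGroup (Fin n)} :
    y * (letter j b)⁻¹ ∈ endsWith j (!b) ↔ y ∉ endsWith j b := by
  change (y * (letter j b)⁻¹)⁻¹ ∈ FreeGroup.startsWith (j, !!b) ↔ _
  rw [mul_inv_rev, inv_inv, Bool.not_not]
  exact mk_mul_mem_startsWith_iff (j, b) y⁻¹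

variable (p : ℝ≥0∞) [Fact (1 ≤ p)]

/-- Right translation: `(R f)(y) = f(y c⁻¹)`. -/
def rightShift (c : FreeGroup (Fin n)) :
    lp (fun _ : FreeGroup (Fin n) => ℂ) p →L[ℂ] lp (fun _ : FreeGroup (Fin n) => ℂ) p :=
  (lpReindex p (Equiv.mulRight c⁻¹)).toContinuousLinearMap

@[simp]
theorem rightShift_apply (c : FreeGroup (Fin n)) (f : lp (fun _ : FreeGroup (Fin n) => ℂ) p)
    (y : FreeGroup (Fin n)) : rightShift p c f y = f (y * c⁻¹) := rfl

open Classical in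
/-- Restriction to a set, extended by zero. -/
def lpMask {κ : Type*} (s : Set κ) : lp (fun _ : κ => ℂ) p →L[ℂ] lp (fun _ : κ => ℂ) p :=
  (lpExtend p ((↑) : s → κ) Subtype.val_injective).comp (lpComp p ((↑) : s → κ)
    Subtype.val_injective)

open Classical in
theorem lpMask_apply {κ : Type*} (s : Set κ) (f : lp (fun _ : κ => ℂ) p) (q : κ) :
    lpMask p s f q = if q ∈ s then f q else 0 := by
  split_ifs with h
  · exact lpExtend_apply Subtype.val_injective _ (⟨q, h⟩ : s)
  · exact lpExtend_apply_of_notMem Subtype.val_injective _ (by rintro ⟨r, rfl⟩; exact h r.2)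

/-- The averaging operator `(M f)(y) = n⁻¹ ∑_j f(y c_j⁻¹)`, where `c_j` is `a_j` or `a_j⁻¹`. -/
def avg (n : ℕ) (b : Bool) :
    lp (fun _ : FreeGroup (Fin n) => ℂ) p →L[ℂ] lp (fun _ : FreeGroup (Fin n) => ℂ) p :=
  (n : ℂ)⁻¹ • ∑ j, rightShift p (letter j b)

/-- The part of `M` that lengthens words: `n⁻¹ ∑_j f(y c_j⁻¹)` over the `j` such that `y` ends with
`c_j`. -/
def avgUp (n : ℕ) (b : Bool) :
    lp (fun _ : FreeGroup (Fin n) => ℂ) p →L[ℂ] lp (fun _ : FreeGroup (Fin n) => ℂ) p :=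
  (n : ℂ)⁻¹ • ∑ j, (lpMask p (endsWith j b)).comp (rightShift p (letter j b))

/-- The part of `M` that shortens words. -/
def avgDown (n : ℕ) (b : Bool) :
    lp (fun _ : FreeGroup (Fin n) => ℂ) p →L[ℂ] lp (fun _ : FreeGroup (Fin n) => ℂ) p :=
  (n : ℂ)⁻¹ • ∑ j, (lpMask p (endsWith j b)ᶜ).comp (rightShift p (letter j b))

variable {p}

theorem avg_apply (b : Bool) (f : lp (fun _ : FreeGroup (Fin n) => ℂ) p) (y : FreeGroup (Fin n)) :
    avg p n b f y = (n : ℂ)⁻¹ * ∑ j, f (y * (letter j b)⁻¹) := by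
  simp only [avg, smul_apply, lp.coeFn_smul, Pi.smul_apply, smul_eq_mul, sum_apply,
    lp.coeFn_sum, Finset.sum_apply, rightShift_apply]

open Classical in
theorem avgUp_apply (b : Bool) (f : lp (fun _ : FreeGroup (Fin n) => ℂ) p)
    (y : FreeGroup (Fin n)) :
    avgUp p n b f y = (n : ℂ)⁻¹ * ∑ j, if y ∈ endsWith j b then f (y * (letter j b)⁻¹) else 0 := by
  simp only [avgUp, smul_apply, lp.coeFn_smul, Pi.smul_apply, smul_eq_mul, sum_apply,
    lp.coeFn_sum, Finset.sum_apply, ContinuousLinearMap.comp_apply, lpMask_apply,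
    rightShift_apply]

open Classical in
theorem avgDown_apply (b : Bool) (f : lp (fun _ : FreeGroup (Fin n) => ℂ) p)
    (y : FreeGroup (Fin n)) :
    avgDown p n b f y =
      (n : ℂ)⁻¹ * ∑ j, if y ∉ endsWith j b then f (y * (letter j b)⁻¹) else 0 := by
  simp only [avgDown, smul_apply, lp.coeFn_smul, Pi.smul_apply, smul_eq_mul, sum_apply,
    lp.coeFn_sum, Finset.sum_apply, ContinuousLinearMap.comp_apply, lpMask_apply,
    rightShift_apply, Set.mem_compl_iff]

theorem avg_eq (b : Bool) : avg p n b = avgUp p n b + avgDown p n b := by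
  classical
  refine ContinuousLinearMap.ext fun f => lp.ext (funext fun y => ?_)
  rw [add_apply, lp.coeFn_add, Pi.add_apply, avg_apply, avgUp_apply, avgDown_apply, ← mul_add,
    ← Finset.sum_add_distrib]
  congr 1
  refine Finset.sum_congr rfl fun j _ => ?_
  by_cases h : y ∈ endsWith j b <;> simp [h]

/-- The image of `U` is supported on the words that end with some `c_k`, and `D` reads a function
only at words that end with some `c_j⁻¹`. -/
theorem avgDown_mul_avgUp (b : Bool) : avgDown p n b * avgUp p n b = 0 := by
  classical
  refine ContinuousLinearMap.ext fun f => lp.ext (funext fun y => ?_)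
  change avgDown p n b (avgUp p n b f) y = 0
  rw [avgDown_apply, Finset.sum_eq_zero, mul_zero]
  intro j _
  by_cases h : y ∉ endsWith j b
  · rw [if_pos h, avgUp_apply, Finset.sum_eq_zero, mul_zero]
    intro k _
    refine if_neg fun hk => ?_
    have := (endsWith_unique hk (mul_letter_inv_mem_endsWith.2 h)).2
    simp at this
  · exact if_neg h

theorem opNorm_lt_one_of_sum_le (hp : p ≠ ∞) {κ : Type*}
    {T : lp (fun _ : κ => ℂ) p →L[ℂ] lp (fun _ : κ => ℂ) p} {c : ℝ} (hc0 : 0 ≤ c) (hc : c < 1)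
    (h : ∀ f (s : Finset κ), ∑ q ∈ s, ‖T f q‖ ^ p.toReal ≤ c * ‖f‖ ^ p.toReal) : ‖T‖ < 1 := by
  have hp0 : 0 < p.toReal := zero_lt_one.trans_le (one_le_toReal hp)
  refine lt_of_le_of_lt (ContinuousLinearMap.opNorm_le_bound _
    (Real.rpow_nonneg hc0 (1 / p.toReal)) fun f => ?_)
    (Real.rpow_lt_one hc0 hc (by positivity))
  refine lp.norm_le_of_forall_sum_le hp0 (by positivity) fun s => (h f s).trans_eq ?_
  rw [Real.mul_rpow (by positivity) (norm_nonneg _), ← Real.rpow_mul hc0,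
    one_div_mul_cancel hp0.ne', Real.rpow_one]

theorem norm_avgUp_lt_one (hn : 2 ≤ n) (hp1 : 1 < p) (hp : p ≠ ∞) (b : Bool) :
    ‖avgUp p n b‖ < 1 := by
  classical
  have hp0 : 0 < p.toReal := zero_lt_one.trans_le (one_le_toReal hp)
  have hp1' : 1 < p.toReal := by
    have := (ENNReal.toReal_lt_toReal (by simp) hp).2 hp1
    simpa using this
  have hn0 : (1 : ℝ) < n := by exact_mod_cast hn
  refine opNorm_lt_one_of_sum_le hp (c := (n : ℝ) ^ (1 - p.toReal)) (by positivity)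
    (Real.rpow_lt_one_of_one_lt_of_neg hn0 (by linarith)) fun f s => ?_
  have hpt : ∀ y, ‖avgUp p n b f y‖ ^ p.toReal ≤
      (n : ℝ) ^ (-p.toReal) * ∑ j, ‖f (y * (letter j b)⁻¹)‖ ^ p.toReal := fun y => by
    rw [avgUp_apply, norm_mul, norm_inv, Complex.norm_natCast,
      Real.mul_rpow (by positivity) (norm_nonneg _), Real.inv_rpow (by positivity),
      ← Real.rpow_neg (by positivity)]
    refine mul_le_mul_of_nonneg_left ?_ (by positivity)
    by_cases hy : ∃ j, y ∈ endsWith j b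
    · obtain ⟨j, hj⟩ := hy
      rw [Finset.sum_eq_single j (fun k _ hk => if_neg fun h => hk (endsWith_unique h hj).1)
        (by simp), if_pos hj]
      exact Finset.single_le_sum (f := fun j => ‖f (y * (letter j b)⁻¹)‖ ^ p.toReal)
        (fun _ _ => by positivity) (Finset.mem_univ j)
    · push Not at hy
      rw [Finset.sum_eq_zero fun j _ => if_neg (hy j), norm_zero, Real.zero_rpow hp0.ne']
      positivity
  calc _ ≤ ∑ y ∈ s, (n : ℝ) ^ (-p.toReal) * ∑ j, ‖f (y * (letter j b)⁻¹)‖ ^ p.toReal :=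
        Finset.sum_le_sum fun y _ => hpt y
    _ = (n : ℝ) ^ (-p.toReal) *
        ∑ j, ∑ y ∈ s, ‖rightShift p (letter j b) f y‖ ^ p.toReal := by
        rw [← Finset.mul_sum, Finset.sum_comm]
        rfl
    _ ≤ (n : ℝ) ^ (-p.toReal) * ∑ j : Fin n, ‖f‖ ^ p.toReal := by
        gcongr with j
        refine (lp.sum_rpow_le_norm_rpow hp0 _ s).trans_eq ?_
        rw [rightShift, LinearIsometry.coe_toContinuousLinearMap, LinearIsometry.norm_map]
    _ = _ := by
        rw [Finset.sum_const, Finset.card_univ, Fintype.card_fin, nsmul_eq_mul, ← mul_assoc,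
          ← Real.rpow_add_one (by positivity)]
        congr 2
        ring

theorem norm_avgDown_lt_one (hn : 2 ≤ n) (hp : p ≠ ∞) (b : Bool) : ‖avgDown p n b‖ < 1 := by
  classical
  have hp1 := one_le_toReal hp
  have hp0 : 0 < p.toReal := zero_lt_one.trans_le hp1
  have hn0 : (1 : ℝ) < n := by exact_mod_cast hn
  refine opNorm_lt_one_of_sum_le hp (c := (n : ℝ)⁻¹) (by positivity)
    (inv_lt_one_of_one_lt₀ hn0) fun f s => ?_
  have hpt : ∀ y, ‖avgDown p n b f y‖ ^ p.toReal ≤ (n : ℝ)⁻¹ *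
      ∑ j, if y ∉ endsWith j b then ‖f (y * (letter j b)⁻¹)‖ ^ p.toReal else 0 := fun y => by
    rw [avgDown_apply, norm_mul, norm_inv, Complex.norm_natCast,
      Real.mul_rpow (by positivity) (norm_nonneg _)]
    have h1 : ‖∑ j, if y ∉ endsWith j b then f (y * (letter j b)⁻¹) else 0‖ ≤
        ∑ j, if y ∉ endsWith j b then ‖f (y * (letter j b)⁻¹)‖ else 0 := by
      refine (norm_sum_le _ _).trans_eq (Finset.sum_congr rfl fun j _ => ?_)
      split_ifs <;> simp
    have h2 := Real.rpow_sum_le_const_mul_sum_rpow Finset.univ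
      (fun j => if y ∉ endsWith j b then ‖f (y * (letter j b)⁻¹)‖ else 0) hp1
    have h3 : ∀ j, |if y ∉ endsWith j b then ‖f (y * (letter j b)⁻¹)‖ else 0| =
        if y ∉ endsWith j b then ‖f (y * (letter j b)⁻¹)‖ else 0 := fun j => by
      split_ifs <;> simp
    simp only [h3, Finset.card_univ, Fintype.card_fin] at h2
    have h4 : ∀ j, (if y ∉ endsWith j b then ‖f (y * (letter j b)⁻¹)‖ else 0) ^ p.toReal =
        if y ∉ endsWith j b then ‖f (y * (letter j b)⁻¹)‖ ^ p.toReal else 0 := fun j => by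
      split_ifs
      · exact Real.zero_rpow hp0.ne'
      · rfl
    simp only [h4] at h2
    calc _ ≤ ((n : ℝ)⁻¹) ^ p.toReal * ((n : ℝ) ^ (p.toReal - 1) *
          ∑ j, if y ∉ endsWith j b then ‖f (y * (letter j b)⁻¹)‖ ^ p.toReal else 0) := by
          gcongr
          exact (Real.rpow_le_rpow (norm_nonneg _) h1 hp0.le).trans h2
      _ = _ := by
          rw [← mul_assoc, Real.inv_rpow (by positivity), ← Real.rpow_neg (by positivity),
            ← Real.rpow_add (by positivity)]
          congr 1
          rw [show -p.toReal + (p.toReal - 1) = -1 by ring, Real.rpow_neg_one]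
  refine (Finset.sum_le_sum fun y _ => hpt y).trans ?_
  rw [← Finset.mul_sum]
  refine mul_le_mul_of_nonneg_left ?_ (by positivity)
  -- the pairs `(y, j)` that occur are determined by `y c_j⁻¹`
  set T := (s ×ˢ (Finset.univ : Finset (Fin n))).filter fun q => q.1 ∉ endsWith q.2 b with hT
  calc _ = ∑ q ∈ T, ‖f (q.1 * (letter q.2 b)⁻¹)‖ ^ p.toReal := by
        rw [hT, Finset.sum_filter, Finset.sum_product]
    _ = ∑ z ∈ T.image fun q => q.1 * (letter q.2 b)⁻¹, ‖f z‖ ^ p.toReal := by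
        rw [Finset.sum_image]
        rintro ⟨y, j⟩ hq ⟨y', j'⟩ hq' h
        have h1 := mul_letter_inv_mem_endsWith.2 (Finset.mem_filter.1 hq).2
        have h2 := mul_letter_inv_mem_endsWith.2 (Finset.mem_filter.1 hq').2
        simp only at h1 h2 h
        rw [← h] at h2
        obtain rfl := (endsWith_unique h1 h2).1
        rw [mul_left_inj] at h
        rw [h]
    _ ≤ ‖f‖ ^ p.toReal := lp.sum_rpow_le_norm_rpow hp0 _ _

/-- For `n ≥ 2` and `1 < p < ∞` the operator `1 - M` is invertible, as `1 - M = (1 - D) (1 - U)`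
with the parts `U` and `D` of `M` that lengthen and shorten words, both of norm less than `1`. -/
theorem isUnit_one_sub_avg (hn : 2 ≤ n) (hp1 : 1 < p) (hp : p ≠ ∞) (b : Bool) :
    IsUnit (1 - avg p n b) := by
  have h : 1 - avg p n b = (1 - avgDown p n b) * (1 - avgUp p n b) := by
    rw [avg_eq, sub_mul, mul_sub, mul_sub, avgDown_mul_avgUp]
    simp only [mul_one, one_mul]
    abel
  rw [h]
  exact (isUnit_one_sub_of_norm_lt_one (norm_avgDown_lt_one hn hp b)).mul
    (isUnit_one_sub_of_norm_lt_one (norm_avgUp_lt_one hn hp1 hp b))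

end Averaging

/-! ### Dense orbits and dynamically generating sequences -/

section Generating

variable {Γ : Type*} [Group Γ] {X : Type*} [NormedAddCommGroup X] [NormedSpace ℂ X]
  {p : ℝ≥0∞} [Fact (1 ≤ p)] {π : Representation ℂ Γ X}

theorem topologicalClosure_span_orbit_eq_top [DecidableEq Γ] {ι : Type*} [DecidableEq ι]
    (hp : p ≠ ∞) (Ψ : lp (fun _ : Γ × ι => ℂ) p →L[ℂ] X) (hsurj : Function.Surjective Ψ)
    (hΨ : ∀ g f, π g (Ψ f) = Ψ (lpReindex p (leftShift ι g) f)) :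
    (Submodule.span ℂ {y | ∃ g j, y = π g (Ψ (lp.single p (1, j) 1))}).topologicalClosure = ⊤ := by
  refine top_le_iff.1 fun x _ => ?_
  obtain ⟨f, rfl⟩ := hsurj x
  refine mem_closure_of_tendsto ((lp.hasSum_single hp f).mapL Ψ)
    (Filter.Eventually.of_forall fun F => ?_)
  refine Submodule.sum_mem _ fun q _ => ?_
  have h : Ψ (lp.single p q (f q)) = f q • π q.1 (Ψ (lp.single p (1, q.2) 1)) := by
    rw [hΨ, lpReindex_single, leftShift_symm_apply, mul_one, ← map_smul, ← lp.single_smul]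
    simp
  rw [h]
  exact Submodule.smul_mem _ _ (Submodule.subset_span ⟨q.1, q.2, rfl⟩)

/-- A finite family that generates dynamically becomes such a sequence when extended by `0`. -/
theorem exists_isDynGenerating {N : ℕ} (e : Fin N → X)
    (he : (Submodule.span ℂ {y | ∃ g j, y = π g (e j)}).topologicalClosure = ⊤) :
    ∃ S, IsDynGenerating π S := by
  refine ⟨fun k => if h : k < N then e ⟨k, h⟩ else 0, ⟨∑ j, ‖e j‖, fun k => ?_⟩, ?_⟩
  · dsimp only
    split_ifs with h
    · exact Finset.single_le_sum (f := fun j => ‖e j‖) (fun _ _ => norm_nonneg _)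
        (Finset.mem_univ (⟨k, h⟩ : Fin N))
    · rw [norm_zero]
      positivity
  · refine top_le_iff.1 (he.symm.le.trans (Submodule.topologicalClosure_mono
      (Submodule.span_mono ?_)))
    rintro y ⟨g, j, rfl⟩
    exact ⟨g, j, by simp⟩

theorem hasUpperDim_and_hasLowerDim {A : SoficApproximation Γ} {r : ℝ≥0∞}
    (hS : ∃ S, IsDynGenerating π S)
    (hU : ∀ S ρ, IsDynGenerating π S → upperDim p A π S ρ ≤ r)
    (hL : ∀ S ρ, IsDynGenerating π S → r ≤ lowerDim p A π S ρ) :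
    HasUpperDim p A π r ∧ HasLowerDim p A π r :=
  ⟨⟨hS, ProductNorm.nonempty, fun S ρ h => le_antisymm (hU S ρ h)
      ((hL S ρ h).trans (lowerDim_le_upperDim A ρ))⟩,
    ⟨hS, ProductNorm.nonempty, fun S ρ h => le_antisymm
      ((lowerDim_le_upperDim A ρ).trans (hU S ρ h)) (hL S ρ h)⟩⟩

end Generating

/-! ### The reduced cohomology of the Cayley tree in coordinates -/

section Cohomology

theorem mem_cocycles {n : ℕ} {p : ℝ≥0∞} (f : LpCochain (cayleyComplex n) p 1) :
    f ∈ cocycles (cayleyComplex n) p 1 :=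
  funext fun v => ((isEmpty_ordSimplex le_rfl).false v).elim

variable {n : ℕ} {p : ℝ≥0∞} [Fact (1 ≤ p)]

/-- A function on `Γ`, placed in the `j`-th component of `Γ × ι`. -/
def lpInsert {Γ ι : Type*} (p : ℝ≥0∞) [Fact (1 ≤ p)] (j : ι) :
    lp (fun _ : Γ => ℂ) p →L[ℂ] lp (fun _ : Γ × ι => ℂ) p :=
  lpExtend p (fun g => (g, j)) (Prod.mk_left_injective j)

theorem lpInsert_apply {Γ ι : Type*} [DecidableEq ι] (j : ι) (f : lp (fun _ : Γ => ℂ) p)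
    (q : Γ × ι) : lpInsert p j f q = if q.2 = j then f q.1 else 0 := by
  obtain ⟨g, k⟩ := q
  split_ifs with h
  · obtain rfl : k = j := h
    exact lpExtend_apply (Prod.mk_left_injective k) f g
  · refine lpExtend_apply_of_notMem (Prod.mk_left_injective j) f ?_
    rintro ⟨r, hr⟩
    exact h (congrArg Prod.snd hr).symm

/-- The `j`-th component of a function on `Γ × ι`. -/
def lpColumn {Γ ι : Type*} (p : ℝ≥0∞) [Fact (1 ≤ p)] (j : ι) :
    lp (fun _ : Γ × ι => ℂ) p →L[ℂ] lp (fun _ : Γ => ℂ) p :=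
  lpComp p (fun g => (g, j)) (Prod.mk_left_injective j)

@[simp]
theorem lpColumn_apply {Γ ι : Type*} (j : ι) (f : lp (fun _ : Γ × ι => ℂ) p) (g : Γ) :
    lpColumn p j f g = f (g, j) := rfl

/-- The coboundary in coordinates: `(g, j) ↦ h(g a_j) - h(g)`. -/
def edgeDiff (n : ℕ) (p : ℝ≥0∞) [Fact (1 ≤ p)] :
    lp (fun _ : FreeGroup (Fin n) => ℂ) p →L[ℂ] lp (fun _ : FreeGroup (Fin n) × Fin n => ℂ) p :=
  ∑ j, (lpInsert p j).comp (rightShift p (letter j false) - 1)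

theorem edgeDiff_apply (h : lp (fun _ : FreeGroup (Fin n) => ℂ) p)
    (q : FreeGroup (Fin n) × Fin n) :
    edgeDiff n p h q = h (q.1 * FreeGroup.of q.2) - h q.1 := by
  simp only [edgeDiff, sum_apply, lp.coeFn_sum, Finset.sum_apply, ContinuousLinearMap.comp_apply,
    lpInsert_apply]
  rw [Finset.sum_ite_eq Finset.univ q.2, if_pos (Finset.mem_univ _)]
  change h (q.1 * (letter q.2 false)⁻¹) - h q.1 = _
  rw [letter_false, inv_inv]

theorem coboundary_negEdge (f : OrdSimplex (cayleyComplex n) 0 → ℂ)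
    (q : FreeGroup (Fin n) × Fin n) :
    coboundary (cayleyComplex n) 0 f (negEdge q) =
      f (vtx q.1) - f (vtx (q.1 * FreeGroup.of q.2)) := by
  have h0 : (negEdge q).face 0 = vtx q.1 :=
    Subtype.ext (Function.Embedding.ext fun i => by
      rw [Subsingleton.elim (α := Fin 1) i 0]
      rfl)
  change ∑ j : Fin 2, (-1 : ℂ) ^ (j : ℕ) * f ((negEdge q).face j) = _
  rw [Fin.sum_univ_two, h0, face_one_negEdge]
  simp [sub_eq_add_neg]

theorem mem_coboundaries_iff {f : LpCochain (cayleyComplex n) p 1} :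
    f ∈ coboundaries (cayleyComplex n) p 1 ↔ ∃ h, edgeCoord n p f = edgeDiff n p h := by
  constructor
  · rintro ⟨c, hc⟩
    refine ⟨vertexCoord n p c, lp.ext (funext fun q => ?_)⟩
    rw [edgeDiff_apply]
    exact (congrFun hc (posEdge q)).symm.trans (coboundary_posEdge _ q)
  · rintro ⟨h, hh⟩
    obtain ⟨c, rfl⟩ := vertexCoord_surjective p h
    have hq : ∀ q, f.1 (posEdge q) = c.1 (vtx (q.1 * FreeGroup.of q.2)) - c.1 (vtx q.1) :=
      fun q => by
        rw [← edgeCoord_apply, hh, edgeDiff_apply]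
        rfl
    refine ⟨c, funext fun v => ?_⟩
    change coboundary (cayleyComplex n) 0 (LpCochain.fn _ _ _ c) v = f.1 v
    rcases exists_eq_edge v with ⟨q, rfl⟩ | ⟨q, rfl⟩
    · rw [coboundary_posEdge, hq]
      rfl
    · rw [coboundary_negEdge, cochain_negEdge, hq, neg_sub]
      rfl

/-- The class in `H^1_{l^p}` of a function on the positively oriented edges. -/
def cohClass (n : ℕ) (p : ℝ≥0∞) [Fact (1 ≤ p)] :
    lp (fun _ : FreeGroup (Fin n) × Fin n => ℂ) p →L[ℂ] LpCohomology (cayleyComplex n) p 1 :=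
  (Submodule.mkQL _).comp (((edgeCoord n p).symm : _ →L[ℂ] _).codRestrict
    (cocycles (cayleyComplex n) p 1) fun _ => mem_cocycles _)

theorem cohClass_surjective : Function.Surjective (cohClass n p) := fun x => by
  obtain ⟨z, rfl⟩ := Submodule.mkQ_surjective _ x
  refine ⟨edgeCoord n p z.1, ?_⟩
  change Submodule.mkQ _ _ = _
  congr 1
  exact Subtype.ext ((edgeCoord n p).symm_apply_apply z.1)

theorem cohomologyRep_cohClass (g : FreeGroup (Fin n))
    (f : lp (fun _ : FreeGroup (Fin n) × Fin n => ℂ) p) :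
    cohomologyRep (cayleyComplex n) p 1 g (cohClass n p f) =
      cohClass n p (lpReindex p (leftShift (Fin n) g) f) := by
  change Submodule.mkQ _ _ = Submodule.mkQ _ _
  congr 1
  exact Subtype.ext (edgeCoord_symm_translation p g f)

theorem cohClass_edgeDiff (h : lp (fun _ : FreeGroup (Fin n) => ℂ) p) :
    cohClass n p (edgeDiff n p h) = 0 := by
  refine (Submodule.Quotient.mk_eq_zero _).2 ?_
  refine Submodule.le_topologicalClosure (coboundaries (cayleyComplex n) p 1) ?_
  exact mem_coboundaries_iff.2 ⟨h, (edgeCoord n p).apply_symm_apply _⟩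

variable {Y : Type*} [NormedAddCommGroup Y] [NormedSpace ℂ Y]

/-- The map induced on `H^1_{l^p}` by a map that vanishes on the coboundaries. -/
def cohLift (Θ : lp (fun _ : FreeGroup (Fin n) × Fin n => ℂ) p →L[ℂ] Y)
    (hΘ : ∀ h, Θ (edgeDiff n p h) = 0) : LpCohomology (cayleyComplex n) p 1 →L[ℂ] Y :=
  Submodule.liftQL _ ((Θ.comp (edgeCoord n p : _ →L[ℂ] _)).comp
    (cocycles (cayleyComplex n) p 1).subtypeL) fun z hz => by
    have hz' : z.1 ∈ closure (coboundaries (cayleyComplex n) p 1 :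
      Set (LpCochain (cayleyComplex n) p 1)) := hz
    have hcl : IsClosed {f : LpCochain (cayleyComplex n) p 1 | Θ (edgeCoord n p f) = 0} :=
      isClosed_eq (Θ.continuous.comp (edgeCoord n p).continuous) continuous_const
    refine closure_minimal (fun f hf => ?_) hcl hz'
    obtain ⟨h, hh⟩ := mem_coboundaries_iff.1 hf
    change Θ (edgeCoord n p f) = 0
    rw [hh, hΘ]

theorem cohLift_cohClass (Θ : lp (fun _ : FreeGroup (Fin n) × Fin n => ℂ) p →L[ℂ] Y)
    (hΘ : ∀ h, Θ (edgeDiff n p h) = 0) (f : lp (fun _ : FreeGroup (Fin n) × Fin n => ℂ) p) :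
    cohLift Θ hΘ (cohClass n p f) = Θ f := by
  change Θ (edgeCoord n p ((edgeCoord n p).symm f)) = Θ f
  rw [ContinuousLinearEquiv.apply_symm_apply]

theorem norm_cohLift_le (Θ : lp (fun _ : FreeGroup (Fin n) × Fin n => ℂ) p →L[ℂ] Y)
    (hΘ : ∀ h, Θ (edgeDiff n p h) = 0) :
    ‖cohLift Θ hΘ‖ ≤ ‖Θ‖ * ‖(edgeCoord n p : LpCochain (cayleyComplex n) p 1 →L[ℂ]
      lp (fun _ : FreeGroup (Fin n) × Fin n => ℂ) p)‖ := by
  refine ContinuousLinearMap.opNorm_le_bound _ (by positivity) fun x => ?_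
  refine le_of_forall_gt_imp_ge_of_dense fun c hc => ?_
  set C := ‖Θ‖ * ‖(edgeCoord n p : LpCochain (cayleyComplex n) p 1 →L[ℂ]
    lp (fun _ : FreeGroup (Fin n) × Fin n => ℂ) p)‖ with hC
  have hC0 : 0 ≤ C := by positivity
  obtain ⟨δ, hδ, hδc⟩ : ∃ δ > 0, C * (‖x‖ + δ) ≤ c := by
    refine ⟨(c - C * ‖x‖) / (C + 1), div_pos (sub_pos.2 hc) (by positivity), ?_⟩
    have : C * ((c - C * ‖x‖) / (C + 1)) ≤ c - C * ‖x‖ := by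
      rw [mul_div_assoc', div_le_iff₀ (by positivity)]
      nlinarith [sub_pos.2 hc]
    linarith
  obtain ⟨z, rfl, hz⟩ := Submodule.Quotient.norm_mk_lt x hδ
  refine le_trans ?_ hδc
  refine le_trans ?_ (mul_le_mul_of_nonneg_left hz.le hC0)
  exact ((Θ.comp (edgeCoord n p : LpCochain (cayleyComplex n) p 1 →L[ℂ]
    lp (fun _ : FreeGroup (Fin n) × Fin n => ℂ) p)).le_opNorm z.1).trans
    (mul_le_mul_of_nonneg_right (ContinuousLinearMap.opNorm_comp_le _ _) (norm_nonneg _))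

end Cohomology

/-! ### The dimension of the reduced cohomology -/

section CohomologyDimension

variable {n : ℕ} {p : ℝ≥0∞} [Fact (1 ≤ p)]

theorem continuous_reducedRep {Γ E : Type*} [Group Γ] [NormedAddCommGroup E] [NormedSpace ℂ E]
    {π : Representation ℂ Γ E} (hπ : ∀ g, Continuous (π g)) {Z B : Submodule ℂ E}
    (hZ : ∀ g, Z ≤ Z.comap (π g)) (hB : ∀ g, B ≤ B.comap (π g)) (g : Γ) :
    Continuous (reducedRep π hπ Z B hZ hB g) := by
  refine (Submodule.isQuotientMap_mkQL _).continuous_iff.2 ?_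
  change Continuous fun z : Z => Submodule.mkQL _ (⟨π g z.1, hZ g z.2⟩ : Z)
  exact (Submodule.mkQL _).continuous.comp
    (((hπ g).comp continuous_subtype_val).subtype_mk _)

theorem continuous_cohomologyRep (g : FreeGroup (Fin n)) :
    Continuous (cohomologyRep (cayleyComplex n) p 1 g) :=
  continuous_reducedRep (continuous_translation _ p 1) (cocycles_invariant _ p 1)
    (coboundaries_invariant _ p 1) g

/-- The classes of the edges at `1`. -/
def edgeClass (n : ℕ) (p : ℝ≥0∞) [Fact (1 ≤ p)] (j : Fin n) :
    LpCohomology (cayleyComplex n) p 1 :=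
  cohClass n p (lp.single p (1, j) 1)

theorem edgeClass_dense (hp : p ≠ ∞) :
    (Submodule.span ℂ {y | ∃ g j, y = cohomologyRep (cayleyComplex n) p 1 g
      (edgeClass n p j)}).topologicalClosure = ⊤ :=
  topologicalClosure_span_orbit_eq_top hp (cohClass n p) cohClass_surjective
    cohomologyRep_cohClass

/-- The coboundary of the indicator function of a vertex. -/
theorem edgeDiff_single (g : FreeGroup (Fin n)) :
    edgeDiff n p (lp.single p g 1) =
      ∑ j, (lp.single p (g * (FreeGroup.of j)⁻¹, j) 1 - lp.single p (g, j) 1) := by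
  refine lp.ext (funext fun q => ?_)
  obtain ⟨x, k⟩ := q
  rw [edgeDiff_apply, lp.coeFn_sum, Finset.sum_apply, Finset.sum_eq_single k]
  · simp only [lp.coeFn_sub, Pi.sub_apply, lp.single_apply, Pi.single_apply, Prod.mk.injEq,
      and_true, eq_mul_inv_iff_mul_eq]
  · intro j _ hj
    simp only [lp.coeFn_sub, Pi.sub_apply, lp.single_apply, Pi.single_apply, Prod.mk.injEq,
      hj.symm, and_false, if_false, sub_zero]
  · simp

theorem orbitComb_edgeClass :
    orbitComb (cohomologyRep (cayleyComplex n) p 1) (cycleRel n) (edgeClass n p) = 0 := by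
  rw [orbitComb_cycleRel, ← cohClass_edgeDiff (lp.single p 1 1), edgeDiff_single, map_sum]
  refine Finset.sum_congr rfl fun j _ => ?_
  rw [edgeClass, cohomologyRep_cohClass, cohomologyRep_cohClass, lpReindex_single,
    lpReindex_single, map_sub, leftShift_symm_apply, leftShift_symm_apply]
  simp

theorem upperDim_cohomology_le (hn : 1 ≤ n) (A : SoficApproximation (FreeGroup (Fin n)))
    (hp : p ≠ ∞) {S : ℕ → LpCohomology (cayleyComplex n) p 1}
    (hS : IsDynGenerating (cohomologyRep (cayleyComplex n) p 1) S) (ρ : ProductNorm) :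
    upperDim p A (cohomologyRep (cayleyComplex n) p 1) S ρ ≤ (n - 1 : ℕ) :=
  upperDim_le_of_model A continuous_cohomologyRep hS ρ (edgeClass n p) (edgeClass_dense hp)
    (cycleRel n) orbitComb_edgeClass (n - 1) fun _ hκ _ hθ => cycleRel_model hn A p hκ hθ

theorem rightShift_leftTranslate (c : FreeGroup (Fin n)) (g : FreeGroup (Fin n))
    (f : lp (fun _ : FreeGroup (Fin n) => ℂ) p) :
    rightShift p c (lpReindex p (Equiv.mulLeft g⁻¹) f) =
      lpReindex p (Equiv.mulLeft g⁻¹) (rightShift p c f) :=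
  lp.ext (funext fun _ => congrArg f (mul_assoc _ _ _).symm)

theorem avg_leftTranslate (b : Bool) (g : FreeGroup (Fin n))
    (f : lp (fun _ : FreeGroup (Fin n) => ℂ) p) :
    avg p n b (lpReindex p (Equiv.mulLeft g⁻¹) f) =
      lpReindex p (Equiv.mulLeft g⁻¹) (avg p n b f) := by
  simp only [avg, smul_apply, sum_apply, rightShift_leftTranslate, map_smul, map_sum]

theorem inverse_one_sub_avg_leftTranslate {b : Bool} (hu : IsUnit (1 - avg p n b))
    (g : FreeGroup (Fin n)) (f : lp (fun _ : FreeGroup (Fin n) => ℂ) p) :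
    Ring.inverse (1 - avg p n b) (lpReindex p (Equiv.mulLeft g⁻¹) f) =
      lpReindex p (Equiv.mulLeft g⁻¹) (Ring.inverse (1 - avg p n b) f) := by
  have h1 : ∀ f, Ring.inverse (1 - avg p n b) ((1 - avg p n b) f) = f := fun f =>
    congrArg (fun T : _ →L[ℂ] _ => T f) (Ring.inverse_mul_cancel _ hu)
  have h2 : ∀ f, (1 - avg p n b) (Ring.inverse (1 - avg p n b) f) = f := fun f =>
    congrArg (fun T : _ →L[ℂ] _ => T f) (Ring.mul_inverse_cancel _ hu)
  have h3 : ∀ f, (1 - avg p n b) (lpReindex p (Equiv.mulLeft g⁻¹) f) =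
      lpReindex p (Equiv.mulLeft g⁻¹) ((1 - avg p n b) f) := fun f => by
    simp only [sub_apply, one_apply_eq_self, avg_leftTranslate, map_sub]
  rw [← h1 (lpReindex p (Equiv.mulLeft g⁻¹) (Ring.inverse (1 - avg p n b) f)), h3, h2]

theorem lpColumn_leftShift {ι : Type*} (g : FreeGroup (Fin n)) (j : ι)
    (f : lp (fun _ : FreeGroup (Fin n) × ι => ℂ) p) :
    lpColumn p j (lpReindex p (leftShift ι g) f) =
      lpReindex p (Equiv.mulLeft g⁻¹) (lpColumn p j f) := rfl

theorem edgeDiff_leftTranslate (g : FreeGroup (Fin n))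
    (h : lp (fun _ : FreeGroup (Fin n) => ℂ) p) :
    edgeDiff n p (lpReindex p (Equiv.mulLeft g⁻¹) h) =
      lpReindex p (leftShift (Fin n) g) (edgeDiff n p h) := by
  refine lp.ext (funext fun q => ?_)
  rw [lpReindex_apply, edgeDiff_apply, edgeDiff_apply]
  simp [mul_assoc]

/-- The sum of the components of the coboundary of `h` is `-n (1 - M) h`. -/
theorem sum_lpColumn_edgeDiff (hn : 1 ≤ n) (h : lp (fun _ : FreeGroup (Fin n) => ℂ) p) :
    ∑ j, lpColumn p j (edgeDiff n p h) = -((n : ℂ) • (1 - avg p n false) h) := by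
  refine lp.ext (funext fun g => ?_)
  have hn0 : (n : ℂ) ≠ 0 := by exact_mod_cast (by omega : n ≠ 0)
  simp only [lp.coeFn_sum, Finset.sum_apply, lpColumn_apply, edgeDiff_apply, lp.coeFn_neg,
    lp.coeFn_smul, Pi.neg_apply, Pi.smul_apply, sub_apply, one_apply_eq_self,
    lp.coeFn_sub, Pi.sub_apply, avg_apply, letter_false, inv_inv, smul_eq_mul, mul_sub,
    mul_inv_cancel_left₀ hn0, Finset.sum_sub_distrib, Finset.sum_const, Finset.card_univ,
    Fintype.card_fin, nsmul_eq_mul, neg_sub]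

/-- The `l^p`-solution `h` of `∑_j (δh)_j = ∑_j f_j`. Here `Ring.inverse` is the inverse of `1 - M`
as soon as `1 - M` is invertible (and `0` otherwise). -/
def gaugeFix (n : ℕ) (p : ℝ≥0∞) [Fact (1 ≤ p)] :
    lp (fun _ : FreeGroup (Fin n) × Fin n => ℂ) p →L[ℂ] lp (fun _ : FreeGroup (Fin n) => ℂ) p :=
  -((n : ℂ)⁻¹ • (Ring.inverse (1 - avg p n false)).comp (∑ j, lpColumn p j))

theorem gaugeFix_apply (f : lp (fun _ : FreeGroup (Fin n) × Fin n => ℂ) p) :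
    gaugeFix n p f =
      -((n : ℂ)⁻¹ • Ring.inverse (1 - avg p n false) (∑ j, lpColumn p j f)) := by
  simp only [gaugeFix, neg_apply, smul_apply, ContinuousLinearMap.comp_apply, sum_apply]

theorem gaugeFix_edgeDiff (hn : 1 ≤ n) (hu : IsUnit (1 - avg p n false))
    (h : lp (fun _ : FreeGroup (Fin n) => ℂ) p) : gaugeFix n p (edgeDiff n p h) = h := by
  have hn0 : (n : ℂ) ≠ 0 := by exact_mod_cast (by omega : n ≠ 0)
  have h1 : Ring.inverse (1 - avg p n false) ((1 - avg p n false) h) = h :=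
    congrArg (fun T : _ →L[ℂ] _ => T h) (Ring.inverse_mul_cancel _ hu)
  rw [gaugeFix_apply, sum_lpColumn_edgeDiff hn, map_neg, map_smul, h1, smul_neg, neg_neg,
    inv_smul_smul₀ hn0]

theorem gaugeFix_leftShift (hu : IsUnit (1 - avg p n false)) (g : FreeGroup (Fin n))
    (f : lp (fun _ : FreeGroup (Fin n) × Fin n => ℂ) p) :
    gaugeFix n p (lpReindex p (leftShift (Fin n) g) f) =
      lpReindex p (Equiv.mulLeft g⁻¹) (gaugeFix n p f) := by
  simp only [gaugeFix_apply, lpColumn_leftShift, ← map_sum, inverse_one_sub_avg_leftTranslate hu,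
    map_neg, map_smul]

/-- For `1 < p ≤ 2` every class has a unique representative with `∑_j f_j = 0`, which identifies
`H^1_{l^p}` with `l^p(Γ)^{n-1}`. -/
theorem le_lowerDim_cohomology_of_one_lt (hn : 2 ≤ n) (A : SoficApproximation (FreeGroup (Fin n)))
    (hp1 : 1 < p) (hp2 : p ≤ 2) {S : ℕ → LpCohomology (cayleyComplex n) p 1}
    (hS : IsDynGenerating (cohomologyRep (cayleyComplex n) p 1) S) (ρ : ProductNorm) :
    ((n - 1 : ℕ) : ℝ≥0∞) ≤ lowerDim p A (cohomologyRep (cayleyComplex n) p 1) S ρ := by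
  have hp : p ≠ ∞ := (hp2.trans_lt (by simp)).ne
  have hu := isUnit_one_sub_avg (p := p) hn hp1 hp false
  obtain ⟨N, rfl⟩ : ∃ N, n = N + 1 := ⟨n - 1, by omega⟩
  rw [Nat.add_sub_cancel]
  have hinj : Function.Injective fun q : FreeGroup (Fin (N + 1)) × Fin N => (q.1, q.2.castSucc) :=
    fun q r h => by
      simp only [Prod.mk.injEq, Fin.castSucc_inj] at h
      exact Prod.ext h.1 h.2
  -- representatives whose components have sum zero are determined by the first ones
  let Θ₀ : lp (fun _ : FreeGroup (Fin (N + 1)) × Fin (N + 1) => ℂ) p →L[ℂ]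
      lp (fun _ : FreeGroup (Fin (N + 1)) × Fin N => ℂ) p :=
    (lpComp p _ hinj).comp (1 - (edgeDiff (N + 1) p).comp (gaugeFix (N + 1) p))
  have hΘ₀ : ∀ f, Θ₀ f = lpComp p _ hinj (f - edgeDiff (N + 1) p (gaugeFix (N + 1) p f)) :=
    fun f => rfl
  have hker : ∀ h, Θ₀ (edgeDiff (N + 1) p h) = 0 := fun h => by
    rw [hΘ₀, gaugeFix_edgeDiff (by omega) hu, sub_self, map_zero]
  refine le_lowerDim_of_lpMap (by omega) A hp2 hS ρ N (cohLift Θ₀ hker) (fun g x => ?_)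
    (fun j => cohClass (N + 1) p
      (lp.single p (1, j.castSucc) 1 - lp.single p (1, Fin.last N) 1)) fun j => ?_
  · obtain ⟨f, rfl⟩ := cohClass_surjective x
    rw [cohomologyRep_cohClass, cohLift_cohClass, cohLift_cohClass, hΘ₀, hΘ₀,
      gaugeFix_leftShift hu, edgeDiff_leftTranslate, ← map_sub]
    rfl
  · rw [cohLift_cohClass, hΘ₀]
    have h0 : gaugeFix (N + 1) p
        (lp.single p (1, j.castSucc) 1 - lp.single p (1, Fin.last N) 1) = 0 := by
      rw [gaugeFix_apply]
      have : ∑ k, lpColumn p k ((lp.single p ((1 : FreeGroup (Fin (N + 1))), j.castSucc) (1 : ℂ) -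
          lp.single p (1, Fin.last N) 1 : lp (fun _ => ℂ) p)) = 0 := by
        refine lp.ext (funext fun g => ?_)
        simp only [map_sub, Finset.sum_sub_distrib, lp.coeFn_sub, Pi.sub_apply, lp.coeFn_sum,
          Finset.sum_apply, lpColumn_apply, lp.single_apply, Pi.single_apply, Prod.mk.injEq,
          ite_and, Finset.sum_ite_irrel, Finset.sum_ite_eq', Finset.mem_univ, if_true,
          Finset.sum_const_zero, sub_self]
        rfl
      rw [this, map_zero, smul_zero, neg_zero]
    rw [h0, map_zero, sub_zero]
    refine lp.ext (funext fun q => ?_)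
    obtain ⟨g, k⟩ := q
    simp only [lpComp_apply, lp.coeFn_sub, Pi.sub_apply, lp.single_apply, Pi.single_apply,
      Prod.mk.injEq, Fin.castSucc_inj, (Fin.castSucc_lt_last k).ne, and_false, if_false, sub_zero]

end CohomologyDimension

/-! ### The reduced `l^1`-cohomology -/

section LOne

variable {n : ℕ}

theorem lp_one_summable_norm {κ : Type*} (f : lp (fun _ : κ => ℂ) 1) :
    Summable fun q => ‖f q‖ := by
  simpa using (lp.memℓp f).summable (by simp)

theorem lp_one_norm_eq_tsum {κ : Type*} (f : lp (fun _ : κ => ℂ) 1) : ‖f‖ = ∑' q, ‖f q‖ := by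
  rw [lp.norm_eq_tsum_rpow (by simp)]
  simp

section Map

variable {κ V : Type*} [NormedAddCommGroup V] [NormedSpace ℂ V] {v : κ → V} {C : ℝ}

theorem norm_smul_le_of_bounded (hv : ∀ q, ‖v q‖ ≤ C) (f : κ → ℂ) (q : κ) :
    ‖f q • v q‖ ≤ ‖f q‖ * C := by
  rw [norm_smul]
  exact mul_le_mul_of_nonneg_left (hv q) (norm_nonneg _)

theorem norm_tsum_smul_le (hv : ∀ q, ‖v q‖ ≤ C) (f : lp (fun _ : κ => ℂ) 1) :
    ‖∑' q, f q • v q‖ ≤ C * ‖f‖ := by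
  rw [lp_one_norm_eq_tsum, mul_comm, ← tsum_mul_right]
  exact tsum_of_norm_bounded ((lp_one_summable_norm f).mul_right C).hasSum
    (norm_smul_le_of_bounded hv f)

variable [CompleteSpace V]

theorem summable_smul_of_bounded (hv : ∀ q, ‖v q‖ ≤ C) (f : lp (fun _ : κ => ℂ) 1) :
    Summable fun q => f q • v q :=
  Summable.of_norm_bounded ((lp_one_summable_norm f).mul_right C) (norm_smul_le_of_bounded hv f)

/-- The map `l^1(κ) → V` that sends the basis vectors to the terms of a bounded family. -/
def lpOneMap (v : κ → V) (hv : ∀ q, ‖v q‖ ≤ C) : lp (fun _ : κ => ℂ) 1 →L[ℂ] V :=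
  LinearMap.mkContinuous
    { toFun := fun f => ∑' q, f q • v q
      map_add' := fun f g => by
        rw [← (summable_smul_of_bounded hv f).tsum_add (summable_smul_of_bounded hv g)]
        simp [add_smul]
      map_smul' := fun c f => by
        rw [RingHom.id_apply, ← (summable_smul_of_bounded hv f).tsum_const_smul]
        simp [mul_smul] } C (norm_tsum_smul_le hv)

theorem lpOneMap_single [DecidableEq κ] (v : κ → V) (hv : ∀ q, ‖v q‖ ≤ C) (q : κ) (c : ℂ) :
    lpOneMap v hv (lp.single 1 q c) = c • v q := by
  change ∑' r, (lp.single 1 q c : lp (fun _ : κ => ℂ) 1) r • v r = _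
  rw [tsum_eq_single q]
  · simp
  · intro r hr
    rw [lp.single_apply_ne _ _ _ hr, zero_smul]

theorem norm_lpOneMap_le (v : κ → V) (hC : 0 ≤ C) (hv : ∀ q, ‖v q‖ ≤ C) :
    ‖lpOneMap v hv‖ ≤ C :=
  LinearMap.mkContinuous_norm_le _ hC (norm_tsum_smul_le hv)

end Map

/-- The map `ξ ↦ (∑_j (φ(a_j)⁻¹ ξ_j - ξ_j), ξ|_B)` on families `ξ = (ξ_j)` in `l^1(d)`. -/
def cycleMap {d : ℕ} (φ : FreeGroup (Fin n) →* Equiv.Perm (Fin d)) (B : Finset (Fin d)) :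
    (Fin n → PiLp 1 (fun _ : Fin d => ℂ)) →ₗ[ℂ]
      PiLp 1 (fun _ : Fin d => ℂ) × (Fin n × B → ℂ) where
  toFun ξ := (∑ j, (permAct 1 (φ (FreeGroup.of j)⁻¹) (ξ j) - ξ j), fun q => ξ q.1 q.2)
  map_add' ξ ζ := Prod.ext (by
    change ∑ j, (permAct 1 (φ (FreeGroup.of j)⁻¹) (ξ j + ζ j) - (ξ j + ζ j)) =
      ∑ j, (permAct 1 (φ (FreeGroup.of j)⁻¹) (ξ j) - ξ j) +
        ∑ j, (permAct 1 (φ (FreeGroup.of j)⁻¹) (ζ j) - ζ j)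
    simp only [map_add, ← Finset.sum_add_distrib, add_sub_add_comm]) rfl
  map_smul' c ξ := Prod.ext (by
    change ∑ j, (permAct 1 (φ (FreeGroup.of j)⁻¹) (c • ξ j) - c • ξ j) =
      c • ∑ j, (permAct 1 (φ (FreeGroup.of j)⁻¹) (ξ j) - ξ j)
    simp only [map_smul, Finset.smul_sum, smul_sub]) rfl

/-- The families `(ξ_j)` with `∑_j (φ(a_j)⁻¹ ξ_j - ξ_j) = 0` that vanish on `B`. -/
def cycleSpace {d : ℕ} (φ : FreeGroup (Fin n) →* Equiv.Perm (Fin d)) (B : Finset (Fin d)) :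
    Submodule ℂ (Fin n → PiLp 1 (fun _ : Fin d => ℂ)) :=
  LinearMap.ker (cycleMap φ B)

section CycleSpace

variable {d : ℕ} {φ : FreeGroup (Fin n) →* Equiv.Perm (Fin d)} {B : Finset (Fin d)}
  {ξ : Fin n → PiLp 1 (fun _ : Fin d => ℂ)}

theorem sum_eq_zero_of_mem_cycleSpace (hξ : ξ ∈ cycleSpace φ B) :
    ∑ j, (permAct 1 (φ (FreeGroup.of j)⁻¹) (ξ j) - ξ j) = 0 :=
  congrArg Prod.fst (show cycleMap φ B ξ = 0 from hξ)

theorem apply_eq_zero_of_mem_cycleSpace (hξ : ξ ∈ cycleSpace φ B) (j : Fin n) {x : Fin d}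
    (hx : x ∈ B) : ξ j x = 0 :=
  congrFun (congrArg Prod.snd (show cycleMap φ B ξ = 0 from hξ)) (j, ⟨x, hx⟩)

theorem le_finrank_cycleSpace (φ : FreeGroup (Fin n) →* Equiv.Perm (Fin d))
    (B : Finset (Fin d)) :
    n * d ≤ Module.finrank ℂ (cycleSpace φ B) + (d + n * B.card) := by
  have h1 := LinearMap.finrank_range_add_finrank_ker (cycleMap φ B)
  have h2 := Submodule.finrank_le (LinearMap.range (cycleMap φ B))
  have h3 : Module.finrank ℂ (Fin n → PiLp 1 (fun _ : Fin d => ℂ)) = n * d := by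
    rw [(flatten 1 (Fin n) d).finrank_eq]
    simp
  have h4 : Module.finrank ℂ (PiLp 1 (fun _ : Fin d => ℂ) × (Fin n × B → ℂ)) =
      d + n * B.card := by
    rw [Module.finrank_prod, (WithLp.linearEquiv 1 ℂ (Fin d → ℂ)).finrank_eq]
    simp
  rw [cycleSpace]
  omega

end CycleSpace

/-- For `p = 1` the operator `1 - M` is not invertible. Instead, the test maps are
`f ↦ ∑ f(g, j) φ(g) ξ_j`, where `ξ` is a small cycle of the action `φ` of the free group on `l^1(d)`
supported on good points: the cycle equation says that the map vanishes on coboundaries. The cycles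
form a space of dimension about `(n - 1) d`, and `finrank_le_of_l1_close` bounds its width. -/
theorem le_lowerDim_cohomology_one (hn : 1 ≤ n) (A : SoficApproximation (FreeGroup (Fin n)))
    {S : ℕ → LpCohomology (cayleyComplex n) 1 1}
    (hS : IsDynGenerating (cohomologyRep (cayleyComplex n) 1 1) S) (ρ : ProductNorm) :
    ((n - 1 : ℕ) : ℝ≥0∞) ≤ lowerDim 1 A (cohomologyRep (cayleyComplex n) 1 1) S ρ := by
  classical
  have : Nontrivial (FreeGroup (Fin n)) :=
    ⟨(FreeGroup.of (⟨0, hn⟩ : Fin n))⁻¹, 1, by simp⟩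
  set M := ‖(edgeCoord n 1 : LpCochain (cayleyComplex n) 1 1 →L[ℂ]
    lp (fun _ : FreeGroup (Fin n) × Fin n => ℂ) 1)‖ with hM
  have hn0 : (0 : ℝ) < n := by exact_mod_cast hn
  refine le_lowerDim_of_model A A.eventually_pos hS ρ (edgeClass n 1) (n - 1) (B := M + 1)
    (by positivity) fun κ hκ => ⟨κ / (2 * n ^ 2), by positivity, fun Q η hη => ?_⟩
  -- finitely supported approximations of representatives of the vectors in `Q`
  have happrox : ∀ v : LpCohomology (cayleyComplex n) 1 1,
      ∃ (f : lp (fun _ : FreeGroup (Fin n) × Fin n => ℂ) 1)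
        (F : Finset (FreeGroup (Fin n) × Fin n)), cohClass n 1 f = v ∧
        ‖f - ∑ q ∈ F, lp.single 1 q (f q)‖ < η / 2 := fun v => by
    obtain ⟨f, rfl⟩ := cohClass_surjective v
    obtain ⟨F, hF⟩ := (Metric.tendsto_atTop.1 (lp.hasSum_single (by simp) f)) (η / 2) (half_pos hη)
    refine ⟨f, F, rfl, ?_⟩
    rw [← dist_eq_norm, dist_comm]
    exact hF F le_rfl
  choose rep F hrep hF using happrox
  let bad : ∀ i, Finset (Fin (A.d i)) := fun i => Q.biUnion fun q => (F q.2).biUnion fun r =>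
    Finset.univ.filter fun x => A.hom i r.1 x ∈
      Finset.univ.filter fun y => (q.1.map (A.σ i)).prod y ≠ A.hom i q.1.prod y
  have hbad : Negligible A.d bad :=
    Negligible.biUnion _ fun q _ => Negligible.biUnion _ fun r _ =>
      (A.negligible_word_ne q.1).preimage _
  filter_upwards [hbad.eventually_card_le (show 0 < κ / (2 * n) by positivity)] with i hi
  have hgood : ∀ x, x ∉ bad i → ∀ q ∈ Q, ∀ r ∈ F q.2,
      (q.1.map (A.σ i)).prod (A.hom i r.1 x) = A.hom i (q.1.prod * r.1) x := by
    intro x hx q hq r hr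
    by_contra hne
    refine hx (Finset.mem_biUnion.2 ⟨q, hq, Finset.mem_biUnion.2 ⟨r, hr, ?_⟩⟩)
    simpa using hne
  -- a map `l^1(Γ × n) → l^1(d)` for each cycle of the approximating action
  let orb (ξ : Fin n → PiLp 1 (fun _ : Fin (A.d i) => ℂ)) (q : FreeGroup (Fin n) × Fin n) :
    PiLp 1 (fun _ : Fin (A.d i) => ℂ) := permAct 1 (A.hom i q.1) (ξ q.2)
  have horb : ∀ ξ, (∀ j, ‖ξ j‖ ≤ 1) → ∀ q, ‖orb ξ q‖ ≤ 1 := fun ξ hξ q => by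
    rw [LinearIsometryEquiv.norm_map]
    exact hξ _
  have hker : ∀ ξ ∈ cycleSpace (A.hom i) (bad i), ∀ hξ : ∀ j, ‖ξ j‖ ≤ 1, ∀ h,
      lpOneMap (orb ξ) (horb ξ hξ) (edgeDiff n 1 h) = 0 := by
    intro ξ hZ hξ h
    have : (lpOneMap (orb ξ) (horb ξ hξ)).comp (edgeDiff n 1) = 0 := by
      refine lp.ext_continuousLinearMap (by simp) fun g => ContinuousLinearMap.ext_ring ?_
      change lpOneMap (orb ξ) (horb ξ hξ) (edgeDiff n 1 (lp.single 1 g 1)) = 0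
      rw [edgeDiff_single, map_sum]
      have h2 := congrArg (permAct 1 (A.hom i g)) (sum_eq_zero_of_mem_cycleSpace hZ)
      rw [map_zero, map_sum] at h2
      rw [← h2]
      refine Finset.sum_congr rfl fun j _ => ?_
      rw [map_sub, lpOneMap_single, lpOneMap_single, one_smul, one_smul, map_sub]
      simp only [orb, map_mul, permAct_mul]
    exact congrArg (fun T : _ →L[ℂ] _ => T h) this
  refine ⟨{T | ∃ (ξ : _) (hZ : ξ ∈ cycleSpace (A.hom i) (bad i)) (hξ : ∀ j, ‖ξ j‖ ≤ 1),
    T = cohLift (lpOneMap (orb ξ) (horb ξ hξ)) (hker ξ hZ hξ)}, ?_, ?_, ?_⟩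
  · rintro T ⟨ξ, hZ, hξ, rfl⟩
    refine (norm_cohLift_le _ _).trans ?_
    have := mul_le_mul_of_nonneg_right (norm_lpOneMap_le _ zero_le_one (horb ξ hξ))
      (norm_nonneg (edgeCoord n 1 : LpCochain (cayleyComplex n) 1 1 →L[ℂ]
        lp (fun _ : FreeGroup (Fin n) × Fin n => ℂ) 1))
    linarith
  · rintro T ⟨ξ, hZ, hξ, rfl⟩ ⟨w, v⟩ hq
    simp only
    have hv := hrep v
    have hFv := hF v
    have hg := fun r hr => fun x hx => hgood x hx (w, v) hq r hr
    simp only at hg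
    set f := rep v
    rw [← hv, cohomologyRep_cohClass, cohLift_cohClass, cohLift_cohClass]
    set f' := ∑ q ∈ F v, lp.single 1 q (f q) with hf'
    set s := lpOneMap (orb ξ) (horb ξ hξ) with hs
    have hsn : ‖s‖ ≤ 1 := norm_lpOneMap_le _ zero_le_one (horb ξ hξ)
    -- on finitely supported vectors the map is exactly equivariant
    have hexact : s (lpReindex 1 (leftShift (Fin n) w.prod) f') =
        permAct 1 (w.map (A.σ i)).prod (s f') := by
      rw [hf', map_sum, map_sum, map_sum, map_sum]
      refine Finset.sum_congr rfl fun r hr => ?_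
      obtain ⟨h, l⟩ := r
      rw [lpReindex_single, leftShift_symm_apply, hs, lpOneMap_single, lpOneMap_single, map_smul]
      congr 1
      refine PiLp.ext fun y => ?_
      simp only [orb]
      rw [← permAct_mul, permAct_apply, permAct_apply]
      -- the two points at which `ξ` is evaluated agree, or both are bad
      set τ := (w.map (A.σ i)).prod * A.hom i h with hτ
      set υ := A.hom i (w.prod * h) with hυ
      have hg' : ∀ x, x ∉ bad i → τ x = υ x := fun x hx => hg _ hr x hx
      by_cases h1 : υ⁻¹ y ∈ bad i
      · by_cases h2 : τ⁻¹ y ∈ bad i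
        · rw [apply_eq_zero_of_mem_cycleSpace hZ l h1, apply_eq_zero_of_mem_cycleSpace hZ l h2]
        · have : υ (τ⁻¹ y) = y := (hg' _ h2).symm.trans (τ.apply_symm_apply y)
          rw [← Equiv.Perm.inv_eq_iff_eq.2 this.symm]
      · have : τ (υ⁻¹ y) = y := (hg' _ h1).trans (υ.apply_symm_apply y)
        rw [← Equiv.Perm.inv_eq_iff_eq.2 this.symm]
    have e1 : ‖s (lpReindex 1 (leftShift (Fin n) w.prod) f) -
        s (lpReindex 1 (leftShift (Fin n) w.prod) f')‖ < η / 2 := by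
      rw [← map_sub, ← map_sub]
      refine (s.le_of_opNorm_le hsn _).trans_lt ?_
      rw [one_mul, LinearIsometry.norm_map]
      exact hFv
    have e2 : ‖permAct 1 (w.map (A.σ i)).prod (s f') -
        permAct 1 (w.map (A.σ i)).prod (s f)‖ < η / 2 := by
      rw [← map_sub, LinearIsometryEquiv.norm_map, ← map_sub]
      refine (s.le_of_opNorm_le hsn _).trans_lt ?_
      rw [one_mul, norm_sub_rev]
      exact hFv
    rw [← hexact] at e2
    exact (norm_sub_le_norm_sub_add_norm_sub _ _ _).trans_lt (by linarith)
  · intro W hW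
    set θ := κ / (2 * (n : ℝ) ^ 2) with hθ
    have hθ0 : 0 ≤ θ := by positivity
    have hmain := finrank_le_of_l1_close
      ((cycleSpace (A.hom i) (bad i)).map (flatten 1 (Fin n) (A.d i)).toLinearMap)
      (W.map (flatten 1 (Fin n) (A.d i)).toLinearMap) (θ := n * θ) (by positivity) (by
        rintro _ ⟨ξ, hZ, rfl⟩ h1
        have hnorm : ∀ ζ : PiLp 1 (fun _ : Fin (A.d i) => ℂ), ‖ζ‖ = ∑ x, ‖ζ x‖ := fun ζ => by
          rw [PiLp.norm_eq_sum (by simp)]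
          simp
        have h1' : ∑ j, ‖ξ j‖ ≤ 1 := by
          rw [Fintype.sum_prod_type] at h1
          simp only [hnorm]
          exact h1
        have hξ : ∀ j, ‖ξ j‖ ≤ 1 := fun j =>
          (Finset.single_le_sum (f := fun j => ‖ξ j‖) (fun _ _ => norm_nonneg _)
            (Finset.mem_univ j)).trans h1'
        obtain ⟨w, hw, hd⟩ := hW _ ⟨ξ, hZ, hξ, rfl⟩
        refine ⟨_, Submodule.mem_map_of_mem hw, ?_⟩
        have hTe : ∀ j, cohLift (lpOneMap (orb ξ) (horb ξ hξ)) (hker ξ hZ hξ) (edgeClass n 1 j) =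
            ξ j := fun j => by
          rw [edgeClass, cohLift_cohClass, lpOneMap_single, one_smul]
          simp only [orb, map_one, permAct_one]
        rw [Fintype.sum_prod_type]
        calc _ = ∑ j, ‖ξ j - w j‖ := by
              simp only [hnorm]
              rfl
          _ ≤ ∑ j : Fin n, θ := Finset.sum_le_sum fun j _ => by
              rw [← hTe j]
              exact hd j
          _ = n * θ := by simp)
    rw [LinearEquiv.finrank_map_eq, LinearEquiv.finrank_map_eq] at hmain
    have hZ : (n * A.d i : ℝ) ≤ Module.finrank ℂ (cycleSpace (A.hom i) (bad i)) +
        (A.d i + n * (bad i).card) := by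
      exact_mod_cast le_finrank_cycleSpace (A.hom i) (bad i)
    have hc : n * θ * (Fintype.card (Fin n × Fin (A.d i)) : ℝ) = κ / 2 * A.d i := by
      rw [Fintype.card_prod, Fintype.card_fin, Fintype.card_fin, hθ]
      push_cast
      field_simp
    have hb : (n : ℝ) * (bad i).card ≤ κ / 2 * A.d i := by
      calc _ ≤ (n : ℝ) * (κ / (2 * n) * A.d i) := by gcongr
        _ = _ := by field_simp
    rw [hc] at hmain
    push_cast [hn]
    linarith

end LOne

theorem cohomology_dimension {n : ℕ} (hn : 1 ≤ n) (A : SoficApproximation (FreeGroup (Fin n)))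
    {p : ℝ≥0∞} [Fact (1 ≤ p)] (hp2 : p ≤ 2) :
    HasUpperDim p A (cohomologyRep (cayleyComplex n) p 1) ((n - 1 : ℕ) : ℝ≥0∞) ∧
      HasLowerDim p A (cohomologyRep (cayleyComplex n) p 1) ((n - 1 : ℕ) : ℝ≥0∞) := by
  have hp : p ≠ ∞ := (hp2.trans_lt (by simp)).ne
  refine hasUpperDim_and_hasLowerDim (exists_isDynGenerating _ (edgeClass_dense hp))
    (fun S ρ hS => upperDim_cohomology_le hn A hp hS ρ) fun S ρ hS => ?_
  rcases (Fact.out : 1 ≤ p).eq_or_lt with rfl | hp1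
  · exact le_lowerDim_cohomology_one hn A hS ρ
  · rcases hn.eq_or_lt with rfl | hn2
    · simp
    · exact le_lowerDim_cohomology_of_one_lt hn2 A hp1 hp2 hS ρ

/-! ### Flows on the Cayley tree -/

section Flows

theorem lpCochain_subsingleton {n m : ℕ} {p : ℝ≥0∞} (hm : 2 ≤ m) :
    Subsingleton (LpCochain (cayleyComplex n) p m) :=
  ⟨fun _ _ => Subtype.ext (lp.ext (funext fun v => ((isEmpty_ordSimplex hm).false v).elim))⟩

theorem subsingleton_of_two_le {n m : ℕ} {p : ℝ≥0∞} [Fact (1 ≤ p)] (hm : 2 ≤ m) :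
    Subsingleton (LpCohomology (cayleyComplex n) p m) ∧
      Subsingleton (LpHomology (cayleyComplex n) p m) := by
  have := lpCochain_subsingleton (n := n) (p := p) hm
  exact ⟨(Submodule.mkQ_surjective _).subsingleton, (Submodule.mkQ_surjective _).subsingleton⟩

theorem boundaries_one {n : ℕ} {p : ℝ≥0∞} : boundaries (cayleyComplex n) p 1 = ⊥ := by
  have := lpCochain_subsingleton (n := n) (p := p) le_rfl
  refine (Submodule.eq_bot_iff _).2 ?_
  rintro f ⟨c, hc⟩
  rw [Subsingleton.elim c 0, map_zero] at hc
  exact Subtype.ext (lp.ext hc.symm)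

variable {n : ℕ} {p : ℝ≥0∞} [Fact (1 ≤ p)]

/-- The boundary in coordinates: `x ↦ ∑_j (f(x, j) - f(x a_j⁻¹, j))`. -/
def edgeDiv (n : ℕ) (p : ℝ≥0∞) [Fact (1 ≤ p)] :
    lp (fun _ : FreeGroup (Fin n) × Fin n => ℂ) p →L[ℂ] lp (fun _ : FreeGroup (Fin n) => ℂ) p :=
  ∑ j, (1 - rightShift p (letter j true)).comp (lpColumn p j)

theorem edgeDiv_apply (f : lp (fun _ : FreeGroup (Fin n) × Fin n => ℂ) p) (x : FreeGroup (Fin n)) :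
    edgeDiv n p f x = ∑ j, (f (x, j) - f (x * (FreeGroup.of j)⁻¹, j)) := by
  simp only [edgeDiv, sum_apply, lp.coeFn_sum, Finset.sum_apply, ContinuousLinearMap.comp_apply,
    sub_apply, one_apply_eq_self, lp.coeFn_sub, Pi.sub_apply, lpColumn_apply, rightShift_apply,
    letter_true]

theorem mem_cycles_iff {f : LpCochain (cayleyComplex n) p 1} :
    f ∈ cycles (cayleyComplex n) p 1 ↔ edgeDiv n p (edgeCoord n p f) = 0 := by
  have h : ∀ x, boundary (cayleyComplex n) 0 (LpCochain.fn _ _ _ f) (vtx x) =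
      edgeDiv n p (edgeCoord n p f) x := fun x => by
    rw [boundary_vtx, edgeDiv_apply]
    refine Finset.sum_congr rfl fun j _ => ?_
    change f.1 (posEdge _) + f.1 (negEdge _) = f.1 (posEdge _) - f.1 (posEdge _)
    rw [cochain_negEdge, sub_eq_add_neg]
  constructor
  · intro hf
    refine lp.ext (funext fun x => (h x).symm.trans ?_)
    exact congrFun (show boundary (cayleyComplex n) 0 (LpCochain.fn _ _ _ f) = 0 from hf) (vtx x)
  · intro hf
    refine funext fun v => ?_
    obtain ⟨x, rfl⟩ := vtx_surjective v
    refine (h x).trans ?_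
    rw [hf]
    rfl

theorem lpHomology_subsingleton (h : cycles (cayleyComplex n) p 1 = ⊥) :
    Subsingleton (LpHomology (cayleyComplex n) p 1) := by
  have : Subsingleton (cycles (cayleyComplex n) p 1) := by
    rw [h]
    infer_instance
  exact (Submodule.mkQ_surjective _).subsingleton

theorem startsWith_unique {z : FreeGroup (Fin n)} {c d : Fin n × Bool}
    (hc : z ∈ FreeGroup.startsWith c) (hd : z ∈ FreeGroup.startsWith d) : c = d := by
  have h1 : z.toWord[0]? = some c := hc
  have h2 : z.toWord[0]? = some d := hd
  rw [h1] at h2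
  exact Option.some.inj h2

theorem mk_cons_mem_startsWith {c : Fin n × Bool} {t : List (Fin n × Bool)}
    (h : FreeGroup.IsReduced (c :: t)) : FreeGroup.mk (c :: t) ∈ FreeGroup.startsWith c := by
  simp [FreeGroup.startsWith, FreeGroup.toWord_mk, h.reduce_eq]

theorem mk_cons_mul_mem_startsWith (d : Fin n × Bool) (t : List (Fin n × Bool)) :
    ∀ c, FreeGroup.IsReduced (c :: t) → FreeGroup.mk (c :: t) * FreeGroup.mk [d] = 1 ∨
      FreeGroup.mk (c :: t) * FreeGroup.mk [d] ∈ FreeGroup.startsWith c := by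
  induction t with
  | nil =>
    intro c _
    rw [mk_mul_mem_startsWith_iff, or_iff_not_imp_right, not_not]
    intro h
    have h1 := startsWith_unique (mk_cons_mem_startsWith (by simp)) h
    rw [h1, FreeGroup.mul_mk]
    exact Quot.sound (FreeGroup.Red.Step.cons_not (x := c.1) (b := c.2) (L := []))
  | cons c' t ih =>
    intro c hc
    obtain ⟨h1, h2⟩ := FreeGroup.isReduced_cons_cons.1 hc
    have hsplit : FreeGroup.mk (c :: c' :: t) * FreeGroup.mk [d] =
        FreeGroup.mk [c] * (FreeGroup.mk (c' :: t) * FreeGroup.mk [d]) := by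
      simp only [FreeGroup.mul_mk, List.cons_append, List.nil_append]
    right
    rw [hsplit]
    rcases ih c' h2 with h | h
    · rw [h, mul_one]
      exact mk_cons_mem_startsWith (by simp)
    · rw [mk_mul_mem_startsWith_iff]
      intro h'
      have := startsWith_unique h h'
      subst this
      simp at h1

/-- Multiplication by a letter on the right does not change the first letter, unless it cancels the
word. -/
theorem mul_mk_mem_startsWith {c : Fin n × Bool} {z : FreeGroup (Fin n)} (d : Fin n × Bool)
    (hz : z ∈ FreeGroup.startsWith c) :
    z * FreeGroup.mk [d] = 1 ∨ z * FreeGroup.mk [d] ∈ FreeGroup.startsWith c := by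
  have hred : FreeGroup.IsReduced z.toWord := FreeGroup.isReduced_toWord
  rcases hL : z.toWord with - | ⟨a, t⟩
  · simp [FreeGroup.startsWith, hL] at hz
  · have ha : a = c := by simpa [FreeGroup.startsWith, hL] using hz
    subst ha
    rw [hL] at hred
    rw [← z.mk_toWord, hL]
    exact mk_cons_mul_mem_startsWith d t a hred

/-- The only edge between the elements whose reduced word starts with `a_j` and the others is the
edge from `1` to `a_j`. -/
theorem mul_of_mem_startsWith_iff {j k : Fin n} {z : FreeGroup (Fin n)}
    (h : ¬ (z = 1 ∧ k = j)) :
    z * FreeGroup.of k ∈ FreeGroup.startsWith (j, true) ↔ z ∈ FreeGroup.startsWith (j, true) := by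
  constructor
  · intro hz
    rcases mul_mk_mem_startsWith (k, false) hz with h1 | h1 <;>
      rw [show FreeGroup.mk [(k, false)] = (FreeGroup.of k)⁻¹ from letter_false k,
        mul_inv_cancel_right] at h1
    · refine absurd ⟨h1, ?_⟩ h
      rw [h1, one_mul] at hz
      have : FreeGroup.of k ∈ FreeGroup.startsWith (k, true) := mk_cons_mem_startsWith (by simp)
      exact congrArg Prod.fst (startsWith_unique this hz)
    · exact h1
  · intro hz
    rcases mul_mk_mem_startsWith (k, true) hz with h1 | h1
    · have h2 : z = FreeGroup.mk [(k, false)] := by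
        rw [show FreeGroup.mk [(k, false)] = (FreeGroup.of k)⁻¹ from letter_false k]
        exact eq_inv_of_mul_eq_one_left h1
      rw [h2] at hz
      have h3 := startsWith_unique (mk_cons_mem_startsWith (by simp)) hz
      simp at h3
    · exact h1

/-- An `l^1`-flow on the tree vanishes: its value at an edge is its total flux into the half of the
tree on the far side of the edge. -/
theorem eq_zero_of_edgeDiv_eq_zero {f : lp (fun _ : FreeGroup (Fin n) × Fin n => ℂ) 1}
    (hf : edgeDiv n 1 f = 0) : f = 0 := by
  classical
  refine lp.ext (funext fun q => ?_)
  obtain ⟨x, j⟩ := q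
  have hs : Summable fun q => ‖f q‖ := lp_one_summable_norm f
  let χ : FreeGroup (Fin n) → ℂ := fun y =>
    if x⁻¹ * y ∈ FreeGroup.startsWith (j, true) then 1 else 0
  have hχ : ∀ y, ‖χ y‖ ≤ 1 := fun y => by
    simp only [χ]
    split_ifs <;> simp
  have hsum : ∀ u : FreeGroup (Fin n) × Fin n → FreeGroup (Fin n),
      Summable fun q => χ (u q) * f q := fun u =>
    Summable.of_norm_bounded hs fun q => by
      rw [norm_mul]
      exact mul_le_of_le_one_left (norm_nonneg _) (hχ _)
  -- `(y, k) ↦ (y a_k⁻¹, k)`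
  let e : FreeGroup (Fin n) × Fin n ≃ FreeGroup (Fin n) × Fin n :=
    { toFun := fun q => (q.1 * (FreeGroup.of q.2)⁻¹, q.2)
      invFun := fun q => (q.1 * FreeGroup.of q.2, q.2)
      left_inv := fun q => by simp
      right_inv := fun q => by simp }
  have h1 : ∑' q : FreeGroup (Fin n) × Fin n,
      (χ q.1 * f q - χ (q.1 * FreeGroup.of q.2) * f q) = -f (x, j) := by
    rw [tsum_eq_single (x, j)]
    · have h1 : x⁻¹ * x ∉ FreeGroup.startsWith (j, true) := by simp [FreeGroup.startsWith]
      have h2 : x⁻¹ * (x * FreeGroup.of j) ∈ FreeGroup.startsWith (j, true) := by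
        rw [inv_mul_cancel_left]
        exact mk_cons_mem_startsWith (by simp)
      simp only [χ, if_neg h1, if_pos h2]
      ring
    · rintro ⟨y, k⟩ hne
      have : ¬ (x⁻¹ * y = 1 ∧ k = j) := by
        rintro ⟨h, rfl⟩
        exact hne (by rw [inv_mul_eq_one.1 h])
      have h2 : χ (y * FreeGroup.of k) = χ y := by
        simp only [χ, ← mul_assoc, mul_of_mem_startsWith_iff this]
      simp only
      rw [h2, sub_self]
  have h2 : ∑' q : FreeGroup (Fin n) × Fin n, χ (q.1 * FreeGroup.of q.2) * f q =
      ∑' q : FreeGroup (Fin n) × Fin n, χ q.1 * f (q.1 * (FreeGroup.of q.2)⁻¹, q.2) := by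
    rw [← e.tsum_eq]
    refine tsum_congr fun q => ?_
    simp [e]
  have hs2 : Summable fun q : FreeGroup (Fin n) × Fin n =>
      χ q.1 * f (q.1 * (FreeGroup.of q.2)⁻¹, q.2) := by
    have := (e.summable_iff (f := fun q => χ (q.1 * FreeGroup.of q.2) * f q)).2 (hsum _)
    refine this.congr fun q => ?_
    simp [e]
  have h3 : ∑' q : FreeGroup (Fin n) × Fin n,
      (χ q.1 * f q - χ q.1 * f (q.1 * (FreeGroup.of q.2)⁻¹, q.2)) = 0 := by
    have hs3 := (hsum Prod.fst).sub hs2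
    rw [hs3.tsum_prod]
    refine (tsum_congr fun y => ?_).trans tsum_zero
    rw [tsum_fintype]
    simp only [← mul_sub, ← Finset.mul_sum]
    rw [← edgeDiv_apply, hf]
    simp
  rw [(hsum _).tsum_sub (hsum _), h2, ← (hsum Prod.fst).tsum_sub hs2, h3] at h1
  exact (neg_eq_zero.1 h1.symm)

theorem cycles_one_eq_bot : cycles (cayleyComplex n) 1 1 = ⊥ := by
  refine (Submodule.eq_bot_iff _).2 fun f hf => (edgeCoord n 1).injective ?_
  rw [eq_zero_of_edgeDiv_eq_zero (mem_cycles_iff.1 hf), map_zero]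

/-- For `n = 1` a flow is constant along an infinite orbit, hence zero. -/
theorem cycles_eq_bot_of_rank_one (hp : p ≠ ∞) : cycles (cayleyComplex 1) p 1 = ⊥ := by
  refine (Submodule.eq_bot_iff _).2 fun c hc => (edgeCoord 1 p).injective ?_
  have hf := mem_cycles_iff.1 hc
  set f := edgeCoord 1 p c
  rw [map_zero]
  have hinv : ∀ x, f (x * FreeGroup.of 0, 0) = f (x, 0) := fun x => by
    have h := congrArg (fun h : lp (fun _ : FreeGroup (Fin 1) => ℂ) p => h (x * FreeGroup.of 0)) hf
    simp only [edgeDiv_apply, Finset.univ_unique, Finset.sum_singleton, Fin.default_eq_zero,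
      mul_inv_cancel_right] at h
    exact sub_eq_zero.1 h
  have hpow : ∀ x (k : ℕ), f (x * FreeGroup.of 0 ^ k, 0) = f (x, 0) := fun x k => by
    induction k with
    | zero => rw [pow_zero, mul_one]
    | succ k ih => rw [pow_succ, ← mul_assoc, hinv, ih]
  have hp0 : 0 < p.toReal := zero_lt_one.trans_le (one_le_toReal hp)
  refine lp.ext (funext fun q => ?_)
  obtain ⟨x, j⟩ := q
  obtain rfl : j = 0 := Subsingleton.elim _ _
  have hinj : Function.Injective fun k : ℕ => (x * FreeGroup.of (0 : Fin 1) ^ k, (0 : Fin 1)) := by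
    intro k l h
    simp only [Prod.mk.injEq, mul_right_inj, and_true] at h
    have := congrArg (FreeGroup.lift fun _ : Fin 1 => Multiplicative.ofAdd (1 : ℤ)) h
    simp only [map_pow, FreeGroup.lift_apply_of] at this
    have h2 := congrArg Multiplicative.toAdd this
    simpa using h2
  have hs := ((lp.memℓp f).summable hp0).comp_injective hinj
  have hs' : Summable fun _ : ℕ => ‖f (x, 0)‖ ^ p.toReal :=
    hs.congr fun k => by simp only [Function.comp_apply, hpow]
  have h0 := (summable_const_iff _).1 hs'
  rw [Real.rpow_eq_zero (norm_nonneg _) hp0.ne', norm_eq_zero] at h0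
  exact h0

end Flows

/-! ### The dimension of the reduced homology -/

section HomologyDimension

/-- A representation generated by `N` vectors has dimension at most `N`. -/
theorem upperDim_le_of_generators {Γ X : Type*} [Group Γ] [NormedAddCommGroup X]
    [NormedSpace ℂ X] {p : ℝ≥0∞} [Fact (1 ≤ p)] {π : Representation ℂ Γ X} {S : ℕ → X}
    (A : SoficApproximation Γ) (hπ : ∀ g, Continuous (π g)) (hS : IsDynGenerating π S)
    (ρ : ProductNorm) {N : ℕ} (e : Fin N → X)
    (he : (Submodule.span ℂ {y | ∃ g j, y = π g (e j)}).topologicalClosure = ⊤) :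
    upperDim p A π S ρ ≤ N := by
  refine upperDim_le_of_model A hπ hS ρ e he 0 (by simp) N fun κ hκ θ hθ =>
    ⟨1, one_pos, Eventually.of_forall fun i => ⟨⊤, ?_, fun ξ _ => ⟨ξ, trivial, fun j => ?_⟩⟩⟩
  · rw [finrank_top, (flatten p (Fin N) (A.d i)).finrank_eq, finrank_euclideanSpace,
      Fintype.card_prod, Fintype.card_fin, Fintype.card_fin, Nat.cast_mul]
    gcongr
    linarith
  · rw [sub_self, norm_zero]
    exact hθ.le

variable {p : ℝ≥0∞} [Fact (1 ≤ p)]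

theorem continuous_homologyRep {n : ℕ} (g : FreeGroup (Fin n)) :
    Continuous (homologyRep (cayleyComplex n) p 1 g) :=
  continuous_reducedRep (continuous_translation _ p 1) (cycles_invariant _ p 1)
    (boundaries_invariant _ p 1) g

/-- The function `(g, j) ↦ h(g)`. -/
def lpDiag (ι : Type*) [Fintype ι] {Γ : Type*} (p : ℝ≥0∞) [Fact (1 ≤ p)] :
    lp (fun _ : Γ => ℂ) p →L[ℂ] lp (fun _ : Γ × ι => ℂ) p :=
  ∑ j, lpInsert p j

theorem lpDiag_apply {ι : Type*} [Fintype ι] {Γ : Type*} (h : lp (fun _ : Γ => ℂ) p)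
    (q : Γ × ι) : lpDiag ι p h q = h q.1 := by
  classical
  simp only [lpDiag, sum_apply, lp.coeFn_sum, Finset.sum_apply, lpInsert_apply]
  rw [Finset.sum_ite_eq Finset.univ q.2, if_pos (Finset.mem_univ _)]

theorem edgeDiv_lpDiag {n : ℕ} (hn : 1 ≤ n) (h : lp (fun _ : FreeGroup (Fin n) => ℂ) p) :
    edgeDiv n p (lpDiag (Fin n) p h) = (n : ℂ) • (1 - avg p n true) h := by
  have hn0 : (n : ℂ) ≠ 0 := by exact_mod_cast (by omega : n ≠ 0)
  refine lp.ext (funext fun x => ?_)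
  simp only [edgeDiv_apply, lpDiag_apply, lp.coeFn_smul, Pi.smul_apply, sub_apply,
    one_apply_eq_self, lp.coeFn_sub, Pi.sub_apply, avg_apply, letter_true, smul_eq_mul, mul_sub,
    mul_inv_cancel_left₀ hn0, Finset.sum_sub_distrib, Finset.sum_const, Finset.card_univ,
    Fintype.card_fin, nsmul_eq_mul]

theorem edgeDiv_leftShift {n : ℕ} (g : FreeGroup (Fin n))
    (f : lp (fun _ : FreeGroup (Fin n) × Fin n => ℂ) p) :
    edgeDiv n p (lpReindex p (leftShift (Fin n) g) f) =
      lpReindex p (Equiv.mulLeft g⁻¹) (edgeDiv n p f) := by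
  refine lp.ext (funext fun x => ?_)
  rw [lpReindex_apply, edgeDiv_apply, edgeDiv_apply]
  simp [mul_assoc]

variable {N : ℕ}

theorem prodMap_castSucc_injective {Γ : Type*} (N : ℕ) :
    Function.Injective fun q : Γ × Fin N => (q.1, q.2.castSucc) := fun q r h => by
  simp only [Prod.mk.injEq, Fin.castSucc_inj] at h
  exact Prod.ext h.1 h.2

/-- `(f_0, …, f_{N-1}) ↦ (f_0, …, f_{N-1}, 0)`. -/
def lpPad {Γ : Type*} (N : ℕ) (p : ℝ≥0∞) [Fact (1 ≤ p)] :
    lp (fun _ : Γ × Fin N => ℂ) p →L[ℂ] lp (fun _ : Γ × Fin (N + 1) => ℂ) p :=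
  lpExtend p _ (prodMap_castSucc_injective N)

theorem lpPad_castSucc {Γ : Type*} (k : lp (fun _ : Γ × Fin N => ℂ) p) (g : Γ) (j : Fin N) :
    lpPad N p k (g, j.castSucc) = k (g, j) :=
  lpExtend_apply (prodMap_castSucc_injective N) k (g, j)

theorem lpPad_last {Γ : Type*} (k : lp (fun _ : Γ × Fin N => ℂ) p) (g : Γ) :
    lpPad N p k (g, Fin.last N) = 0 := by
  refine lpExtend_apply_of_notMem (prodMap_castSucc_injective N) k ?_
  rintro ⟨r, hr⟩
  exact (Fin.castSucc_lt_last r.2).ne (congrArg Prod.snd hr)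

theorem lpPad_leftShift {Γ : Type*} [Group Γ] (g : Γ) (k : lp (fun _ : Γ × Fin N => ℂ) p) :
    lpPad N p (lpReindex p (leftShift (Fin N) g) k) =
      lpReindex p (leftShift (Fin (N + 1)) g) (lpPad N p k) := by
  refine lp.ext (funext fun q => ?_)
  obtain ⟨h, j⟩ := q
  induction j using Fin.lastCases with
  | last =>
    rw [lpPad_last]
    exact (lpPad_last k (g⁻¹ * h)).symm
  | cast j =>
    rw [lpPad_castSucc]
    exact (lpPad_castSucc k (g⁻¹ * h) j).symm

/-- The flow whose components differ from the last one by `k_0, …, k_{N-1}`: a function is added to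
all components of `(k, 0)` so as to make the divergence zero. -/
def flowOfDiff (N : ℕ) (p : ℝ≥0∞) [Fact (1 ≤ p)] :
    lp (fun _ : FreeGroup (Fin (N + 1)) × Fin N => ℂ) p →L[ℂ]
      lp (fun _ : FreeGroup (Fin (N + 1)) × Fin (N + 1) => ℂ) p :=
  lpPad N p - (((N + 1 : ℕ) : ℂ)⁻¹ • (lpDiag (Fin (N + 1)) p).comp
    ((Ring.inverse (1 - avg p (N + 1) true)).comp ((edgeDiv (N + 1) p).comp (lpPad N p))))

theorem flowOfDiff_apply (k : lp (fun _ : FreeGroup (Fin (N + 1)) × Fin N => ℂ) p) :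
    flowOfDiff N p k = lpPad N p k - ((N + 1 : ℕ) : ℂ)⁻¹ • lpDiag (Fin (N + 1)) p
      (Ring.inverse (1 - avg p (N + 1) true) (edgeDiv (N + 1) p (lpPad N p k))) := rfl

theorem edgeDiv_flowOfDiff (hu : IsUnit (1 - avg p (N + 1) true))
    (k : lp (fun _ : FreeGroup (Fin (N + 1)) × Fin N => ℂ) p) :
    edgeDiv (N + 1) p (flowOfDiff N p k) = 0 := by
  have h2 : ∀ f, (1 - avg p (N + 1) true) (Ring.inverse (1 - avg p (N + 1) true) f) = f :=
    fun f => congrArg (fun T : _ →L[ℂ] _ => T f) (Ring.mul_inverse_cancel _ hu)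
  rw [flowOfDiff_apply, map_sub, map_smul, edgeDiv_lpDiag (by omega), h2,
    inv_smul_smul₀ (by exact_mod_cast N.succ_ne_zero), sub_self]

theorem flowOfDiff_leftShift (hu : IsUnit (1 - avg p (N + 1) true)) (g : FreeGroup (Fin (N + 1)))
    (k : lp (fun _ : FreeGroup (Fin (N + 1)) × Fin N => ℂ) p) :
    flowOfDiff N p (lpReindex p (leftShift (Fin N) g) k) =
      lpReindex p (leftShift (Fin (N + 1)) g) (flowOfDiff N p k) := by
  have hd : ∀ h : lp (fun _ : FreeGroup (Fin (N + 1)) => ℂ) p,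
      lpDiag (Fin (N + 1)) p (lpReindex p (Equiv.mulLeft g⁻¹) h) =
        lpReindex p (leftShift (Fin (N + 1)) g) (lpDiag (Fin (N + 1)) p h) := fun h =>
    lp.ext (funext fun q => by
      rw [lpReindex_apply, lpDiag_apply, lpDiag_apply]
      rfl)
  rw [flowOfDiff_apply, flowOfDiff_apply, lpPad_leftShift, edgeDiv_leftShift,
    inverse_one_sub_avg_leftTranslate hu, hd, map_sub, map_smul]

/-- `(f_0, …, f_N) ↦ (f_0 - f_N, …, f_{N-1} - f_N)`. -/
def lpDiff {Γ : Type*} (N : ℕ) (p : ℝ≥0∞) [Fact (1 ≤ p)] :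
    lp (fun _ : Γ × Fin (N + 1) => ℂ) p →L[ℂ] lp (fun _ : Γ × Fin N => ℂ) p :=
  lpComp p _ (prodMap_castSucc_injective N) - (lpDiag (Fin N) p).comp (lpColumn p (Fin.last N))

theorem lpDiff_apply {Γ : Type*} (f : lp (fun _ : Γ × Fin (N + 1) => ℂ) p) (q : Γ × Fin N) :
    lpDiff N p f q = f (q.1, q.2.castSucc) - f (q.1, Fin.last N) := by
  simp only [lpDiff, sub_apply, lp.coeFn_sub, Pi.sub_apply, ContinuousLinearMap.comp_apply,
    lpDiag_apply, lpColumn_apply, lpComp_apply]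

theorem lpDiff_flowOfDiff (k : lp (fun _ : FreeGroup (Fin (N + 1)) × Fin N => ℂ) p) :
    lpDiff N p (flowOfDiff N p k) = k := by
  refine lp.ext (funext fun q => ?_)
  rw [lpDiff_apply, flowOfDiff_apply]
  simp only [lp.coeFn_sub, Pi.sub_apply, lp.coeFn_smul, Pi.smul_apply, lpDiag_apply,
    lpPad_castSucc, lpPad_last]
  ring

theorem flowOfDiff_lpDiff (hu : IsUnit (1 - avg p (N + 1) true))
    {f : lp (fun _ : FreeGroup (Fin (N + 1)) × Fin (N + 1) => ℂ) p}
    (hf : edgeDiv (N + 1) p f = 0) : flowOfDiff N p (lpDiff N p f) = f := by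
  have h1 : ∀ h, Ring.inverse (1 - avg p (N + 1) true) ((1 - avg p (N + 1) true) h) = h :=
    fun h => congrArg (fun T : _ →L[ℂ] _ => T h) (Ring.inverse_mul_cancel _ hu)
  have hpad : lpPad N p (lpDiff N p f) =
      f - lpDiag (Fin (N + 1)) p (lpColumn p (Fin.last N) f) := by
    refine lp.ext (funext fun q => ?_)
    obtain ⟨g, j⟩ := q
    rw [lp.coeFn_sub, Pi.sub_apply, lpDiag_apply, lpColumn_apply]
    induction j using Fin.lastCases with
    | last => rw [lpPad_last, sub_self]
    | cast j => rw [lpPad_castSucc, lpDiff_apply]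
  rw [flowOfDiff_apply, hpad, map_sub, hf, zero_sub, edgeDiv_lpDiag (by omega), map_neg, map_smul,
    h1, map_neg, map_smul, smul_neg, inv_smul_smul₀ (by exact_mod_cast N.succ_ne_zero)]
  abel

/-- The class in `H_1^{l^p}` of the flow with given differences of its components. -/
def homClass (hu : IsUnit (1 - avg p (N + 1) true)) :
    lp (fun _ : FreeGroup (Fin (N + 1)) × Fin N => ℂ) p →L[ℂ]
      LpHomology (cayleyComplex (N + 1)) p 1 :=
  (Submodule.mkQL _).comp ((((edgeCoord (N + 1) p).symm : _ →L[ℂ] _).comp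
    (flowOfDiff N p)).codRestrict (cycles (cayleyComplex (N + 1)) p 1) fun k =>
      mem_cycles_iff.2 (((edgeCoord (N + 1) p).apply_symm_apply _).symm ▸ edgeDiv_flowOfDiff hu k))

theorem homClass_surjective (hu : IsUnit (1 - avg p (N + 1) true)) :
    Function.Surjective (homClass hu) := fun x => by
  obtain ⟨z, rfl⟩ := Submodule.mkQ_surjective _ x
  refine ⟨lpDiff N p (edgeCoord (N + 1) p z.1), ?_⟩
  change Submodule.mkQ _ _ = _
  congr 1
  refine Subtype.ext ?_
  change (edgeCoord (N + 1) p).symm (flowOfDiff N p _) = z.1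
  rw [flowOfDiff_lpDiff hu (mem_cycles_iff.1 z.2), ContinuousLinearEquiv.symm_apply_apply]

theorem homologyRep_homClass (hu : IsUnit (1 - avg p (N + 1) true)) (g : FreeGroup (Fin (N + 1)))
    (k : lp (fun _ : FreeGroup (Fin (N + 1)) × Fin N => ℂ) p) :
    homologyRep (cayleyComplex (N + 1)) p 1 g (homClass hu k) =
      homClass hu (lpReindex p (leftShift (Fin N) g) k) := by
  change Submodule.mkQ _ _ = Submodule.mkQ _ _
  congr 1
  exact Subtype.ext ((edgeCoord_symm_translation p g _).trans
    (congrArg (edgeCoord (N + 1) p).symm (flowOfDiff_leftShift hu g k).symm))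

/-- The differences of the components of a flow; there are no boundaries to divide by. -/
def homDiff (N : ℕ) (p : ℝ≥0∞) [Fact (1 ≤ p)] :
    LpHomology (cayleyComplex (N + 1)) p 1 →L[ℂ]
      lp (fun _ : FreeGroup (Fin (N + 1)) × Fin N => ℂ) p :=
  Submodule.liftQL _ (((lpDiff N p).comp (edgeCoord (N + 1) p : _ →L[ℂ] _)).comp
    (cycles (cayleyComplex (N + 1)) p 1).subtypeL) fun z hz => by
    have hz' : z.1 ∈ (boundaries (cayleyComplex (N + 1)) p 1).topologicalClosure := hz
    rw [boundaries_one, IsClosed.submodule_topologicalClosure_eq isClosed_singleton,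
      Submodule.mem_bot] at hz'
    change lpDiff N p (edgeCoord (N + 1) p z.1) = 0
    rw [hz', map_zero, map_zero]

theorem homDiff_homClass (hu : IsUnit (1 - avg p (N + 1) true))
    (k : lp (fun _ : FreeGroup (Fin (N + 1)) × Fin N => ℂ) p) :
    homDiff N p (homClass hu k) = k := by
  change lpDiff N p (edgeCoord (N + 1) p ((edgeCoord (N + 1) p).symm (flowOfDiff N p k))) = k
  rw [ContinuousLinearEquiv.apply_symm_apply, lpDiff_flowOfDiff]

/-- A flow is determined by the differences of its components, which are arbitrary: this identifies
`H_1^{l^p}` with `l^p(Γ)^N`. -/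
theorem homology_dimension (A : SoficApproximation (FreeGroup (Fin (N + 1)))) (hp1 : 1 < p)
    (hp2 : p ≤ 2) :
    HasUpperDim p A (homologyRep (cayleyComplex (N + 1)) p 1) N ∧
      HasLowerDim p A (homologyRep (cayleyComplex (N + 1)) p 1) N := by
  classical
  have hp : p ≠ ∞ := (hp2.trans_lt (by simp)).ne
  rcases Nat.eq_zero_or_pos N with rfl | hN
  · have := lpHomology_subsingleton (cycles_eq_bot_of_rank_one hp)
    let e : Fin 0 → LpHomology (cayleyComplex 1) p 1 := fun _ => 0
    have he : (Submodule.span ℂ {y | ∃ g j, y =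
        homologyRep (cayleyComplex 1) p 1 g (e j)}).topologicalClosure = ⊤ :=
      Subsingleton.elim _ _
    refine hasUpperDim_and_hasLowerDim (exists_isDynGenerating e he) (fun S ρ hS => ?_)
      fun S ρ hS => by simp
    exact upperDim_le_of_generators A continuous_homologyRep hS ρ e he
  · have hu := isUnit_one_sub_avg (p := p) (show 2 ≤ N + 1 by omega) hp1 hp true
    have he := topologicalClosure_span_orbit_eq_top (π := homologyRep (cayleyComplex (N + 1)) p 1)
      hp (homClass hu) (homClass_surjective hu) (homologyRep_homClass hu)
    refine hasUpperDim_and_hasLowerDim (exists_isDynGenerating _ he)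
      (fun S ρ hS => upperDim_le_of_generators A continuous_homologyRep hS ρ _ he)
      fun S ρ hS => le_lowerDim_of_lpMap (by omega) A hp2 hS ρ N (homDiff N p) (fun g x => ?_)
        _ fun j => homDiff_homClass hu _
    obtain ⟨k, rfl⟩ := homClass_surjective hu x
    rw [homologyRep_homClass, homDiff_homClass, homDiff_homClass]

end HomologyDimension

end LpBetti

end

theorem mainTheorem3 (n : ℕ) (hn : 1 ≤ n)
    (A : LpBetti.SoficApproximation (FreeGroup (Fin n))) :
    (∀ (p : ℝ≥0∞) [Fact (1 ≤ p)], p ≤ 2 →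
      LpBetti.HasUpperDim p A (LpBetti.cohomologyRep (LpBetti.cayleyComplex n) p 1)
          ((n - 1 : ℕ) : ℝ≥0∞) ∧
        LpBetti.HasLowerDim p A (LpBetti.cohomologyRep (LpBetti.cayleyComplex n) p 1)
          ((n - 1 : ℕ) : ℝ≥0∞)) ∧
    (∀ (p : ℝ≥0∞) [Fact (1 ≤ p)], 1 < p → p < 2 →
      LpBetti.HasUpperDim p A (LpBetti.homologyRep (LpBetti.cayleyComplex n) p 1)
          ((n - 1 : ℕ) : ℝ≥0∞) ∧
        LpBetti.HasLowerDim p A (LpBetti.homologyRep (LpBetti.cayleyComplex n) p 1)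
          ((n - 1 : ℕ) : ℝ≥0∞)) ∧
    (LpBetti.cycles (LpBetti.cayleyComplex n) 1 1 = ⊥ ∧
      Subsingleton (LpBetti.LpHomology (LpBetti.cayleyComplex n) 1 1)) ∧
    (∀ (p : ℝ≥0∞) [Fact (1 ≤ p)], p < ∞ → ∀ m : ℕ, 2 ≤ m →
      Subsingleton (LpBetti.LpCohomology (LpBetti.cayleyComplex n) p m) ∧
        Subsingleton (LpBetti.LpHomology (LpBetti.cayleyComplex n) p m)) := by
  refine ⟨fun p _ hp2 => LpBetti.cohomology_dimension hn A hp2, fun p _ hp1 hp2 => ?_,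
    ⟨LpBetti.cycles_one_eq_bot, LpBetti.lpHomology_subsingleton LpBetti.cycles_one_eq_bot⟩,
    fun p _ _ m hm => LpBetti.subsingleton_of_two_le hm⟩
  obtain ⟨N, rfl⟩ : ∃ N, n = N + 1 := ⟨n - 1, by omega⟩
  exact LpBetti.homology_dimension A hp1 hp2.le
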